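/- Let $q\in\mathbb{C}$ be such that $q^2$ is a root of unity of order $\ell\ge 3$. For $n\ge 0$ let $TL_n(q)$ be the Temperley–Lieb algebra: the associative $\mathbb{C}$-algebra with generators $f_1,\dots,f_{n-1}$ and relations $f_i^2=-(q+q^{-1})f_i$, $f_if_{i\pm1}f_i=f_i$, and $f_if_j=f_jf_i$ if $|i-j|\ge 2$. For $t\ge 0$ let $W_t(n)$ be the cell module of $TL_n(q)$, with basis the monic Temperley–Lieb diagrams $D:t\to n$ (planar pairings of $t$ bottom and $n$ top points in which every bottom point is joined to a top point); $f_i$ acts by composition of diagrams, where each closed loop contributes the factor $-(q+q^{-1})$ and non-monic diagrams are set to $0$. Let $(\cdot,\cdot)_t$ be the bilinear form on $W_t(n)$ such that, for monic diagrams $D_1,D_2:t\to n$, $D_1^*D_2=(D_1,D_2)_t\,\mathrm{id}_t$ if $D_1^*D_2$ is a multiple of $\mathrm{id}_t$, and $(D_1,D_2)_t=0$ otherwise, where $D^*$ is the reflection of $D$ in a horizontal line. Its radical $\mathrm{Rad}_t$ is a submodule; put $L_t(n)=W_t(n)/\mathrm{Rad}_t$. There is a unique nonzero idempotent $E_{\ell-1}\in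 TL_{\ell-1}(q)$ such that $f_iE_{\ell-1}=E_{\ell-1}f_i=0$ for $1\le i\le \ell-2$ (the Jones–Wenzl idempotent). For $n\ge \ell-1$ let $Q_n(\ell)=TL_n(q)/\langle E_{\ell-1}\rangle$ be the quotient by the two-sided ideal generated by the image of $E_{\ell-1}$ under $TL_{\ell-1}(q)\to TL_n(q)$, $f_i\mapsto f_i$. 1. Let $n\ge\ell-1$. For all $t$ with $0\le t\le n$ and $t\equiv n \pmod 2$, the $TL_n(q)$-module $L_t(n)$ is simple, and its module structure descends to that of a (simple) $Q_n(\ell)$-module if and only if $t\le \ell-2$. Every simple $Q_n(\ell)$-module is isomorphic to $L_t(n)$ for exactly one $t$ with $0\le t\le\min(n,\ell-2)$ and $t\equiv n\pmod 2$. 2. Define $p_1(x)=p_2(x)=1$ and $p_{i+1}(x)=p_i(x)-x\,p_{i-1}(x)$ for $i\ge 2$. Then $p_\ell(x)$ is invertible in $\mathbb{Z}[[x]]$, and for $0\le t\le \ell-2$ $$\sum_{k=0}^{\infty}\dim_{\mathbb{C}} L_t(t+2k)\,x^k=\frac{p_{\ell-1-t}(x)}{p_\ell(x)}.$$ -/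

import Mathlib

open scoped Polynomial PowerSeries

noncomputable section

/-! ### The Temperley-Lieb algebra by generators and relations -/

/-- The value `-(q + q⁻¹)` of a closed loop. -/
def loopValue (q : ℂ) : ℂ := -(q + q⁻¹)

/-- The defining relations of `TL_n(q)`. The generators `f_1, …, f_{n-1}` are indexed from `0` by
`Fin (n - 1)`. -/
inductive TLRel (q : ℂ) (n : ℕ) :
    FreeAlgebra ℂ (Fin (n - 1)) → FreeAlgebra ℂ (Fin (n - 1)) → Prop
  | sq (i : Fin (n - 1)) :
      TLRel q n (FreeAlgebra.ι ℂ i * FreeAlgebra.ι ℂ i) (loopValue q • FreeAlgebra.ι ℂ i)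
  | braid (i j : Fin (n - 1)) (h : i.val + 1 = j.val ∨ j.val + 1 = i.val) :
      TLRel q n (FreeAlgebra.ι ℂ i * FreeAlgebra.ι ℂ j * FreeAlgebra.ι ℂ i) (FreeAlgebra.ι ℂ i)
  | comm (i j : Fin (n - 1)) (h : i.val + 2 ≤ j.val ∨ j.val + 2 ≤ i.val) :
      TLRel q n (FreeAlgebra.ι ℂ i * FreeAlgebra.ι ℂ j) (FreeAlgebra.ι ℂ j * FreeAlgebra.ι ℂ i)

/-- The Temperley-Lieb algebra `TL_n(q)` over `ℂ`. -/
def TL (q : ℂ) (n : ℕ) : Type := RingQuot (TLRel q n)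

namespace TL

instance (q : ℂ) (n : ℕ) : Ring (TL q n) := inferInstanceAs (Ring (RingQuot (TLRel q n)))

instance (q : ℂ) (n : ℕ) : Algebra ℂ (TL q n) :=
  inferInstanceAs (Algebra ℂ (RingQuot (TLRel q n)))

/-- The generators of `TL_n(q)`. -/
def gen (q : ℂ) {n : ℕ} (i : Fin (n - 1)) : TL q n :=
  RingQuot.mkAlgHom ℂ (TLRel q n) (FreeAlgebra.ι ℂ i)

theorem gen_sq (q : ℂ) {n : ℕ} (i : Fin (n - 1)) :
    gen q i * gen q i = loopValue q • gen q i := by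
  have h := RingQuot.mkAlgHom_rel ℂ (TLRel.sq (q := q) i)
  rw [map_mul, map_smul] at h
  exact h

theorem gen_braid (q : ℂ) {n : ℕ} (i j : Fin (n - 1))
    (h : i.val + 1 = j.val ∨ j.val + 1 = i.val) :
    gen q i * gen q j * gen q i = gen q i := by
  have h := RingQuot.mkAlgHom_rel ℂ (TLRel.braid (q := q) i j h)
  rw [map_mul, map_mul] at h
  exact h

theorem gen_comm (q : ℂ) {n : ℕ} (i j : Fin (n - 1))
    (h : i.val + 2 ≤ j.val ∨ j.val + 2 ≤ i.val) :
    gen q i * gen q j = gen q j * gen q i := by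
  have h := RingQuot.mkAlgHom_rel ℂ (TLRel.comm (q := q) i j h)
  rw [map_mul, map_mul] at h
  exact h

/-- The algebra homomorphism out of `TL_n(q)` defined by images of the generators that satisfy
the relations. -/
def lift {q : ℂ} {n : ℕ} {A : Type*} [Ring A] [Algebra ℂ A] (F : Fin (n - 1) → A)
    (hsq : ∀ i, F i * F i = loopValue q • F i)
    (hbraid : ∀ i j : Fin (n - 1), (i.val + 1 = j.val ∨ j.val + 1 = i.val) →
      F i * F j * F i = F i)
    (hcomm : ∀ i j : Fin (n - 1), (i.val + 2 ≤ j.val ∨ j.val + 2 ≤ i.val) →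
      F i * F j = F j * F i) : TL q n →ₐ[ℂ] A :=
  RingQuot.liftAlgHom ℂ ⟨FreeAlgebra.lift ℂ F, by
    intro x y h
    induction h with
    | sq i => simp [hsq]
    | braid i j h => simp [hbraid i j h]
    | comm i j h => simp [hcomm i j h]⟩

theorem lift_gen {q : ℂ} {n : ℕ} {A : Type*} [Ring A] [Algebra ℂ A] (F : Fin (n - 1) → A)
    (hsq : ∀ i, F i * F i = loopValue q • F i)
    (hbraid : ∀ i j : Fin (n - 1), (i.val + 1 = j.val ∨ j.val + 1 = i.val) →
      F i * F j * F i = F i)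
    (hcomm : ∀ i j : Fin (n - 1), (i.val + 2 ≤ j.val ∨ j.val + 2 ≤ i.val) →
      F i * F j = F j * F i) (i : Fin (n - 1)) :
    lift F hsq hbraid hcomm (gen q i) = F i := by
  unfold lift gen
  erw [RingQuot.liftAlgHom_mkAlgHom_apply]
  simp

theorem induction {q : ℂ} {n : ℕ} {P : TL q n → Prop}
    (scalar : ∀ c : ℂ, P (algebraMap ℂ (TL q n) c)) (gen : ∀ i, P (gen q i))
    (mul : ∀ a b, P a → P b → P (a * b)) (add : ∀ a b, P a → P b → P (a + b))
    (a : TL q n) : P a := by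
  obtain ⟨x, rfl⟩ := RingQuot.mkAlgHom_surjective ℂ (TLRel q n) a
  induction x using FreeAlgebra.induction with
  | grade0 r =>
    have h := scalar r
    exact (congrArg P ((RingQuot.mkAlgHom ℂ (TLRel q n)).commutes r)).mpr h
  | grade1 i => exact gen i
  | mul a b ha hb => rw [map_mul]; exact mul _ _ ha hb
  | add a b ha hb => rw [map_add]; exact add _ _ ha hb

/-- The map `TL_m(q) → TL_n(q)`, `f_i ↦ f_i`, for `m ≤ n`. -/
def incl (q : ℂ) {m n : ℕ} (h : m ≤ n) : TL q m →ₐ[ℂ] TL q n :=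
  lift (fun i => gen q (Fin.castLE (Nat.sub_le_sub_right h 1) i))
    (fun _ => gen_sq q _) (fun _ _ hij => gen_braid q _ _ hij) (fun _ _ hij => gen_comm q _ _ hij)

end TL

/-! ### The Jones-Wenzl idempotent and the Jones quotient -/

/-- `E` is a Jones-Wenzl idempotent of `TL_m(q)`: a nonzero idempotent killed by every generator
from the left and from the right. -/
structure IsJonesWenzl {q : ℂ} {m : ℕ} (E : TL q m) : Prop where
  ne_zero : E ≠ 0
  idem : E * E = E
  gen_mul : ∀ i : Fin (m - 1), TL.gen q i * E = 0
  mul_gen : ∀ i : Fin (m - 1), E * TL.gen q i = 0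

/-- The two-sided ideal of `TL_n(q)` generated by the image of `E ∈ TL_m(q)`, `m ≤ n`. -/
def jonesIdeal {q : ℂ} {m n : ℕ} (h : m ≤ n) (E : TL q m) : TwoSidedIdeal (TL q n) :=
  TwoSidedIdeal.span {TL.incl q h E}

/-- The quotient of `TL_n(q)` by the two-sided ideal generated by `E ∈ TL_m(q)`, `m ≤ n`. -/
abbrev JonesQuotient {q : ℂ} {m n : ℕ} (h : m ≤ n) (E : TL q m) : Type :=
  (jonesIdeal h E).ringCon.Quotient

/-- The canonical surjection from `TL_n(q)` to the quotient. -/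
def jonesMk {q : ℂ} {m n : ℕ} (h : m ≤ n) (E : TL q m) : TL q n →+* JonesQuotient h E :=
  (jonesIdeal h E).ringCon.mk'

/-- The `TL_n(q)`-module `N` is isomorphic to the pullback of the module `M` of the quotient algebra
along the canonical surjection. -/
def IsInflation {q : ℂ} {m n : ℕ} (h : m ≤ n) (E : TL q m)
    (M : Type*) [AddCommGroup M] [Module (JonesQuotient h E) M]
    (N : Type*) [AddCommGroup N] [Module (TL q n) N] : Prop :=
  ∃ e : M ≃+ N, ∀ (a : TL q n) (x : M), e (jonesMk h E a • x) = a • e x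

/-! ### Auxiliary facts on pairings -/

section Reconnect

variable {P : Type*} [DecidableEq P]

/-- Given a pairing `s`, join `a` to `b` and the former partners of `a` and `b` to each other (if
`a` and `b` were not joined already), and keep all other pairs. -/
def reconnect (a b : P) (s : P → P) (x : P) : P :=
  if x = a then b else if x = b then a else if x = s a then s b else if x = s b then s a else s x

theorem reconnect_invol {a b : P} {s : P → P} (h1 : ∀ x, s (s x) = x) (h2 : ∀ x, s x ≠ x)
    (x : P) : reconnect a b s (reconnect a b s x) = x := by
  simp only [reconnect]; grind

theorem reconnect_ne {a b : P} {s : P → P} (h1 : ∀ x, s (s x) = x) (h2 : ∀ x, s x ≠ x)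
    (hab : a ≠ b) (x : P) : reconnect a b s x ≠ x := by
  simp only [reconnect]; grind

theorem reconnect_left {a b : P} {s : P → P} : reconnect a b s a = b := by simp [reconnect]

theorem reconnect_reconnect {a b : P} {s : P → P} (h1 : ∀ x, s (s x) = x) (h2 : ∀ x, s x ≠ x)
    (hab : a ≠ b) (x : P) : reconnect a b (reconnect a b s) x = reconnect a b s x := by
  obtain ⟨f, hf⟩ : ∃ f, f = reconnect a b s := ⟨_, rfl⟩
  have f1 : ∀ x, f (f x) = x := by simp only [hf, reconnect]; grind
  have f3 : f a = b := by simp [hf, reconnect]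
  rw [← hf, reconnect]
  grind

theorem reconnect_braid {a b c : P} {s : P → P} (h1 : ∀ x, s (s x) = x) (h2 : ∀ x, s x ≠ x)
   (hab : a ≠ b) (hbc : b ≠ c) (hac : a ≠ c) (x : P) : reconnect a b (reconnect b c (reconnect a b s)) x = reconnect a b s x := by
  obtain ⟨f, hf⟩ : ∃ f, f = reconnect a b s := ⟨_, rfl⟩
  have f1 : ∀ x, f (f x) = x := by simp only [hf, reconnect]; grind
  have f2 : ∀ x, f x ≠ x := by simp only [hf, reconnect]; grind
  have f3 : f a = b := by simp [hf, reconnect]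
  rw [← hf]
  clear hf
  have e1 : reconnect b c f a = f c := by simp only [reconnect]; grind
  have e2 : reconnect b c f b = c := by simp only [reconnect]; grind
  rw [reconnect, e1, e2, reconnect]
  grind

theorem reconnect_braid' {a b c : P} {s : P → P} (h1 : ∀ x, s (s x) = x) (h2 : ∀ x, s x ≠ x)
   (hab : a ≠ b) (hbc : b ≠ c) (hac : a ≠ c) (x : P) : reconnect b c (reconnect a b (reconnect b c s)) x = reconnect b c s x := by
  obtain ⟨f, hf⟩ : ∃ f, f = reconnect b c s := ⟨_, rfl⟩
  have f1 : ∀ x, f (f x) = x := by simp only [hf, reconnect]; grind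
  have f2 : ∀ x, f x ≠ x := by simp only [hf, reconnect]; grind
  have f3 : f b = c := by simp [hf, reconnect]
  rw [← hf]
  clear hf
  have e1 : reconnect a b f b = a := by simp only [reconnect]; grind
  have e2 : reconnect a b f c = f a := by simp only [reconnect]; grind
  rw [reconnect, e1, e2, reconnect]
  grind

theorem reconnect_comm {a b c d : P} {s : P → P} (h1 : ∀ x, s (s x) = x) (h2 : ∀ x, s x ≠ x)
   (hab : a ≠ b) (hcd : c ≠ d) (h5 : a ≠ c) (h6 : a ≠ d) (h7 : b ≠ c) (h8 : b ≠ d) (x : P) :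
   reconnect a b (reconnect c d s) x = reconnect c d (reconnect a b s) x := by
  by_cases k : s a = b
  · have h : ∀ y, reconnect a b s y = s y := by simp only [reconnect]; grind
    have e1 : reconnect c d s a = b := by simp only [reconnect]; grind
    have e2 : reconnect c d s b = a := by simp only [reconnect]; grind
    rw [reconnect, e1, e2, funext h]
    simp only [reconnect]; grind
  by_cases k' : s c = d
  · have h : ∀ y, reconnect c d s y = s y := by simp only [reconnect]; grind
    have e1 : reconnect a b s c = d := by simp only [reconnect]; grind
    have e2 : reconnect a b s d = c := by simp only [reconnect]; grind
    rw [reconnect.eq_1 c d, e1, e2, funext h]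
    simp only [reconnect]; grind
  by_cases k1 : s a = c
  · have e1 : reconnect c d s a = s d := by simp only [reconnect]; grind
    have e2 : reconnect a b s c = s b := by simp only [reconnect]; grind
    by_cases k3 : s b = d
    · have e3 : reconnect c d s b = a := by simp only [reconnect]; grind
      have e4 : reconnect a b s d = c := by simp only [reconnect]; grind
      rw [reconnect, reconnect.eq_1 c d (reconnect a b s), e1, e2, e3, e4, reconnect, reconnect]; grind
    · have e3 : reconnect c d s b = s b := by simp only [reconnect]; grind
      have e4 : reconnect a b s d = s d := by simp only [reconnect]; grind
      rw [reconnect, reconnect.eq_1 c d (reconnect a b s), e1, e2, e3, e4, reconnect, reconnect]; grind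
  by_cases k2 : s a = d
  · have e1 : reconnect c d s a = s c := by simp only [reconnect]; grind
    have e2 : reconnect a b s d = s b := by simp only [reconnect]; grind
    by_cases k3 : s b = c
    · have e3 : reconnect c d s b = a := by simp only [reconnect]; grind
      have e4 : reconnect a b s c = d := by simp only [reconnect]; grind
      rw [reconnect, reconnect.eq_1 c d (reconnect a b s), e1, e2, e3, e4, reconnect, reconnect]; grind
    · have e3 : reconnect c d s b = s b := by simp only [reconnect]; grind
      have e4 : reconnect a b s c = s c := by simp only [reconnect]; grind
      rw [reconnect, reconnect.eq_1 c d (reconnect a b s), e1, e2, e3, e4, reconnect, reconnect]; grind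
  have e1 : reconnect c d s a = s a := by simp only [reconnect]; grind
  by_cases k3 : s b = c
  · have e2 : reconnect a b s c = s a := by simp only [reconnect]; grind
    have e3 : reconnect c d s b = s d := by simp only [reconnect]; grind
    have e4 : reconnect a b s d = s d := by simp only [reconnect]; grind
    rw [reconnect, reconnect.eq_1 c d (reconnect a b s), e1, e2, e3, e4, reconnect, reconnect]; grind
  have e2 : reconnect a b s c = s c := by simp only [reconnect]; grind
  by_cases k4 : s b = d
  · have e3 : reconnect c d s b = s c := by simp only [reconnect]; grind
    have e4 : reconnect a b s d = s a := by simp only [reconnect]; grind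
    rw [reconnect, reconnect.eq_1 c d (reconnect a b s), e1, e2, e3, e4, reconnect, reconnect]; grind
  have e3 : reconnect c d s b = s b := by simp only [reconnect]; grind
  have e4 : reconnect a b s d = s d := by simp only [reconnect]; grind
  rw [reconnect, reconnect.eq_1 c d (reconnect a b s), e1, e2, e3, e4, reconnect, reconnect]; grind

theorem reconnect_far {a b c d : P} {s : P → P} (h1 : ∀ x, s (s x) = x) (h2 : ∀ x, s x ≠ x)
   (hab : a ≠ b) (hcd : c ≠ d) (h5 : a ≠ c) (h6 : a ≠ d) (h7 : b ≠ c) (h8 : b ≠ d) :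
   reconnect a b s c = d ↔ s c = d ∨ (s a = c ∧ s b = d) ∨ (s a = d ∧ s b = c) := by
  simp only [reconnect]; grind

theorem reconnect_val {a b : P} {s : P → P} (h1 : ∀ x, s (s x) = x) (hab : a ≠ b) (z : P) :
    (z = a ∧ reconnect a b s z = b) ∨ (z = b ∧ reconnect a b s z = a) ∨
      (z = s a ∧ z ≠ b ∧ reconnect a b s z = s b) ∨ (z = s b ∧ z ≠ a ∧ reconnect a b s z = s a) ∨
      (z ≠ a ∧ z ≠ b ∧ s z ≠ a ∧ s z ≠ b ∧ reconnect a b s z = s z) := by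
  by_cases za : z = a
  · exact .inl ⟨za, by rw [reconnect, if_pos za]⟩
  by_cases zb : z = b
  · exact .inr (.inl ⟨zb, by rw [reconnect, if_neg za, if_pos zb]⟩)
  by_cases zc : z = s a
  · exact .inr (.inr (.inl ⟨zc, zb, by rw [reconnect, if_neg za, if_neg zb, if_pos zc]⟩))
  by_cases zd : z = s b
  · exact .inr (.inr (.inr (.inl ⟨zd, za,
      by rw [reconnect, if_neg za, if_neg zb, if_neg zc, if_pos zd]⟩)))
  exact .inr (.inr (.inr (.inr ⟨za, zb, fun h => zc (by rw [← h, h1]),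
    fun h => zd (by rw [← h, h1]), by rw [reconnect, if_neg za, if_neg zb, if_neg zc, if_neg zd]⟩)))

theorem reconnect_planar {a b : P} {s : P → P} (h1 : ∀ x, s (s x) = x) (h2 : ∀ x, s x ≠ x) (hab : a ≠ b)
    {pos : P → ℤ} (hpos : Function.Injective pos) (h : pos b = pos a + 1)
    (pl : ∀ x y, ¬ (pos x < pos y ∧ pos y < pos (s x) ∧ pos (s x) < pos (s y))) (x y : P) :
    ¬ (pos x < pos y ∧ pos y < pos (reconnect a b s x) ∧ pos (reconnect a b s x) < pos (reconnect a b s y)) := by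
  have key : ∀ u v, u ≠ v → pos u ≠ pos v := fun u v huv h => huv (hpos h)
  have arc : ∀ z, z ≠ a → z ≠ b → s z ≠ a → s z ≠ b → pos z < pos (s z) →
      ((pos z < pos (s a) ∧ pos (s a) < pos (s z)) ↔
        (pos z < pos (s b) ∧ pos (s b) < pos (s z))) := by
    have side : ∀ p z, p ≠ z → p ≠ s z → (pos z < pos p ∧ pos p < pos (s z)) →
        (pos z < pos (s p) ∧ pos (s p) < pos (s z)) := by
      intro p z hpz hpz' h
      have e1 := pl z p
      have e2 := pl (s p) z
      rw [h1] at e2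
      have e3 := key (s p) z (by grind)
      have e4 := key (s p) (s z) (by grind)
      omega
    intro z z1 z2 z3 z4 hz
    have a1 := side a z (by grind) (by grind)
    have a2 := side (s a) z (by grind) (by grind)
    have a3 := side b z (by grind) (by grind)
    have a4 := side (s b) z (by grind) (by grind)
    rw [h1] at a2 a4
    have b1 := key _ _ z1
    have b2 := key _ _ z2
    have b3 := key _ _ z3
    have b4 := key _ _ z4
    omega
  have e := pl x y
  have ax := arc x
  have ay := arc y
  have val := reconnect_val (s := s) (a := a) (b := b) h1 hab
  clear arc pl
  rcases val x with ⟨x1, x2⟩ | ⟨x1, x2⟩ | ⟨x1, x3, x2⟩ | ⟨x1, x3, x2⟩ | ⟨x1, x3, x4, x5, x2⟩ <;>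
  rcases val y with ⟨y1, y2⟩ | ⟨y1, y2⟩ | ⟨y1, y3, y2⟩ | ⟨y1, y3, y2⟩ | ⟨y1, y3, y4, y5, y2⟩ <;>
  rw [x2, y2] <;> (try simp only [x1, y1]) <;> (try simp only [x1, h1] at ax e) <;>
    (try simp only [y1, h1] at ay e) <;> grind

end Reconnect

section Glue

theorem bool_cases {s s' : Bool} (hs : s' ≠ s) (r : Bool) : r = s ∨ r = s' := by
  revert hs r s s'; decide

variable {P V : Type*} (ι : Bool → P → V)

/-- The equivalence relation generated on the points of two pictures, indexed by `Bool` and drawn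
on a common set of points by `ι`, by joining `x` to `σ s x` in the picture `s`. Its classes are the
connected components of the superposition. -/
def glueSetoid (σ : Bool → P → P) : Setoid V :=
  Relation.EqvGen.setoid fun u v => ∃ s x, u = ι s x ∧ v = ι s (σ s x)

variable {ι}

theorem glue_edge (σ : Bool → P → P) (s : Bool) (x : P) :
    glueSetoid ι σ (ι s x) (ι s (σ s x)) := Relation.EqvGen.rel _ _ ⟨s, x, rfl, rfl⟩

theorem glue_lift {σ : Bool → P → P} {T : Setoid V} (ψ : V → V)
    (h : ∀ s x, T (ψ (ι s x)) (ψ (ι s (σ s x)))) {u v : V} (huv : glueSetoid ι σ u v) :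
    T (ψ u) (ψ v) := by
  induction huv with
  | rel u v h' => obtain ⟨s, x, rfl, rfl⟩ := h'; exact h s x
  | refl u => exact T.refl _
  | symm u v _ ih => exact T.symm ih
  | trans u v w _ _ ih1 ih2 => exact T.trans ih1 ih2

theorem glue_transfer [DecidableEq P] [DecidableEq V] {a b : P} {A B : V} {σ : Bool → P → P}
    (hA : ∀ s, ι s a = A) (hB : ∀ s, ι s b = B)
    (hι : ∀ s, Function.Injective (ι s)) (hab : a ≠ b)
    (h1 : ∀ s x, σ s (σ s x) = x) (h2 : ∀ s x, σ s x ≠ x) {s s' : Bool} (hs : s' ≠ s) {u v : V}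
    (hu : u ≠ A ∧ u ≠ B) (hv : v ≠ A ∧ v ≠ B)
    (h : glueSetoid ι (Function.update σ s (reconnect a b (σ s))) u v) :
    glueSetoid ι (Function.update σ s' (reconnect a b (σ s'))) u v := by
  have hs' : ∀ r, r = s ∨ r = s' := fun r => bool_cases hs r
  have hAι : ∀ r x, ι r x = A ↔ x = a := fun r x => by rw [← hA r, (hι r).eq_iff]
  have hBι : ∀ r x, ι r x = B ↔ x = b := fun r x => by rw [← hB r, (hι r).eq_iff]
  set T := glueSetoid ι (Function.update σ s' (reconnect a b (σ s'))) with hT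
  have es : ∀ x, T (ι s x) (ι s (σ s x)) := fun x => by
    have := glue_edge (ι := ι) (Function.update σ s' (reconnect a b (σ s'))) s x
    rwa [Function.update_of_ne hs.symm] at this
  have es' : ∀ x, T (ι s' x) (ι s' (reconnect a b (σ s') x)) := fun x => by
    have := glue_edge (ι := ι) (Function.update σ s' (reconnect a b (σ s'))) s' x
    rwa [Function.update_self] at this
  have eAB : T A B := by
    have := es' a
    rwa [show reconnect a b (σ s') a = b by simp [reconnect], hA, hB] at this
  let ψ : V → V := fun v => if v = A ∨ v = B then
    (if σ s' a = b then A else ι s' (σ s' a)) else v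
  have ψA : ψ A = if σ s' a = b then A else ι s' (σ s' a) := by simp [ψ]
  have ψB : ψ B = ψ A := by simp [ψ]
  have ψo : ∀ r x, x ≠ a → x ≠ b → ψ (ι r x) = ι r x := by
    intro r x hx hx'
    simp only [ψ]
    rw [if_neg]
    rw [hAι, hBι]; tauto
  have key : T (ψ u) (ψ v) := by
    refine glue_lift ψ ?_ h
    intro r x
    rcases hs' r with rfl | rfl
    · rw [Function.update_self]
      rcases reconnect_val (h1 r) hab x with ⟨x1, x2⟩ | ⟨x1, x2⟩ | ⟨x1, x3, x2⟩ | ⟨x1, x3, x2⟩ |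
        ⟨x1, x3, x4, x5, x2⟩
      · rw [x2, x1, hA, hB, ψB]
      · rw [x2, x1, hA, hB, ψB]
      · have k1 : σ r a ≠ a := h2 r a
        have k2 : σ r b ≠ b := h2 r b
        have k3 : σ r b ≠ a := by rintro k; apply x3; rw [x1, ← k, h1]
        rw [x2, ψo _ _ k3 k2, x1, ψo _ _ k1 (x1 ▸ x3)]
        have e1 := es a
        have e2 := es b
        rw [hA] at e1
        rw [hB] at e2
        exact T.trans (T.symm e1) (T.trans eAB e2)
      · have k1 : σ r a ≠ a := h2 r a
        have k2 : σ r b ≠ b := h2 r b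
        have k3 : σ r a ≠ b := by rintro k; apply x3; rw [x1, ← k, h1]
        rw [x2, ψo _ _ k1 k3, x1, ψo _ _ (x1 ▸ x3) k2]
        have e1 := es a
        have e2 := es b
        rw [hA] at e1
        rw [hB] at e2
        exact T.symm (T.trans (T.symm e1) (T.trans eAB e2))
      · rw [x2, ψo _ _ x1 x3, ψo _ _ x4 x5]
        exact es x
    · rw [Function.update_of_ne hs]
      by_cases k : σ r a = b
      · have k' : σ r b = a := by rw [← k, h1]
        by_cases xa : x = a
        · rw [xa, k, hA, hB, ψB]
        by_cases xb : x = b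
        · rw [xb, k', hA, hB, ψB]
        have e := es' x
        have y1 : σ r x ≠ a := fun h => xb (by rw [← k, ← h, h1])
        have y2 : σ r x ≠ b := fun h => xa (by rw [← k', ← h, h1])
        rw [show reconnect a b (σ r) x = σ r x by
          simp [reconnect, xa, xb, k, k']] at e
        rwa [ψo _ _ xa xb, ψo _ _ y1 y2]
      · rw [if_neg k] at ψA
        have k' : σ r b ≠ a := fun h => k (by rw [← h, h1])
        have e : T (ι r (σ r a)) (ι r (σ r b)) := by
          have := es' (σ r a)
          rwa [show reconnect a b (σ r) (σ r a) = σ r b by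
            simp [reconnect, h2, k]] at this
        by_cases xa : x = a
        · rw [xa, hA, ψA, ψo _ _ (h2 r a) k]
        by_cases xb : x = b
        · rw [xb, hB, ψB, ψA, ψo _ _ k' (h2 r b)]; exact e
        by_cases xc : x = σ r a
        · rw [xc, h1, hA, ψA, ψo _ _ (h2 r a) k]
        by_cases xd : x = σ r b
        · rw [xd, h1, hB, ψB, ψA, ψo _ _ k' (h2 r b)]; exact T.symm e
        have e := es' x
        rw [show reconnect a b (σ r) x = σ r x by simp [reconnect, xa, xb, xc, xd]] at e
        rwa [ψo _ _ xa xb, ψo _ _ (fun h => xc (by rw [← h, h1]))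
          (fun h => xd (by rw [← h, h1]))]
  have ψu : ψ u = u := by simp [ψ, hu.1, hu.2]
  have ψv : ψ v = v := by simp [ψ, hv.1, hv.2]
  rwa [ψu, ψv] at key

/-- The components of a superposition that contain none of the points `o ∈ O`. -/
def innerComponents (T : Setoid V) (O : Set V) : Set (Quotient T) :=
  {c | ∀ o ∈ O, Quotient.mk T o ≠ c}

/-- Auxiliary description of the components that contain a point other than `A` and `B`. -/
def awayComponents (T : Setoid V) (O : Set V) (A B : V) : Set (Set V) :=
  {C | ∃ v, v ≠ A ∧ v ≠ B ∧ (∀ o ∈ O, ¬ T o v) ∧ C = {w | w ≠ A ∧ w ≠ B ∧ T w v}}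

theorem awayComponents_congr {T T' : Setoid V} {O : Set V} {A B : V} (hAO : A ∉ O) (hBO : B ∉ O)
    (h : ∀ u v, u ≠ A ∧ u ≠ B → v ≠ A ∧ v ≠ B → (T u v ↔ T' u v)) :
    awayComponents T O A B = awayComponents T' O A B := by
  have hO : ∀ o ∈ O, o ≠ A ∧ o ≠ B := fun o ho => ⟨by rintro rfl; exact hAO ho,
    by rintro rfl; exact hBO ho⟩
  ext C
  constructor
  · rintro ⟨v, v1, v2, v3, rfl⟩
    refine ⟨v, v1, v2, fun o ho h' => v3 o ho ((h o v (hO o ho) ⟨v1, v2⟩).2 h'), ?_⟩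
    ext w
    constructor
    · rintro ⟨w1, w2, w3⟩; exact ⟨w1, w2, (h w v ⟨w1, w2⟩ ⟨v1, v2⟩).1 w3⟩
    · rintro ⟨w1, w2, w3⟩; exact ⟨w1, w2, (h w v ⟨w1, w2⟩ ⟨v1, v2⟩).2 w3⟩
  · rintro ⟨v, v1, v2, v3, rfl⟩
    refine ⟨v, v1, v2, fun o ho h' => v3 o ho ((h o v (hO o ho) ⟨v1, v2⟩).1 h'), ?_⟩
    ext w
    constructor
    · rintro ⟨w1, w2, w3⟩; exact ⟨w1, w2, (h w v ⟨w1, w2⟩ ⟨v1, v2⟩).2 w3⟩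
    · rintro ⟨w1, w2, w3⟩; exact ⟨w1, w2, (h w v ⟨w1, w2⟩ ⟨v1, v2⟩).1 w3⟩

theorem ncard_inner_away (T : Setoid V) (O : Set V) (A B : V) :
    (innerComponents T O ∩ {c | ∃ v, v ≠ A ∧ v ≠ B ∧ Quotient.mk T v = c}).ncard =
      (awayComponents T O A B).ncard := by
  refine Set.ncard_congr
    (fun c _ => {w | w ≠ A ∧ w ≠ B ∧ Quotient.mk T w = c}) ?_ ?_ ?_
  · rintro c ⟨h, v, v1, v2, rfl⟩
    refine ⟨v, v1, v2, fun o ho h' => h o ho (Quotient.sound h'), ?_⟩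
    ext w
    simp only [Set.mem_ofPred_eq, Quotient.eq]
  · rintro c c' ⟨h, v, v1, v2, rfl⟩ _ e
    have : v ∈ {w | w ≠ A ∧ w ≠ B ∧ Quotient.mk T w = c'} := by
      rw [← e]; exact ⟨v1, v2, rfl⟩
    exact this.2.2
  · rintro C ⟨v, v1, v2, v3, rfl⟩
    refine ⟨Quotient.mk T v, ⟨fun o ho h' => v3 o ho (Quotient.exact h'), v, v1, v2, rfl⟩, ?_⟩
    ext w
    simp only [Set.mem_ofPred_eq, Quotient.eq]

theorem glue_count [DecidableEq P] [Finite V] {a b : P} {A B : V} {σ : Bool → P → P}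
    (hA : ∀ s, ι s a = A) (hB : ∀ s, ι s b = B)
    (hι : ∀ s, Function.Injective (ι s)) (hab : a ≠ b)
    (h1 : ∀ s x, σ s (σ s x) = x) (h2 : ∀ s x, σ s x ≠ x) {s s' : Bool} (hs : s' ≠ s)
    {O : Set V} (hAO : A ∉ O) (hBO : B ∉ O) :
    (innerComponents (glueSetoid ι (Function.update σ s (reconnect a b (σ s)))) O).ncard =
      (awayComponents (glueSetoid ι (Function.update σ s (reconnect a b (σ s)))) O A B).ncard +
        if σ s' a = b then 1 else 0 := by
  have hs' : ∀ r, r = s ∨ r = s' := fun r => bool_cases hs r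
  have hAι : ∀ r x, ι r x = A ↔ x = a := fun r x => by rw [← hA r, (hι r).eq_iff]
  have hBι : ∀ r x, ι r x = B ↔ x = b := fun r x => by rw [← hB r, (hι r).eq_iff]
  set T := glueSetoid ι (Function.update σ s (reconnect a b (σ s))) with hT
  have es' : ∀ x, T (ι s' x) (ι s' (σ s' x)) := fun x => by
    have := glue_edge (ι := ι) (Function.update σ s (reconnect a b (σ s))) s' x
    rwa [Function.update_of_ne hs] at this
  have eAB : T A B := by
    have := glue_edge (ι := ι) (Function.update σ s (reconnect a b (σ s))) s a
    rwa [Function.update_self, show reconnect a b (σ s) a = b by simp [reconnect], hA, hB] at this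
  rw [← ncard_inner_away]
  have cover : ∀ c : Quotient T, c = Quotient.mk T A ∨
      ∃ v, v ≠ A ∧ v ≠ B ∧ Quotient.mk T v = c := by
    intro c
    obtain ⟨v, rfl⟩ := Quotient.exists_rep c
    by_cases vA : v = A
    · exact .inl (by rw [vA])
    by_cases vB : v = B
    · exact .inl (by rw [vB]; exact Quotient.sound (T.symm eAB))
    exact .inr ⟨v, vA, vB, rfl⟩
  by_cases k : σ s' a = b
  · rw [if_pos k]
    have k' : σ s' b = a := by rw [← k, h1]
    have sat : ∀ v, T A v → v = A ∨ v = B := by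
      have : ∀ u v, T u v → ((u = A ∨ u = B) ↔ (v = A ∨ v = B)) := by
        intro u v huv
        induction huv with
        | rel u v h' =>
          obtain ⟨r, x, rfl, rfl⟩ := h'
          rw [hAι, hBι, hAι, hBι]
          rcases hs' r with rfl | rfl
          · rw [Function.update_self]
            rcases reconnect_val (h1 r) hab x with ⟨x1, x2⟩ | ⟨x1, x2⟩ | ⟨x1, x3, x2⟩ |
              ⟨x1, x3, x2⟩ | ⟨x1, x3, x4, x5, x2⟩
            · rw [x2, x1]; tauto
            · rw [x2, x1]; tauto
            · have k1 : σ r a ≠ a := h2 r a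
              have k2 : σ r b ≠ b := h2 r b
              have k3 : σ r b ≠ a := by rintro k; apply x3; rw [x1, ← k, h1]
              rw [x2]; subst x1; tauto
            · have k1 : σ r a ≠ a := h2 r a
              have k2 : σ r b ≠ b := h2 r b
              have k3 : σ r a ≠ b := by rintro k; apply x3; rw [x1, ← k, h1]
              rw [x2]; subst x1; tauto
            · rw [x2]; tauto
          · rw [Function.update_of_ne hs]
            constructor
            · rintro (rfl | rfl)
              · exact .inr k
              · exact .inl k'
            · rintro (h | h)
              · exact .inr (by rw [← k, ← h, h1])
              · exact .inl (by rw [← k', ← h, h1])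
        | refl u => exact Iff.rfl
        | symm u v _ ih => exact ih.symm
        | trans u v w _ _ ih1 ih2 => exact ih1.trans ih2
      intro v hv
      exact (this A v hv).1 (.inl rfl)
    have hins : innerComponents T O = insert (Quotient.mk T A)
        (innerComponents T O ∩ {c | ∃ v, v ≠ A ∧ v ≠ B ∧ Quotient.mk T v = c}) := by
      ext c
      constructor
      · intro hc
        rcases cover c with h | h
        · exact .inl h
        · exact .inr ⟨hc, h⟩
      · rintro (rfl | h)
        · intro o ho h'
          rcases sat o (T.symm (Quotient.exact h')) with rfl | rfl
          · exact hAO ho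
          · exact hBO ho
        · exact h.1
    conv_lhs => rw [hins]
    rw [Set.ncard_insert_of_notMem]
    rintro ⟨_, v, v1, v2, h⟩
    rcases sat v (T.symm (Quotient.exact h)) with rfl | rfl
    · exact v1 rfl
    · exact v2 rfl
  · rw [if_neg k, add_zero]
    congr 1
    ext c
    refine ⟨fun hc => ⟨hc, ?_⟩, fun hc => hc.1⟩
    rcases cover c with rfl | h
    · refine ⟨ι s' (σ s' a), ?_, ?_, ?_⟩
      · rw [Ne, hAι]; exact h2 s' a
      · rw [Ne, hBι]; exact k
      · have := es' a
        rw [hA] at this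
        exact Quotient.sound (T.symm this)
    · exact h

end Glue

/-! ### Temperley-Lieb diagrams -/

/-- Position of a boundary point of a diagram with `t` bottom points and `n` top points, where
the bottom line is rotated to the left of the top line: the points are read from the right to the
left along the bottom and then from the left to the right along the top. -/
def tlPos {t n : ℕ} : Fin t ⊕ Fin n → ℤ :=
  Sum.elim (fun j => -((j : ℤ) + 1)) (fun i => (i : ℤ))

theorem tlPos_injective {t n : ℕ} : Function.Injective (tlPos (t := t) (n := n)) := by
  rintro (x | x) (y | y) h <;> simp only [tlPos, Sum.elim_inl, Sum.elim_inr] at h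
  · congr 1; apply Fin.ext; omega
  · omega
  · omega
  · congr 1; apply Fin.ext; omega

/-- A Temperley-Lieb diagram from `t` (bottom points `Sum.inl`) to `n` (top points `Sum.inr`):
a pairing of the boundary points, in which `x` is joined to `σ x`, such that no two arcs cross. -/
structure TLDiagram (t n : ℕ) where
  σ : Fin t ⊕ Fin n → Fin t ⊕ Fin n
  invol : ∀ x, σ (σ x) = x
  no_fix : ∀ x, σ x ≠ x
  planar : ∀ x y, ¬ (tlPos x < tlPos y ∧ tlPos y < tlPos (σ x) ∧ tlPos (σ x) < tlPos (σ y))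

namespace TLDiagram

variable {t n : ℕ}

/-- A diagram `t → n` is monic if each bottom point is joined to a top point. -/
def IsMonic (D : TLDiagram t n) : Prop := ∀ j : Fin t, ∃ i : Fin n, D.σ (Sum.inl j) = Sum.inr i

/-- The left one of the two neighbouring top points on which `f_i` acts. -/
def lpt (i : Fin (n - 1)) : Fin t ⊕ Fin n := Sum.inr ⟨i.val, by omega⟩

/-- The right one of the two neighbouring top points on which `f_i` acts. -/
def rpt (i : Fin (n - 1)) : Fin t ⊕ Fin n := Sum.inr ⟨i.val + 1, by omega⟩

theorem lpt_ne_rpt (i : Fin (n - 1)) : (lpt i : Fin t ⊕ Fin n) ≠ rpt i := by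
  simp [lpt, rpt]

theorem tlPos_lpt (i : Fin (n - 1)) : tlPos (lpt i : Fin t ⊕ Fin n) = i := rfl

theorem tlPos_rpt (i : Fin (n - 1)) : tlPos (rpt i : Fin t ⊕ Fin n) = i + 1 := by
  simp [tlPos, rpt]

/-- The diagram obtained from `f_i ∘ D` by deleting the closed loop, if there is one: the points
`i` and `i + 1` are joined to each other, their former partners are joined to each other (unless
`i` and `i + 1` were already joined), and all other arcs stay. -/
def hook (i : Fin (n - 1)) (D : TLDiagram t n) : TLDiagram t n where
  σ := reconnect (lpt i) (rpt i) D.σ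
  invol := reconnect_invol D.invol D.no_fix
  no_fix := reconnect_ne D.invol D.no_fix (lpt_ne_rpt i)
  planar := reconnect_planar D.invol D.no_fix (lpt_ne_rpt i) tlPos_injective
    (by rw [tlPos_lpt, tlPos_rpt]) D.planar

open Classical in
/-- The number of closed loops in `f_i ∘ D` is one if `i` and `i + 1` are joined in `D`, and zero
otherwise; this is the corresponding power of the loop value. -/
def hookCoef (q : ℂ) (i : Fin (n - 1)) (D : TLDiagram t n) : ℂ :=
  if D.σ (lpt i) = rpt i then loopValue q else 1

theorem ext_σ {D D' : TLDiagram t n} (h : ∀ x, D.σ x = D'.σ x) : D = D' := by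
  cases D
  cases D'
  congr 1
  exact funext h

instance : Finite (TLDiagram t n) :=
  Finite.of_injective TLDiagram.σ fun _ _ h => ext_σ (congrFun h)

theorem hook_hook (i : Fin (n - 1)) (D : TLDiagram t n) : hook i (hook i D) = hook i D :=
  ext_σ (reconnect_reconnect D.invol D.no_fix (lpt_ne_rpt i))

theorem hook_braid (i j : Fin (n - 1)) (h : i.val + 1 = j.val ∨ j.val + 1 = i.val)
    (D : TLDiagram t n) : hook i (hook j (hook i D)) = hook i D := by
  apply ext_σ
  intro x
  rcases h with h | h
  · have h5 : (lpt j : Fin t ⊕ Fin n) = rpt i := by simp [lpt, rpt, h]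
    have h6 : (lpt i : Fin t ⊕ Fin n) ≠ rpt j := by simp [lpt, rpt]; omega
    simp only [hook, h5]
    exact reconnect_braid D.invol D.no_fix (lpt_ne_rpt i) (h5 ▸ lpt_ne_rpt j) h6 x
  · have h5 : (rpt j : Fin t ⊕ Fin n) = lpt i := by simp [lpt, rpt, h]
    have h6 : (lpt j : Fin t ⊕ Fin n) ≠ rpt i := by simp [lpt, rpt]; omega
    simp only [hook, h5]
    exact reconnect_braid' D.invol D.no_fix (h5 ▸ lpt_ne_rpt j) (lpt_ne_rpt i) h6 x

theorem hookCoef_braid (q : ℂ) (i j : Fin (n - 1)) (h : i.val + 1 = j.val ∨ j.val + 1 = i.val)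
    (D : TLDiagram t n) :
    hookCoef q j (hook i D) = 1 ∧ hookCoef q i (hook j (hook i D)) = 1 := by
  have key : ∀ (i j : Fin (n - 1)) (D : TLDiagram t n),
      (i.val + 1 = j.val ∨ j.val + 1 = i.val) → hookCoef q j (hook i D) = 1 := by
    intro i j D h
    rw [hookCoef, if_neg]
    have e1 : (hook i D).σ (lpt i) = rpt i := reconnect_left
    have e2 : (hook i D).σ (rpt i) = lpt i := by rw [← e1, (hook i D).invol]
    rcases h with h | h
    · have h5 : (lpt j : Fin t ⊕ Fin n) = rpt i := by simp [lpt, rpt, h]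
      have h6 : (lpt i : Fin t ⊕ Fin n) ≠ rpt j := by simp [lpt, rpt]; omega
      rw [h5, e2]; exact h6
    · have h5 : (rpt j : Fin t ⊕ Fin n) = lpt i := by simp [lpt, rpt, h]
      have h6 : (lpt j : Fin t ⊕ Fin n) ≠ rpt i := by simp [lpt, rpt]; omega
      intro h'
      apply h6
      rw [h5] at h'
      rw [← (hook i D).invol (lpt j), h', e1]
  exact ⟨key i j D h, key j i _ h.symm⟩

theorem far_points (i j : Fin (n - 1)) (h : i.val + 2 ≤ j.val ∨ j.val + 2 ≤ i.val) :
    (lpt i : Fin t ⊕ Fin n) ≠ lpt j ∧ (lpt i : Fin t ⊕ Fin n) ≠ rpt j ∧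
      (rpt i : Fin t ⊕ Fin n) ≠ lpt j ∧ (rpt i : Fin t ⊕ Fin n) ≠ rpt j := by
  simp only [lpt, rpt, ne_eq, Sum.inr.injEq, Fin.mk.injEq]
  omega

theorem hook_comm (i j : Fin (n - 1)) (h : i.val + 2 ≤ j.val ∨ j.val + 2 ≤ i.val)
    (D : TLDiagram t n) : hook i (hook j D) = hook j (hook i D) := by
  obtain ⟨h5, h6, h7, h8⟩ := far_points (t := t) i j h
  exact ext_σ (reconnect_comm D.invol D.no_fix (lpt_ne_rpt i) (lpt_ne_rpt j) h5 h6 h7 h8)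

theorem hookCoef_comm (q : ℂ) (i j : Fin (n - 1)) (h : i.val + 2 ≤ j.val ∨ j.val + 2 ≤ i.val)
    (D : TLDiagram t n) :
    hookCoef q j D * hookCoef q i (hook j D) = hookCoef q i D * hookCoef q j (hook i D) := by
  have h1 := D.invol
  have h2 := D.no_fix
  obtain ⟨h5, h6, h7, h8⟩ := far_points (t := t) i j h
  have e1 := reconnect_far h1 h2 (lpt_ne_rpt i) (lpt_ne_rpt j) h5 h6 h7 h8
  have e2 := reconnect_far h1 h2 (lpt_ne_rpt j) (lpt_ne_rpt i) h5.symm h7.symm h6.symm h8.symm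
  simp only [hookCoef, hook, e1, e2]
  grind

theorem hookCoef_hook (q : ℂ) (i : Fin (n - 1)) (D : TLDiagram t n) :
    hookCoef q i (hook i D) = loopValue q := by
  rw [hookCoef, if_pos]
  exact reconnect_left

/-- If `D` is not monic then neither is `f_i ∘ D`. -/
theorem IsMonic.of_hook {i : Fin (n - 1)} {D : TLDiagram t n} (h : (hook i D).IsMonic) :
    D.IsMonic := by
  intro j
  obtain ⟨k, hk⟩ := h j
  rcases hD : D.σ (Sum.inl j) with k' | k'
  · exfalso
    have h1 := D.invol
    have h3 : ∀ k : Fin t, (Sum.inl k : Fin t ⊕ Fin n) ≠ lpt i := by simp [lpt]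
    have h4 : ∀ k : Fin t, (Sum.inl k : Fin t ⊕ Fin n) ≠ rpt i := by simp [rpt]
    have h5 : D.σ (Sum.inl k') = Sum.inl j := by rw [← hD, h1]
    have : (hook i D).σ (Sum.inl j) = Sum.inl k' := by
      simp only [hook, reconnect]
      grind
    rw [this] at hk
    exact absurd hk (by simp)
  · exact ⟨k', rfl⟩

/-! ### Superposition of two diagrams -/

/-- The points of the picture of `D₁* ∘ D₂` for diagrams `D₁, D₂ : t → n`: the `n` points on the
middle line, the bottom points of `D₂` on the outer line `false`, and the (reflected) bottom points
of `D₁` on the outer line `true`. -/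
abbrev GluePt (t n : ℕ) : Type := Fin n ⊕ (Bool × Fin t)

/-- The place in the picture of the boundary points of the diagram `s`. -/
def gluePt (s : Bool) : Fin t ⊕ Fin n → GluePt t n :=
  Sum.elim (fun j => Sum.inr (s, j)) Sum.inl

theorem gluePt_injective (s : Bool) : Function.Injective (gluePt (t := t) (n := n) s) := by
  rintro (x | x) (y | y) h <;> simp_all [gluePt]

/-- The points `u` and `v` lie on the same connected component of the picture made of the
diagrams `D false` and `D true` (reflected) that share the middle line. -/
def glue (D : Bool → TLDiagram t n) : Setoid (GluePt t n) := glueSetoid gluePt fun s => (D s).σ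

/-- The composite `D₁* ∘ D₂ : t → t` is monic, that is, a multiple of the identity: each point of
either outer line is connected to a point of the other one. -/
def GlueMonic (D : Bool → TLDiagram t n) : Prop :=
  ∀ s j, ∃ k, glue D (Sum.inr (s, j)) (Sum.inr (!s, k))

/-- The number of closed loops in `D₁* ∘ D₂`, that is, of the components of the picture without
points on the outer lines. -/
def glueLoops (D : Bool → TLDiagram t n) : ℕ :=
  (innerComponents (glue D) (Set.range Sum.inr)).ncard

open Classical in
/-- The scalar `(D₁, D₂)` with `D₁* ∘ D₂ = (D₁, D₂) id_t` if `D₁* ∘ D₂` is monic, and zero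
otherwise, for `D₁ = D true` and `D₂ = D false`. -/
def glueValue (q : ℂ) (D : Bool → TLDiagram t n) : ℂ :=
  if GlueMonic D then loopValue q ^ glueLoops D else 0

theorem glueMonic_isMonic {D : Bool → TLDiagram t n} (h : GlueMonic D) (s : Bool) :
    (D s).IsMonic := by
  intro j
  rcases hD : (D s).σ (Sum.inl j) with k' | k'
  · exfalso
    have h1 := (D s).invol
    have h5 : (D s).σ (Sum.inl k') = Sum.inl j := by rw [← hD, h1]
    have key : ∀ u v, glue D u v → ((u = Sum.inr (s, j) ∨ u = Sum.inr (s, k')) ↔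
        (v = Sum.inr (s, j) ∨ v = Sum.inr (s, k'))) := by
      intro u v huv
      induction huv with
      | rel u v h' =>
        obtain ⟨r, x, rfl, rfl⟩ := h'
        by_cases hr : r = s
        · subst hr
          have e : ∀ j, (Sum.inr (r, j) : GluePt t n) = gluePt r (Sum.inl j) := fun _ => rfl
          rw [e, e, (gluePt_injective r).eq_iff, (gluePt_injective r).eq_iff,
            (gluePt_injective r).eq_iff, (gluePt_injective r).eq_iff]
          constructor
          · rintro (rfl | rfl)
            · exact .inr hD
            · exact .inl h5
          · rintro (h | h)
            · exact .inr ((h1 x).symm.trans ((congrArg (D r).σ h).trans hD))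
            · exact .inl ((h1 x).symm.trans ((congrArg (D r).σ h).trans h5))
        · have e : ∀ x j, (gluePt r x : GluePt t n) ≠ Sum.inr (s, j) := by
            rintro (x | x) j <;> simp [gluePt, hr]
          simp [e]
      | refl u => exact Iff.rfl
      | symm u v _ ih => exact ih.symm
      | trans u v w _ _ ih1 ih2 => exact ih1.trans ih2
    obtain ⟨k, hk⟩ := h s j
    have := (key _ _ hk).1 (.inl rfl)
    simp at this
  · exact ⟨k', rfl⟩

theorem glueValue_eq_zero (q : ℂ) {D : Bool → TLDiagram t n} {s : Bool} (h : ¬ (D s).IsMonic) :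
    glueValue q D = 0 := if_neg fun h' => h (glueMonic_isMonic h' s)

theorem glue_update (i : Fin (n - 1)) (D : Bool → TLDiagram t n) (s : Bool) :
    glue (Function.update D s (hook i (D s))) =
      glueSetoid gluePt (Function.update (fun s => (D s).σ) s
        (reconnect (lpt i) (rpt i) (D s).σ)) := by
  unfold glue
  congr 1
  funext r
  by_cases h : r = s
  · subst h; simp [hook]
  · simp [h]

theorem glueValue_hook (q : ℂ) (i : Fin (n - 1)) (D : Bool → TLDiagram t n) {s s' : Bool}
    (hs : s' ≠ s) :
    hookCoef q i (D s) * glueValue q (Function.update D s (hook i (D s))) =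
      hookCoef q i (D s') * glueValue q (Function.update D s' (hook i (D s'))) := by
  have hA : ∀ s, gluePt s (lpt i : Fin t ⊕ Fin n) = Sum.inl ⟨i.val, by omega⟩ := fun _ => rfl
  have hB : ∀ s, gluePt s (rpt i : Fin t ⊕ Fin n) = Sum.inl ⟨i.val + 1, by omega⟩ := fun _ => rfl
  have h1 : ∀ s x, (D s).σ ((D s).σ x) = x := fun s => (D s).invol
  have h2 : ∀ s x, (D s).σ x ≠ x := fun s => (D s).no_fix
  have hab := lpt_ne_rpt (t := t) i
  have transfer : ∀ u v : GluePt t n,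
      (u ≠ Sum.inl ⟨i.val, by omega⟩ ∧ u ≠ Sum.inl ⟨i.val + 1, by omega⟩) →
      (v ≠ Sum.inl ⟨i.val, by omega⟩ ∧ v ≠ Sum.inl ⟨i.val + 1, by omega⟩) →
      (glue (Function.update D s (hook i (D s))) u v ↔
        glue (Function.update D s' (hook i (D s'))) u v) := by
    intro u v hu hv
    rw [glue_update, glue_update]
    exact ⟨glue_transfer hA hB gluePt_injective hab h1 h2 hs hu hv,
      glue_transfer hA hB gluePt_injective hab h1 h2 hs.symm hu hv⟩
  have hM : GlueMonic (Function.update D s (hook i (D s))) ↔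
      GlueMonic (Function.update D s' (hook i (D s'))) := by
    unfold GlueMonic
    refine forall_congr' fun r => forall_congr' fun j => exists_congr fun k => ?_
    exact transfer _ _ (by simp) (by simp)
  have c1 := glue_count hA hB gluePt_injective hab h1 h2 hs (O := Set.range Sum.inr)
    (by simp) (by simp)
  have c2 := glue_count hA hB gluePt_injective hab h1 h2 hs.symm (O := Set.range Sum.inr)
    (by simp) (by simp)
  rw [← glue_update] at c1 c2
  rw [awayComponents_congr (by simp) (by simp) transfer] at c1
  unfold glueValue
  by_cases h : GlueMonic (Function.update D s (hook i (D s)))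
  · rw [if_pos h, if_pos (hM.1 h), glueLoops, glueLoops, c1, c2, hookCoef, hookCoef]
    split_ifs <;> ring
  · rw [if_neg h, if_neg (fun h' => h (hM.2 h')), mul_zero, mul_zero]

end TLDiagram

/-! ### Cell modules and their simple heads -/

/-- Monic Temperley-Lieb diagrams from `t` to `n`. -/
abbrev MonicDiagram (t n : ℕ) : Type := {D : TLDiagram t n // D.IsMonic}

/-- The cell module `W_t(n)` of `TL_n(q)`: the complex vector space with basis the monic diagrams
from `t` to `n`. -/
def CellModule (_q : ℂ) (t n : ℕ) : Type := MonicDiagram t n →₀ ℂ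

namespace CellModule

open TLDiagram

variable (q : ℂ) {t n : ℕ}

instance : AddCommGroup (CellModule q t n) := inferInstanceAs (AddCommGroup (_ →₀ ℂ))

instance : Module ℂ (CellModule q t n) := inferInstanceAs (Module ℂ (_ →₀ ℂ))

instance : Module.Finite ℂ (CellModule q t n) := inferInstanceAs (Module.Finite ℂ (_ →₀ ℂ))

/-- The basis of monic diagrams. -/
def basis : Module.Basis (MonicDiagram t n) ℂ (CellModule q t n) := ⟨LinearEquiv.refl ℂ _⟩

open Classical in
/-- The class of a diagram in the cell module: the diagrams that are not monic are zero. -/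
def ofDiagram (D : TLDiagram t n) : CellModule q t n :=
  if h : D.IsMonic then basis q ⟨D, h⟩ else 0

theorem ofDiagram_val (D : MonicDiagram t n) : ofDiagram q D.val = basis q D := dif_pos D.2

theorem ofDiagram_of_not {D : TLDiagram t n} (h : ¬ D.IsMonic) : ofDiagram q D = 0 := dif_neg h

/-- The action of `f_i` on the cell module: composition of diagrams, where every closed loop counts
as the factor `-(q + q⁻¹)` and diagrams that are not monic are zero. -/
def genAction (i : Fin (n - 1)) : Module.End ℂ (CellModule q t n) :=
  (basis q).constr ℂ fun D => hookCoef q i D.val • ofDiagram q (hook i D.val)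

theorem genAction_ofDiagram (i : Fin (n - 1)) (D : TLDiagram t n) :
    genAction q i (ofDiagram q D) = hookCoef q i D • ofDiagram q (hook i D) := by
  by_cases h : D.IsMonic
  · rw [ofDiagram, dif_pos h, genAction, Module.Basis.constr_basis]
  · rw [ofDiagram_of_not q h, ofDiagram_of_not q fun h' => h h'.of_hook, map_zero, smul_zero]

/-- The representation of `TL_n(q)` on the cell module `W_t(n)`. -/
def rep : TL q n →ₐ[ℂ] Module.End ℂ (CellModule q t n) :=
  TL.lift (genAction q)
    (fun i => (basis q).ext fun D => by
      simp only [Module.End.mul_apply, LinearMap.smul_apply, ← ofDiagram_val,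
        genAction_ofDiagram, map_smul, hook_hook, hookCoef_hook]
      rw [smul_comm])
    (fun i j h => (basis q).ext fun D => by
      simp only [Module.End.mul_apply, ← ofDiagram_val,
        genAction_ofDiagram, map_smul, hook_braid i j h, (hookCoef_braid q i j h D.val).1,
        (hookCoef_braid q i j h D.val).2, one_smul])
    (fun i j h => (basis q).ext fun D => by
      simp only [Module.End.mul_apply, ← ofDiagram_val,
        genAction_ofDiagram, map_smul, hook_comm i j h, smul_smul, hookCoef_comm q i j h])

instance : Module (TL q n) (CellModule q t n) :=
  Module.compHom (CellModule q t n) (rep q (t := t) (n := n)).toRingHom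

theorem smul_def (a : TL q n) (v : CellModule q t n) : a • v = rep q a v := rfl

theorem gen_smul (i : Fin (n - 1)) (v : CellModule q t n) :
    TL.gen q i • v = genAction q i v := by
  rw [smul_def, rep, TL.lift_gen]

instance : IsScalarTower ℂ (TL q n) (CellModule q t n) :=
  ⟨fun c a v => by rw [smul_def, smul_def, map_smul, LinearMap.smul_apply]⟩

/-- The bilinear form on `W_t(n)`, given on monic diagrams by `D₁* ∘ D₂ = (D₁, D₂) id_t` if
`D₁* ∘ D₂` is monic, and `(D₁, D₂) = 0` otherwise. -/
def form : LinearMap.BilinForm ℂ (CellModule q t n) :=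
  (basis q).constr ℂ fun D₁ => (basis q).constr ℂ fun D₂ =>
    glueValue q fun s => if s then D₁.val else D₂.val

theorem form_ofDiagram (D₁ D₂ : TLDiagram t n) :
    form q (ofDiagram q D₁) (ofDiagram q D₂) =
      glueValue q fun s => if s then D₁ else D₂ := by
  by_cases h1 : D₁.IsMonic
  · by_cases h2 : D₂.IsMonic
    · rw [ofDiagram, dif_pos h1, ofDiagram, dif_pos h2, form, Module.Basis.constr_basis,
        Module.Basis.constr_basis]
    · rw [ofDiagram_of_not q h2, map_zero, glueValue_eq_zero q (s := false) (by simpa using h2)]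
  · rw [ofDiagram_of_not q h1, map_zero, LinearMap.zero_apply,
      glueValue_eq_zero q (s := true) (by simpa using h1)]

theorem form_gen (i : Fin (n - 1)) (v w : CellModule q t n) :
    form q (TL.gen q i • v) w = form q v (TL.gen q i • w) := by
  have h : form q ∘ₗ genAction q i =
      LinearMap.flip (LinearMap.flip (form q (t := t) (n := n)) ∘ₗ genAction q i) := by
    refine (basis q).ext fun D₁ => (basis q).ext fun D₂ => ?_
    simp only [LinearMap.comp_apply, LinearMap.flip_apply, ← ofDiagram_val, genAction_ofDiagram,
      map_smul, LinearMap.smul_apply, form_ofDiagram, smul_eq_mul]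
    have := glueValue_hook q i (fun s => if s then D₁.val else D₂.val) (s := true) (s' := false)
      (by decide)
    have e1 : Function.update (fun s => if s then D₁.val else D₂.val) true (hook i D₁.val) =
        fun s => if s then hook i D₁.val else D₂.val := by
      funext r; cases r <;> simp
    have e2 : Function.update (fun s => if s then D₁.val else D₂.val) false (hook i D₂.val) =
        fun s => if s then D₁.val else hook i D₂.val := by
      funext r; cases r <;> simp
    simp only [if_true, Bool.false_eq_true, if_false] at this
    rw [e1, e2] at this
    exact this
  rw [gen_smul, gen_smul]
  exact LinearMap.congr_fun (LinearMap.congr_fun h v) w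

/-- The radical of the form, as a submodule of the cell module. -/
def radical (t n : ℕ) : Submodule (TL q n) (CellModule q t n) where
  carrier := {v | ∀ w, form q v w = 0}
  zero_mem' w := by simp
  add_mem' hv hv' w := by rw [map_add, LinearMap.add_apply, hv w, hv' w, add_zero]
  smul_mem' a := by
    induction a using TL.induction with
    | scalar c =>
      intro v hv w
      rw [algebraMap_smul, map_smul, LinearMap.smul_apply, hv w, smul_zero]
    | gen i => intro v hv w; rw [form_gen]; exact hv _
    | mul a b ha hb => intro v hv; rw [mul_smul]; exact ha (hb hv)
    | add a b ha hb =>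
      intro v hv w
      rw [add_smul, map_add, LinearMap.add_apply, ha hv w, hb hv w, add_zero]

end CellModule

/-- The module `L_t(n) = W_t(n) / Rad_t` of `TL_n(q)`. -/
abbrev SimpleHead (q : ℂ) (t n : ℕ) : Type := CellModule q t n ⧸ CellModule.radical q t n

/-! ### The polynomials `p_i` -/

/-- The polynomials `p_1 = p_2 = 1`, `p_{i+1} = p_i - x p_{i-1}` for `i ≥ 2` (and `p_0 = 0`). -/
def chebPoly : ℕ → ℤ[X]
  | 0 => 0
  | 1 => 1
  | 2 => 1
  | i + 3 => chebPoly (i + 2) - Polynomial.X * chebPoly (i + 1)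

end

noncomputable section

/-! ### Corners of the Temperley-Lieb algebra -/

namespace TL

variable {q : ℂ} {n : ℕ}

/-! Write `δ` for the loop value `-(q + q⁻¹)`, `c_k` for `cups q n k` (the product of `k` commuting
generators that places `k` adjacent cups at the left end), and `I_k` for the ideal it generates. The
proof rests on one classification principle, used for two different models of the same simple
module.

Principle. The normal form of Temperley–Lieb words gives `c_k TL_n c_k ⊆ ℂ c_k + I_{k+1}`
(`TL.exists_cups_corner`). So on a simple module killed by `c_{k+1}` but not by `c_k`, the
annihilator of a nonzero vector in the image of `c_k` is governed by scalars chosen in the algebra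
alone. Two simple modules with the same last nonvanishing `c_k` are therefore isomorphic
(`TL.nonempty_equiv_of_cups`). Every simple module has such a `k` with `2k ≤ n`.

First model: `L_t(n)`. If `n = t + 2k`, the cell module is generated by the diagram with `k` cups on
the left, and `c_k` maps the whole cell module into its line. Invariance of the form then makes the
radical a maximal submodule, since `δ ≠ 0` for `ℓ ≥ 3`. The last nonvanishing cup product on
`L_t(n)` is `c_k`, so the `L_t(n)` are pairwise nonisomorphic and exhaust the simple modules.

Second model: for `t ≤ ℓ - 2`, functions on walks from `0` to `t` on the path with vertices `0, …, ℓ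
- 2`. The generators act by explicit weights in quantum numbers, and the walls are respected because
`[0] = [ℓ] = 0`. This module is simple with the same last cup product, hence isomorphic to `L_t(n)`
(`WalkModule.nonempty_equiv_simpleHead`). No Gram matrix is computed.

Consequences. A vector of the path model fixed by the Jones–Wenzl idempotent would be supported on
walks that rise `ℓ - 1` times in a row, which leave the graph; so the idempotent kills `L_t(n)` for
`t ≤ ℓ - 2`. For `t ≥ ℓ - 1` it fixes a diagram whose first `t` top points are through lines. This
decides which `L_t(n)` descend to the quotient. The dimension of `L_t(n)` for `t ≤ ℓ - 2` is a
number of walks, and the recurrence on the last step, solved from both ends of the graph, gives the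
quotient of the polynomials `p_i`. -/

theorem spaceMul_mono_left {M N P : Submodule ℂ (TL q n)} (h : M ≤ N) : M * P ≤ N * P :=
  mul_le_mul_left h P

theorem spaceMul_mono_right {M N P : Submodule ℂ (TL q n)} (h : M ≤ N) : P * M ≤ P * N :=
  mul_le_mul_right h P

/-- The generator with index `i`, or zero if the index is out of range. -/
def genNat (q : ℂ) (n i : ℕ) : TL q n := if h : i < n - 1 then gen q ⟨i, h⟩ else 0

theorem genNat_of_lt {i : ℕ} (h : i < n - 1) : genNat q n i = gen q ⟨i, h⟩ := dif_pos h

theorem genNat_of_not {i : ℕ} (h : ¬ i < n - 1) : genNat q n i = 0 := dif_neg h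

theorem genNat_sq (i : ℕ) : genNat q n i * genNat q n i = loopValue q • genNat q n i := by
  by_cases h : i < n - 1
  · rw [genNat_of_lt h, gen_sq]
  · rw [genNat_of_not h, mul_zero, smul_zero]

theorem genNat_braid {i j : ℕ} (hij : i + 1 = j ∨ j + 1 = i) (hj : j < n - 1) :
    genNat q n i * genNat q n j * genNat q n i = genNat q n i := by
  by_cases h : i < n - 1
  · rw [genNat_of_lt h, genNat_of_lt hj, gen_braid q _ _ hij]
  · rw [genNat_of_not h, mul_zero]

theorem genNat_comm {i j : ℕ} (hij : i + 2 ≤ j ∨ j + 2 ≤ i) :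
    genNat q n i * genNat q n j = genNat q n j * genNat q n i := by
  by_cases h : i < n - 1
  · by_cases hj : j < n - 1
    · rw [genNat_of_lt h, genNat_of_lt hj, gen_comm q _ _ hij]
    · rw [genNat_of_not hj, mul_zero, zero_mul]
  · rw [genNat_of_not h, mul_zero, zero_mul]

/-- The subalgebra generated by the generators with index at least `j`. -/
def tail (q : ℂ) (n j : ℕ) : Subalgebra ℂ (TL q n) :=
  Algebra.adjoin ℂ {x | ∃ i, j ≤ i ∧ x = genNat q n i}

theorem genNat_mem_tail {i j : ℕ} (h : j ≤ i) : genNat q n i ∈ tail q n j :=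
  Algebra.subset_adjoin ⟨i, h, rfl⟩

theorem tail_anti {i j : ℕ} (h : i ≤ j) : tail q n j ≤ tail q n i :=
  Algebra.adjoin_mono fun _ ⟨k, hk, e⟩ => ⟨k, h.trans hk, e⟩

theorem tail_zero : tail q n 0 = ⊤ := by
  refine eq_top_iff.2 fun a _ => ?_
  induction a using TL.induction with
  | scalar c => exact Subalgebra.algebraMap_mem _ c
  | gen i => rw [← genNat_of_lt i.2]; exact genNat_mem_tail (Nat.zero_le _)
  | mul a b ha hb => exact mul_mem (ha trivial) (hb trivial)
  | add a b ha hb => exact add_mem (ha trivial) (hb trivial)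

theorem commute_tail {x : TL q n} {j : ℕ} (hx : x ∈ tail q n (j + 2)) :
    Commute (genNat q n j) x := by
  have : tail q n (j + 2) ≤ Subalgebra.centralizer ℂ {genNat q n j} := by
    refine Algebra.adjoin_le ?_
    rintro _ ⟨i, hi, rfl⟩
    rw [SetLike.mem_coe, Subalgebra.mem_centralizer_iff]
    rintro _ rfl
    exact genNat_comm (.inl hi)
  exact (Subalgebra.mem_centralizer_iff _).1 (this hx) _ rfl

/-- The underlying space of the subalgebra `tail`. -/
abbrev tailSpace (q : ℂ) (n j : ℕ) : Submodule ℂ (TL q n) := Subalgebra.toSubmodule (tail q n j)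

/-- The line spanned by a generator. -/
abbrev genSpace (q : ℂ) (n j : ℕ) : Submodule ℂ (TL q n) := Submodule.span ℂ {genNat q n j}

theorem tailSpace_anti {i j : ℕ} (h : i ≤ j) : tailSpace q n j ≤ tailSpace q n i := tail_anti h

theorem tailSpace_mul_self (j : ℕ) : tailSpace q n j * tailSpace q n j = tailSpace q n j :=
  (Subalgebra.isIdempotentElem_toSubmodule _)

theorem tailSpace_mul_genSpace (j : ℕ) :
    tailSpace q n (j + 2) * genSpace q n j = genSpace q n j * tailSpace q n (j + 2) := by
  have h : ∀ x ∈ tailSpace q n (j + 2), ∀ y ∈ genSpace q n j, Commute x y := by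
    intro x hx y hy
    obtain ⟨c, rfl⟩ := Submodule.mem_span_singleton.1 hy
    exact (commute_tail hx).symm.smul_right c
  apply le_antisymm
  · refine Submodule.mul_le.2 fun x hx y hy => ?_
    rw [(h x hx y hy).eq]
    exact Submodule.mul_mem_mul hy hx
  · refine Submodule.mul_le.2 fun y hy x hx => ?_
    rw [← (h x hx y hy).eq]
    exact Submodule.mul_mem_mul hx hy

theorem genSpace_mul_self_le (j : ℕ) : genSpace q n j * genSpace q n j ≤ genSpace q n j := by
  rw [Submodule.span_mul_span, Set.singleton_mul_singleton, Submodule.span_singleton_le_iff_mem,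
    genNat_sq]
  exact Submodule.smul_mem _ _ (Submodule.mem_span_singleton_self _)

theorem genSpace_braid_le (j : ℕ) :
    genSpace q n j * genSpace q n (j + 1) * genSpace q n j ≤ genSpace q n j := by
  rw [Submodule.span_mul_span, Set.singleton_mul_singleton, Submodule.span_mul_span,
    Set.singleton_mul_singleton, Submodule.span_singleton_le_iff_mem]
  by_cases h : j + 1 < n - 1
  · rw [genNat_braid (.inl rfl) h]
    exact Submodule.mem_span_singleton_self _
  · rw [genNat_of_not h, mul_zero, zero_mul]
    exact zero_mem _

/-- Generators with index at least `j + 2` commute with `f_j`, so by the normal form of the middle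
factor only `f_j f_j` and `f_j f_{j+1} f_j` remain, both multiples of `f_j`. The normal form is a
hypothesis because this lemma is used inside the induction that proves it. -/
theorem genSpace_tailSpace_genSpace_le {j : ℕ}
    (h : tailSpace q n (j + 1) ≤ tailSpace q n (j + 2) ⊔
      tailSpace q n (j + 2) * genSpace q n (j + 1) * tailSpace q n (j + 2)) :
    genSpace q n j * tailSpace q n (j + 1) * genSpace q n j ≤
      genSpace q n j * tailSpace q n (j + 2) := by
  refine (spaceMul_mono_left (spaceMul_mono_right h)).trans ?_
  rw [Submodule.mul_sup, Submodule.sup_mul]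
  refine sup_le ?_ ?_
  · rw [← tailSpace_mul_genSpace, mul_assoc]
    exact spaceMul_mono_right (genSpace_mul_self_le j)
  · calc genSpace q n j * (tailSpace q n (j + 2) * genSpace q n (j + 1) * tailSpace q n (j + 2)) *
          genSpace q n j
        = (genSpace q n j * tailSpace q n (j + 2)) * genSpace q n (j + 1) *
            (tailSpace q n (j + 2) * genSpace q n j) := by simp only [mul_assoc]
      _ = tailSpace q n (j + 2) * (genSpace q n j * genSpace q n (j + 1) * genSpace q n j) *
            tailSpace q n (j + 2) := by
          rw [tailSpace_mul_genSpace, ← tailSpace_mul_genSpace]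
          nth_rw 2 [tailSpace_mul_genSpace]
          simp only [mul_assoc]
      _ ≤ tailSpace q n (j + 2) * genSpace q n j * tailSpace q n (j + 2) :=
          spaceMul_mono_left (spaceMul_mono_right (genSpace_braid_le j))
      _ = genSpace q n j * tailSpace q n (j + 2) := by
          rw [tailSpace_mul_genSpace, mul_assoc, tailSpace_mul_self]

/-- Jones's normal form: words in which the lowest generator occurs at most once suffice. The right
side contains all the generators, and it is closed under products because a second occurrence of
`f_j` is absorbed by `genSpace_tailSpace_genSpace_le`. -/
theorem tailSpace_le (j : ℕ) :
    tailSpace q n j ≤ tailSpace q n (j + 1) ⊔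
      tailSpace q n (j + 1) * genSpace q n j * tailSpace q n (j + 1) := by
  -- Downward induction on `j`, measured by `d`. For `j ≥ n` all generators with index at least `j`
  -- are zero by convention, so the algebra consists of scalars.
  obtain ⟨d, hd⟩ : ∃ d, n ≤ j + d := ⟨n, by omega⟩
  induction d generalizing j with
  | zero =>
    refine le_trans ?_ le_sup_left
    refine Algebra.adjoin_le ?_
    rintro _ ⟨i, hi, rfl⟩
    rw [genNat_of_not (by omega)]
    exact zero_mem _
  | succ d ih =>
    have key := genSpace_tailSpace_genSpace_le (ih (j + 1) (by omega))
    set B := tailSpace q n (j + 1)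
    set F := genSpace q n j
    have hBB : B * B = B := tailSpace_mul_self _
    have one_le : (1 : Submodule ℂ (TL q n)) ≤ B := Submodule.one_le.2 (one_mem (tail q n (j + 1)))
    have mul_le : (B ⊔ B * F * B) * (B ⊔ B * F * B) ≤ B ⊔ B * F * B := by
      rw [Submodule.sup_mul, Submodule.mul_sup, Submodule.mul_sup]
      refine sup_le (sup_le (hBB.le.trans le_sup_left) (le_trans ?_ le_sup_right))
        (sup_le (le_trans ?_ le_sup_right) (le_trans ?_ le_sup_right))
      · rw [← mul_assoc, ← mul_assoc, hBB]
      · rw [mul_assoc, hBB]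
      · calc B * F * B * (B * F * B) = B * (F * (B * B) * F) * B := by simp only [mul_assoc]
          _ ≤ B * (F * tailSpace q n (j + 2)) * B := by
            rw [hBB]; exact spaceMul_mono_left (spaceMul_mono_right key)
          _ ≤ B * (F * B) * B := spaceMul_mono_left
            (spaceMul_mono_right (spaceMul_mono_right (tailSpace_anti (by omega))))
          _ = B * F * B := by rw [← mul_assoc, mul_assoc, hBB]
    have h1 : (1 : TL q n) ∈ B ⊔ B * F * B :=
      le_sup_left (α := Submodule ℂ (TL q n)) (Submodule.one_le.1 one_le)
    refine (Algebra.adjoin_le (S := (B ⊔ B * F * B).toSubalgebra h1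
      fun x y hx hy => mul_le (Submodule.mul_mem_mul hx hy)) ?_ : tail q n j ≤ _)
    rintro _ ⟨i, hi, rfl⟩
    rcases hi.eq_or_lt with rfl | hi
    · refine le_sup_right (α := Submodule ℂ (TL q n)) ?_
      have := Submodule.mul_mem_mul (Submodule.mul_mem_mul (Submodule.one_le.1 one_le)
        (Submodule.mem_span_singleton_self (genNat q n j))) (Submodule.one_le.1 one_le)
      rwa [one_mul, mul_one] at this
    · exact le_sup_left (α := Submodule ℂ (TL q n)) (genNat_mem_tail hi)

/-- The product of the generators with indices `0, 2, …, 2k - 2`. -/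
def cups (q : ℂ) (n : ℕ) : ℕ → TL q n
  | 0 => 1
  | k + 1 => genNat q n (2 * k) * cups q n k

theorem commute_cups (k : ℕ) {j : ℕ} (hj : 2 * k ≤ j) : Commute (genNat q n j) (cups q n k) := by
  induction k with
  | zero => exact Commute.one_right _
  | succ k ih => exact Commute.mul_right (genNat_comm (.inr (by omega))) (ih (by omega))

/-- The corner of `c_{k+1}` is the corner of `c_k` squeezed between two copies of `f_{2k}`.
Expanding by the normal form at `2k` and reducing each `f B f` inside leaves only generators with
index at least `2k + 2`. -/
theorem cups_corner (k : ℕ) :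
    Submodule.span ℂ {cups q n k} * ⊤ * Submodule.span ℂ {cups q n k} ≤
      Submodule.span ℂ {cups q n k} * tailSpace q n (2 * k) := by
  induction k with
  | zero =>
    rw [mul_zero, tailSpace, tail_zero, Algebra.top_toSubmodule]
    simp [cups, Submodule.one_eq_span.symm]
  | succ k ih =>
    have e1 : Submodule.span ℂ {cups q n (k + 1)} =
        genSpace q n (2 * k) * Submodule.span ℂ {cups q n k} := by
      rw [Submodule.span_mul_span, Set.singleton_mul_singleton, cups]
    have e2 : Submodule.span ℂ {cups q n (k + 1)} =
        Submodule.span ℂ {cups q n k} * genSpace q n (2 * k) := by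
      rw [Submodule.span_mul_span, Set.singleton_mul_singleton, cups, (commute_cups k le_rfl).eq]
    have key : genSpace q n (2 * k) * tailSpace q n (2 * k) * genSpace q n (2 * k) ≤
        genSpace q n (2 * k) * tailSpace q n (2 * k + 2) := by
      have c1 := genSpace_tailSpace_genSpace_le (tailSpace_le (q := q) (n := n) (2 * k + 1))
      have c2 := tailSpace_mul_self (q := q) (n := n) (2 * k + 1)
      have c3 : tailSpace q n (2 * k + 2) ≤ tailSpace q n (2 * k + 1) :=
        tailSpace_anti (by omega)
      refine (spaceMul_mono_left (spaceMul_mono_right (tailSpace_le _))).trans ?_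
      set B := tailSpace q n (2 * k + 1)
      set F := genSpace q n (2 * k)
      set B' := tailSpace q n (2 * k + 2)
      rw [Submodule.mul_sup, Submodule.sup_mul]
      refine sup_le c1 ?_
      calc F * (B * F * B) * F = (F * B * F) * (B * F) := by simp only [mul_assoc]
        _ ≤ F * B' * (B * F) := spaceMul_mono_left c1
        _ ≤ F * B * (B * F) := spaceMul_mono_left (spaceMul_mono_right c3)
        _ = F * B * F := by rw [mul_assoc, ← mul_assoc B, c2, ← mul_assoc]
        _ ≤ _ := c1
    calc Submodule.span ℂ {cups q n (k + 1)} * ⊤ * Submodule.span ℂ {cups q n (k + 1)}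
        = genSpace q n (2 * k) * (Submodule.span ℂ {cups q n k} * ⊤ *
            Submodule.span ℂ {cups q n k}) * genSpace q n (2 * k) := by
          nth_rw 1 [e1]; rw [e2]; simp only [mul_assoc]
      _ ≤ genSpace q n (2 * k) * (Submodule.span ℂ {cups q n k} * tailSpace q n (2 * k)) *
            genSpace q n (2 * k) := spaceMul_mono_left (spaceMul_mono_right ih)
      _ = Submodule.span ℂ {cups q n k} *
            (genSpace q n (2 * k) * tailSpace q n (2 * k) * genSpace q n (2 * k)) := by
          rw [← mul_assoc, ← e1, e2]; simp only [mul_assoc]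
      _ ≤ Submodule.span ℂ {cups q n k} * (genSpace q n (2 * k) * tailSpace q n (2 * k + 2)) :=
          spaceMul_mono_right key
      _ = _ := by rw [← mul_assoc, ← e2]; rfl

/-- The two-sided ideal generated by `cups q n k`. -/
def cupsIdeal (q : ℂ) (n k : ℕ) : Submodule ℂ (TL q n) :=
  ⊤ * Submodule.span ℂ {cups q n k} * ⊤

theorem cups_mem_cupsIdeal (k : ℕ) : cups q n k ∈ cupsIdeal q n k := by
  have := Submodule.mul_mem_mul (Submodule.mul_mem_mul (Submodule.mem_top (x := (1 : TL q n)))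
    (Submodule.mem_span_singleton_self (R := ℂ) (cups q n k))) (Submodule.mem_top (x := (1 : TL q n)))
  rwa [one_mul, mul_one] at this

theorem mul_mem_cupsIdeal {k : ℕ} {x : TL q n} (hx : x ∈ cupsIdeal q n k) (a b : TL q n) :
    a * x * b ∈ cupsIdeal q n k := by
  have h := Submodule.mul_mem_mul (Submodule.mul_mem_mul (Submodule.mem_top (x := a)) hx)
    (Submodule.mem_top (x := b))
  refine (?_ : (⊤ : Submodule ℂ (TL q n)) * cupsIdeal q n k * ⊤ ≤ cupsIdeal q n k) h
  have ht : (⊤ : Submodule ℂ (TL q n)) * ⊤ ≤ ⊤ := le_top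
  calc (⊤ : Submodule ℂ (TL q n)) * cupsIdeal q n k * ⊤
      = (⊤ * ⊤) * Submodule.span ℂ {cups q n k} * (⊤ * ⊤) := by
        simp only [cupsIdeal, mul_assoc]
    _ ≤ _ := mul_le_mul' (spaceMul_mono_left ht) ht

/-- For `d = 0` this is `c_{k+1}` itself. Afterwards `f_{i+1} = f_{i+1} f_i f_{i+1}`, where the left
factor commutes past `c_k`, carries membership in the ideal one place to the right. -/
theorem cups_mul_genNat_mem (k d : ℕ) :
    cups q n k * genNat q n (2 * k + d) ∈ cupsIdeal q n (k + 1) := by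
  induction d with
  | zero => rw [add_zero, ← (commute_cups k le_rfl).eq]; exact cups_mem_cupsIdeal _
  | succ d ih =>
    by_cases h : 2 * k + d < n - 1
    · have e := genNat_braid (q := q) (i := 2 * k + (d + 1)) (j := 2 * k + d) (.inr (by omega)) h
      rw [← e, ← mul_assoc, ← mul_assoc, ← (commute_cups k (by omega)).eq]
      rw [mul_assoc (genNat q n (2 * k + (d + 1)))]
      exact mul_mem_cupsIdeal ih _ _
    · rw [genNat_of_not (by omega), mul_zero]
      exact zero_mem _

theorem exists_cups_mul_tail {k : ℕ} {x : TL q n} (hx : x ∈ tail q n (2 * k)) :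
    ∃ c : ℂ, cups q n k * x - c • cups q n k ∈ cupsIdeal q n (k + 1) := by
  induction hx using Algebra.adjoin_induction with
  | mem x hx =>
    obtain ⟨i, hi, rfl⟩ := hx
    obtain ⟨d, rfl⟩ := Nat.exists_eq_add_of_le hi
    exact ⟨0, by rw [zero_smul, sub_zero]; exact cups_mul_genNat_mem k d⟩
  | algebraMap r =>
    exact ⟨r, by rw [← Algebra.commutes, ← Algebra.smul_def, sub_self]; exact zero_mem _⟩
  | add x y _ _ hx hy =>
    obtain ⟨c, hc⟩ := hx
    obtain ⟨d, hd⟩ := hy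
    refine ⟨c + d, ?_⟩
    convert add_mem hc hd using 1
    rw [mul_add, add_smul]; abel
  | mul x y _ _ hx hy =>
    obtain ⟨c, hc⟩ := hx
    obtain ⟨d, hd⟩ := hy
    refine ⟨c * d, ?_⟩
    convert add_mem (mul_mem_cupsIdeal hc 1 y) (Submodule.smul_mem _ c hd) using 1
    rw [one_mul, sub_mul, smul_sub, smul_smul, mul_assoc, smul_mul_assoc]; abel

/-- Modulo the ideal generated by `cups q n (k + 1)`, the corner of `cups q n k` is spanned by
`cups q n k`. -/
theorem exists_cups_corner (k : ℕ) (a : TL q n) :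
    ∃ c : ℂ, cups q n k * a * cups q n k - c • cups q n k ∈ cupsIdeal q n (k + 1) := by
  have h := cups_corner (q := q) (n := n) k (Submodule.mul_mem_mul (Submodule.mul_mem_mul
    (Submodule.mem_span_singleton_self (R := ℂ) (cups q n k)) (Submodule.mem_top (x := a)))
    (Submodule.mem_span_singleton_self (R := ℂ) (cups q n k)))
  obtain ⟨x, hx, e⟩ := Submodule.mem_span_singleton_mul.1 h
  rw [← e]
  exact exists_cups_mul_tail hx

/-! ### Simple modules are determined by the last cup product that acts nontrivially -/

theorem cupsIdeal_smul {M : Type*} [AddCommGroup M] [Module (TL q n) M] {k : ℕ}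
    
    (h : ∀ x : M, cups q n k • x = 0) {a : TL q n} (ha : a ∈ cupsIdeal q n k) (x : M) :
    a • x = 0 := by
  induction ha using Submodule.mul_induction_on' with
  | mem_mul_mem a ha b _ =>
    rw [mul_smul]
    generalize b • x = y
    induction ha using Submodule.mul_induction_on' with
    | mem_mul_mem a _ b hb =>
      obtain ⟨c, rfl⟩ := Submodule.mem_span_singleton.1 hb
      rw [mul_smul, Algebra.smul_def, mul_smul, h, smul_zero, smul_zero]
    | add x _ y _ hx hy => rw [add_smul, hx, hy, add_zero]
  | add x _ y _ hx hy => rw [add_smul, hx, hy, add_zero]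

theorem smul_ne_zero_of_ne {M : Type*} [AddCommGroup M] [Module (TL q n) M] {c : ℂ} (hc : c ≠ 0)
    {x : M} (hx : x ≠ 0) : algebraMap ℂ (TL q n) c • x ≠ 0 := by
  intro h
  have := congrArg (fun y => algebraMap ℂ (TL q n) c⁻¹ • y) h
  simp only [← mul_smul, ← map_mul, inv_mul_cancel₀ hc, map_one, one_smul, smul_zero] at this
  exact hx this

/-- On `y` the element `c_k a c_k` acts as `c a` times `c_k`. If `a c_k y ≠ 0`, simplicity provides
`b` with `b a c_k y = y`, and applying `c_k` shows `c (b * a) ≠ 0`. The right side of the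
equivalence does not mention the module, which is what allows two modules to be compared; `c` need
not be linear or unique. -/
theorem ker_toSpanSingleton_cups {M : Type*} [AddCommGroup M] [Module (TL q n) M]
    [IsSimpleModule (TL q n) M] {k : ℕ} (h : ∀ x : M, cups q n (k + 1) • x = 0)
    {y : M} (hy : cups q n k • y ≠ 0) {c : TL q n → ℂ}
    (hc : ∀ a, cups q n k * a * cups q n k - c a • cups q n k ∈ cupsIdeal q n (k + 1))
    (a : TL q n) : a • cups q n k • y = 0 ↔ ∀ b, c (b * a) = 0 := by
  have key : ∀ a, cups q n k • a • cups q n k • y = algebraMap ℂ (TL q n) (c a) • cups q n k • y := by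
    intro a
    have := cupsIdeal_smul h (hc a) y
    rwa [sub_smul, sub_eq_zero, Algebra.smul_def, mul_smul, mul_smul, mul_smul] at this
  constructor
  · intro ha b
    by_contra hb
    refine smul_ne_zero_of_ne (q := q) (n := n) hb hy ?_
    rw [← key, mul_smul, ha, smul_zero, smul_zero]
  · intro hb
    by_contra ha
    obtain ⟨b, e⟩ := IsSimpleModule.toSpanSingleton_surjective (TL q n) ha y
    rw [LinearMap.toSpanSingleton_apply] at e
    apply hy
    have := key (b * a)
    rw [hb, map_zero, zero_smul, mul_smul, e] at this
    exact this

/-- A simple module is determined by the largest `k` for which `cups q n k` acts nontrivially. -/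
theorem nonempty_equiv_of_cups {M N : Type*} [AddCommGroup M] [Module (TL q n) M]
    [IsSimpleModule (TL q n) M] [AddCommGroup N] [Module (TL q n) N] [IsSimpleModule (TL q n) N]
    {k : ℕ} (hM : ∀ x : M, cups q n (k + 1) • x = 0) (hM' : ∃ x : M, cups q n k • x ≠ 0)
    (hN : ∀ x : N, cups q n (k + 1) • x = 0) (hN' : ∃ x : N, cups q n k • x ≠ 0) :
    Nonempty (M ≃ₗ[TL q n] N) := by
  choose c hc using exists_cups_corner (q := q) (n := n) k
  obtain ⟨x, hx⟩ := hM'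
  obtain ⟨y, hy⟩ := hN'
  have e : (LinearMap.toSpanSingleton (TL q n) M (cups q n k • x)).ker =
      (LinearMap.toSpanSingleton (TL q n) N (cups q n k • y)).ker := by
    ext a
    rw [LinearMap.mem_ker, LinearMap.mem_ker, LinearMap.toSpanSingleton_apply,
      LinearMap.toSpanSingleton_apply, ker_toSpanSingleton_cups hM hx hc,
      ker_toSpanSingleton_cups hN hy hc]
  exact ⟨((LinearMap.quotKerEquivOfSurjective _
    (IsSimpleModule.toSpanSingleton_surjective (TL q n) hx)).symm.trans
    (Submodule.quotEquivOfEq _ _ e)).trans (LinearMap.quotKerEquivOfSurjective _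
    (IsSimpleModule.toSpanSingleton_surjective (TL q n) hy))⟩

theorem cups_eq_zero {k : ℕ} (h : n < 2 * k) : cups q n k = 0 := by
  obtain _ | k := k
  · omega
  · rw [cups, genNat_of_not (by omega), zero_mul]

/-- The products `c_k` start at `1` and vanish once `2k > n`, so a least `k` with `c_{k+1}` acting
as zero exists. -/
theorem exists_max_cups (M : Type*) [AddCommGroup M] [Module (TL q n) M] [Nontrivial M] :
    ∃ k, 2 * k ≤ n ∧ (∀ x : M, cups q n (k + 1) • x = 0) ∧ ∃ x : M, cups q n k • x ≠ 0 := by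
  classical
  have hex : ∃ k, ∀ x : M, cups q n (k + 1) • x = 0 :=
    ⟨n, fun x => by rw [cups_eq_zero (by omega), zero_smul]⟩
  have h1 : ∃ x : M, cups q n (Nat.find hex) • x ≠ 0 := by
    rcases hk : Nat.find hex with _ | k
    · obtain ⟨x, hx⟩ := exists_ne (0 : M)
      exact ⟨x, by rwa [cups, one_smul]⟩
    · have := Nat.find_min hex (m := k) (by omega)
      push Not at this
      exact this
  refine ⟨Nat.find hex, ?_, Nat.find_spec hex, h1⟩
  by_contra h
  obtain ⟨x, hx⟩ := h1
  exact hx (by rw [cups_eq_zero (by omega), zero_smul])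

end TL

/-! ### Quantum numbers -/

/-- The quantum number `[k]`, multiplied by `q - q⁻¹`. -/
def quantum (q : ℂ) (k : ℤ) : ℂ := q ^ k - q ^ (-k)

theorem quantum_zero (q : ℂ) : quantum q 0 = 0 := by simp [quantum]

theorem quantum_add_quantum {q : ℂ} (hq : q ≠ 0) (k : ℤ) :
    quantum q (k + 1) + quantum q (k - 1) = -loopValue q * quantum q k := by
  simp only [quantum, loopValue, neg_add, neg_sub, zpow_add₀ hq, zpow_sub₀ hq, zpow_neg, zpow_one]
  field_simp
  ring

theorem quantum_eq_zero_iff {q : ℂ} (hq : q ≠ 0) (k : ℕ) :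
    quantum q k = 0 ↔ orderOf (q ^ 2) ∣ k := by
  rw [orderOf_dvd_iff_pow_eq_one, quantum, zpow_neg, zpow_natCast, sub_eq_zero,
    ← mul_eq_one_iff_eq_inv₀ (pow_ne_zero _ hq), ← pow_mul, ← pow_add, two_mul]

section RootOfUnity

variable {q : ℂ} {ℓ : ℕ}

theorem ne_zero_of_orderOf (hℓ : 3 ≤ ℓ) (hq : orderOf (q ^ 2) = ℓ) : q ≠ 0 := by
  rintro rfl
  have h := pow_orderOf_eq_one ((0 : ℂ) ^ 2)
  rw [hq, zero_pow two_ne_zero, zero_pow (by omega)] at h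
  exact zero_ne_one h

theorem quantum_order (hℓ : 3 ≤ ℓ) (hq : orderOf (q ^ 2) = ℓ) : quantum q ℓ = 0 :=
  (quantum_eq_zero_iff (ne_zero_of_orderOf hℓ hq) ℓ).2 hq.dvd

theorem quantum_ne_zero (hℓ : 3 ≤ ℓ) (hq : orderOf (q ^ 2) = ℓ) {k : ℤ} (h0 : 0 < k)
    (h1 : k < ℓ) : quantum q k ≠ 0 := by
  lift k to ℕ using h0.le
  rw [Ne, quantum_eq_zero_iff (ne_zero_of_orderOf hℓ hq), hq]
  exact Nat.not_dvd_of_pos_of_lt (by omega) (by omega)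

/-- From `[2] = -δ [1]` and `2 < ℓ`. This is where `ℓ ≥ 3` matters: with `δ ≠ 0`, cups can be
normalized and every diagram pairs nontrivially with itself. -/
theorem loopValue_ne_zero (hℓ : 3 ≤ ℓ) (hq : orderOf (q ^ 2) = ℓ) : loopValue q ≠ 0 := by
  intro h
  have := quantum_add_quantum (ne_zero_of_orderOf hℓ hq) 1
  rw [h, sub_self, quantum_zero, add_zero, neg_zero, zero_mul] at this
  exact quantum_ne_zero hℓ hq (by norm_num) (by omega) this

end RootOfUnity

/-! ### Existence and uniqueness of the Jones-Wenzl idempotent -/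

namespace TL

variable {q : ℂ} {n : ℕ}

/-- The augmentation of `TL_n(q)` that kills the generators. -/
def augmentation (q : ℂ) (n : ℕ) : TL q n →ₐ[ℂ] ℂ :=
  lift (fun _ => 0) (fun _ => by simp) (fun _ _ _ => by simp) (fun _ _ _ => by simp)

theorem augmentation_gen (i : Fin (n - 1)) : augmentation q n (gen q i) = 0 := lift_gen _ _ _ _ i

theorem augmentation_genNat (i : ℕ) : augmentation q n (genNat q n i) = 0 := by
  by_cases h : i < n - 1
  · rw [genNat_of_lt h, augmentation_gen]
  · rw [genNat_of_not h, map_zero]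

theorem smul_eq_augmentation {M : Type*} [AddCommGroup M] [Module (TL q n) M] {x : M}
    (h : ∀ i : Fin (n - 1), gen q i • x = 0) (a : TL q n) :
    a • x = algebraMap ℂ (TL q n) (augmentation q n a) • x := by
  induction a using TL.induction with
  | scalar c => rw [AlgHom.commutes, Algebra.algebraMap_self_apply]
  | gen i => rw [h, augmentation_gen, map_zero, zero_smul]
  | mul a b ha hb =>
    rw [mul_smul, hb, ← mul_smul, ← Algebra.commutes, mul_smul, ha, ← mul_smul, ← map_mul,
      map_mul (augmentation q n), mul_comm]
  | add a b ha hb => rw [add_smul, ha, hb, map_add, map_add, add_smul]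

theorem mul_eq_augmentation {x : TL q n} (h : ∀ i : Fin (n - 1), x * gen q i = 0) (a : TL q n) :
    x * a = augmentation q n a • x := by
  induction a using TL.induction with
  | scalar c => rw [AlgHom.commutes, ← Algebra.commutes, Algebra.smul_def]; rfl
  | gen i => rw [h, augmentation_gen, zero_smul]
  | mul a b ha hb => rw [← mul_assoc, ha, smul_mul_assoc, hb, smul_smul, map_mul]
  | add a b ha hb => rw [mul_add, ha, hb, map_add, add_smul]

/-- The Jones-Wenzl element on `m + 1` strands. -/
def jonesWenzl (q : ℂ) (n : ℕ) : ℕ → TL q n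
  | 0 => 1
  | m + 1 => jonesWenzl q n m + (quantum q (m + 1 : ℕ) / quantum q (m + 2 : ℕ)) •
      (jonesWenzl q n m * genNat q n m * jonesWenzl q n m)

theorem augmentation_jonesWenzl (m : ℕ) : augmentation q n (jonesWenzl q n m) = 1 := by
  induction m with
  | zero => exact map_one _
  | succ m ih => simp [jonesWenzl, augmentation_genNat, ih]

theorem jonesWenzl_commute (m : ℕ) {j : ℕ} (h : m + 1 ≤ j) :
    Commute (genNat q n j) (jonesWenzl q n m) := by
  induction m with
  | zero => exact Commute.one_right _
  | succ m ih =>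
    have h1 := ih (by omega)
    have h2 : Commute (genNat q n j) (genNat q n m) := genNat_comm (.inr (by omega))
    exact h1.add_right (((h1.mul_right h2).mul_right h1).smul_right _)

/-- Wenzl's recursion; the claims feed one another and must be proved together. The last one (a
partial trace) makes `f_m` kill the next element, because its coefficient cancels the one in the
recursion. Only `[1], …, [N]` are inverted, so `N = ℓ - 1` is allowed: at `m = ℓ - 2` the quantum
number `[ℓ]` is only a numerator. For `m = 0` the truncated `m - 1` refers to the unit element. -/
theorem jonesWenzl_properties (hq : q ≠ 0) {N : ℕ}
    (hN : ∀ k : ℕ, 0 < k → k ≤ N → quantum q k ≠ 0) (m : ℕ) (hm : m + 1 ≤ N) :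
    jonesWenzl q n m * jonesWenzl q n m = jonesWenzl q n m ∧
    (∀ j < m, genNat q n j * jonesWenzl q n m = 0 ∧ jonesWenzl q n m * genNat q n j = 0) ∧
    jonesWenzl q n m * jonesWenzl q n (m - 1) = jonesWenzl q n m ∧
    jonesWenzl q n (m - 1) * jonesWenzl q n m = jonesWenzl q n m ∧
    genNat q n m * jonesWenzl q n m * genNat q n m =
      (-(quantum q (m + 2 : ℕ) / quantum q (m + 1 : ℕ))) •
        (jonesWenzl q n (m - 1) * genNat q n m) := by
  induction m with
  | zero =>
    refine ⟨mul_one _, fun j hj => absurd hj (Nat.not_lt_zero j), mul_one _, mul_one _, ?_⟩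
    have h := quantum_add_quantum hq 1
    rw [sub_self, quantum_zero, add_zero] at h
    have h1 := hN 1 one_pos hm
    simp only [jonesWenzl, mul_one, genNat_sq]
    have e0 : jonesWenzl q n (0 - 1) = 1 := rfl
    rw [e0, one_mul]
    congr 1
    have e : quantum q ((0 + 2 : ℕ) : ℤ) = quantum q (1 + 1) := rfl
    rw [e, h, zero_add, Nat.cast_one, mul_div_assoc, div_self (by exact_mod_cast h1), mul_one,
      neg_neg]
  | succ m ih =>
    obtain ⟨i1, i2, i3, i4, i5⟩ := ih (by omega)
    have n1 := hN (m + 1) (by omega) (by omega)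
    have n2 := hN (m + 2) (by omega) (by omega)
    have c0 : Commute (genNat q n m) (jonesWenzl q n (m - 1)) := by
      rcases m with _ | m
      · exact Commute.one_right _
      · exact jonesWenzl_commute m le_rfl
    have c1 : Commute (genNat q n (m + 1)) (jonesWenzl q n m) := jonesWenzl_commute m le_rfl
    have b : genNat q n (m + 1) * genNat q n m * genNat q n (m + 1) = genNat q n (m + 1) := by
      by_cases h : m < n - 1
      · exact genNat_braid (.inr rfl) h
      · rw [genNat_of_not (i := m + 1) (by omega), mul_zero]
    have sq := genNat_sq (q := q) (n := n) (m + 1)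
    have hc : (quantum q (m + 1 : ℕ) / quantum q (m + 2 : ℕ)) *
        (-(quantum q (m + 2 : ℕ) / quantum q (m + 1 : ℕ))) = -1 := by
      field_simp
    -- The relation `[m+3] + [m+1] = -δ [m+2]`, divided by `[m+2]`: it turns the two terms of the
    -- next partial trace into a single coefficient.
    have hd : loopValue q + quantum q (m + 1 : ℕ) / quantum q (m + 2 : ℕ) =
        -(quantum q (m + 1 + 2 : ℕ) / quantum q (m + 1 + 1 : ℕ)) := by
      have h := quantum_add_quantum hq (m + 2 : ℕ)
      have e1 : (((m + 2 : ℕ) : ℤ) + 1) = (m + 1 + 2 : ℕ) := by push_cast; ring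
      have e2 : (((m + 2 : ℕ) : ℤ) - 1) = (m + 1 : ℕ) := by push_cast; ring
      rw [e1, e2] at h
      have n2' : quantum q (m + 1 + 1 : ℕ) ≠ 0 := n2
      change _ + _ / quantum q (m + 1 + 1 : ℕ) = _
      change _ = - _ * quantum q (m + 1 + 1 : ℕ) at h
      field_simp
      linear_combination h
    simp only [Nat.add_sub_cancel]
    rw [jonesWenzl]
    set c := quantum q (m + 1 : ℕ) / quantum q (m + 2 : ℕ)
    set J := jonesWenzl q n m
    set J' := jonesWenzl q n (m - 1)
    set G := genNat q n m
    set G' := genNat q n (m + 1)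
    have z1 : G * (J + c • (J * G * J)) = 0 := by
      have : G * (J + c • (J * G * J)) = G * J + c • ((G * J * G) * J) := by
        simp only [mul_add, mul_smul_comm, mul_assoc]
      rw [this, i5, smul_mul_assoc, smul_smul, hc, ← c0.eq, mul_assoc, i4, neg_one_smul,
        add_neg_cancel]
    have z2 : (J + c • (J * G * J)) * G = 0 := by
      have : (J + c • (J * G * J)) * G = J * G + c • (J * (G * J * G)) := by
        simp only [add_mul, smul_mul_assoc, mul_assoc]
      rw [this, i5, mul_smul_comm, smul_smul, hc, ← mul_assoc, i3, neg_one_smul,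
        add_neg_cancel]
    have d1 : (J + c • (J * G * J)) * J = J + c • (J * G * J) := by
      rw [add_mul, i1, smul_mul_assoc, mul_assoc (J * G), i1]
    have d2 : J * (J + c • (J * G * J)) = J + c • (J * G * J) := by
      rw [mul_add, i1, mul_smul_comm, ← mul_assoc, ← mul_assoc, i1]
    refine ⟨?_, ?_, d1, d2, ?_⟩
    · have : ∀ X : TL q n, X * (J + c • (J * G * J)) = X * J + c • (X * J * G * J) := by
        intro X; simp only [mul_add, mul_smul_comm, mul_assoc]
      rw [this, d1, z2, zero_mul, smul_zero, add_zero]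
    · intro j hj
      rcases Nat.lt_succ_iff_lt_or_eq.1 hj with hj | rfl
      · obtain ⟨a1, a2⟩ := i2 j hj
        refine ⟨?_, ?_⟩
        · rw [mul_add, mul_smul_comm, ← mul_assoc, ← mul_assoc, a1]; simp
        · rw [add_mul, smul_mul_assoc, mul_assoc, a2]; simp
      · exact ⟨z1, z2⟩
    -- `f_{m+1}` commutes with `J`, so the first term contributes a square `f_{m+1} f_{m+1}` and the
    -- second the braid `f_{m+1} f_m f_{m+1}`.
    · have e : G' * (J + c • (J * G * J)) * G' = J * (G' * G') + c • (J * (G' * G * G') * J) := by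
        have c1' : G' * J = J * G' := c1
        have c2' : ∀ X, G' * (J * X) = J * (G' * X) := fun X => by
          rw [← mul_assoc, c1', mul_assoc]
        simp only [mul_add, add_mul, mul_smul_comm, smul_mul_assoc, mul_assoc, c1', c2']
      rw [e, b, sq, mul_assoc J G' J, c1.eq, ← mul_assoc, i1, mul_smul_comm, ← add_smul, hd]

/-- Since `E` is annihilated by the generators, `E = E * E` is also the augmentation of `E` times
`E`, and `E ≠ 0`. -/
theorem augmentation_of_isJonesWenzl {q : ℂ} {m : ℕ} {E : TL q m} (hE : IsJonesWenzl E) :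
    augmentation q m E = 1 := by
  have e3 := mul_eq_augmentation hE.mul_gen E
  rw [hE.idem] at e3
  by_contra h'
  have : (1 - augmentation q m E) • E = 0 := by rw [sub_smul, one_smul, ← e3, sub_self]
  rcases smul_eq_zero.1 this with h'' | h''
  · exact h' (sub_eq_zero.1 h'').symm
  · exact hE.ne_zero h''

theorem isJonesWenzl_existsUnique {ℓ : ℕ} (hℓ : 3 ≤ ℓ) (hq : orderOf (q ^ 2) = ℓ) :
    ∃! E : TL q (ℓ - 1), IsJonesWenzl E := by
  have h := jonesWenzl_properties (n := ℓ - 1) (ne_zero_of_orderOf hℓ hq) (N := ℓ - 1)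
    (fun k h0 h1 => quantum_ne_zero hℓ hq (by omega) (by omega)) (ℓ - 2) (by omega)
  refine ⟨jonesWenzl q (ℓ - 1) (ℓ - 2), ⟨fun h0 => ?_, h.1, fun i => ?_, fun i => ?_⟩, ?_⟩
  · have := augmentation_jonesWenzl (q := q) (n := ℓ - 1) (ℓ - 2)
    rw [h0, map_zero] at this
    exact zero_ne_one this
  · rw [← genNat_of_lt i.2]; exact (h.2.1 i (by omega)).1
  · rw [← genNat_of_lt i.2]; exact (h.2.1 i (by omega)).2
  -- Two such idempotents have augmentation one, so their product equals each of them.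
  · intro E hE
    have e1 := mul_eq_augmentation hE.mul_gen (jonesWenzl q (ℓ - 1) (ℓ - 2))
    have e2 := smul_eq_augmentation (x := jonesWenzl q (ℓ - 1) (ℓ - 2)) (fun i => by
      rw [smul_eq_mul, ← genNat_of_lt i.2]; exact (h.2.1 i (by omega)).1) E
    rw [augmentation_jonesWenzl, one_smul] at e1
    rw [augmentation_of_isJonesWenzl hE, map_one, one_smul, smul_eq_mul, e1] at e2
    exact e2

end TL

/-! ### Standard diagrams -/

theorem reconnect_of_ne {P : Type*} [DecidableEq P] {a b : P} {s : P → P} (h1 : ∀ x, s (s x) = x)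
    {x : P} (xa : x ≠ a) (xb : x ≠ b) (ya : s x ≠ a) (yb : s x ≠ b) :
    reconnect a b s x = s x := by
  simp only [reconnect]; grind

theorem reconnect_slide {P : Type*} [DecidableEq P] {a b c : P} {s : P → P}
    (h1 : ∀ x, s (s x) = x) (hab : a ≠ b) (hac : a ≠ c) (hbc : b ≠ c)
    (h : s b = c) (x : P) : reconnect b c (reconnect a b s) x = s x := by
  have e1 : reconnect a b s b = a := by simp only [reconnect]; grind
  have e2 : reconnect a b s c = s a := by simp only [reconnect]; grind
  rw [reconnect, e1, e2]
  simp only [reconnect]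
  grind

/-- A strictly increasing self-map of `Fin t` lies above the identity; applied also to the map
conjugated by reversal, this leaves no freedom. -/
theorem eq_add_of_strictMono {t a : ℕ} {f : Fin t → ℕ} (hf : StrictMono f) (h1 : ∀ j, a ≤ f j)
    (h2 : ∀ j, f j < a + t) (j : Fin t) : f j = a + j := by
  have g1 : StrictMono fun j : Fin t => (⟨f j - a, by have := h1 j; have := h2 j; omega⟩ : Fin t) := by
    intro i j hij
    have := hf hij
    have := h1 i
    rw [Fin.mk_lt_mk]
    omega
  have g2 : StrictMono fun j : Fin t =>
      (⟨f j.rev - a, by have := h1 j.rev; have := h2 j.rev; omega⟩ : Fin t).rev := by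
    intro i j hij
    exact Fin.rev_lt_rev.2 (g1 (Fin.rev_lt_rev.2 hij))
  have e1 := g1.le_apply (x := j)
  have e2 := g2.le_apply (x := j.rev)
  rw [Fin.rev_le_rev] at e2
  simp only [Fin.le_def, Fin.rev_rev] at e1 e2
  have := h1 j
  omega

namespace TLDiagram

variable {t n : ℕ}

/-- The diagram with `k` adjacent cups that has `s` through lines to the left of the cups. -/
def std (s k : ℕ) (h : n = t + 2 * k) (hs : s ≤ t) : TLDiagram t n where
  σ := Sum.elim (fun j => Sum.inr ⟨if j.val < s then j else j + 2 * k, by split_ifs <;> omega⟩)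
    (fun i => if h1 : i.val < s then Sum.inl ⟨i, by omega⟩ else
      if h2 : i.val < s + 2 * k then
        Sum.inr ⟨if (i - s) % 2 = 0 then i + 1 else i - 1, by split_ifs <;> omega⟩
      else Sum.inl ⟨i - 2 * k, by omega⟩)
  invol := by
    rintro (⟨j, hj⟩ | ⟨i, hi⟩)
    · simp only [Sum.elim_inl, Sum.elim_inr]
      split_ifs <;> first | omega | skip
      · rfl
      · congr 2; omega
    · simp only [Sum.elim_inr]
      split_ifs <;> simp only [Sum.elim_inl, Sum.elim_inr] <;> split_ifs <;>
        first | omega | skip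
      all_goals (congr 2; try omega)
  no_fix := by
    rintro (⟨j, hj⟩ | ⟨i, hi⟩)
    · simp
    · simp only [Sum.elim_inr]
      split_ifs <;> simp
      omega
  planar := by
    rintro (⟨i, hi⟩ | ⟨i, hi⟩) (⟨j, hj⟩ | ⟨j, hj⟩) <;>
      simp only [Sum.elim_inr, Sum.elim_inl] <;> split_ifs <;>
      simp only [tlPos, Sum.elim_inl, Sum.elim_inr] <;> (try split_ifs) <;>
      (try simp only [Sum.elim_inl, Sum.elim_inr]) <;> omega

theorem std_inl {s k : ℕ} (h : n = t + 2 * k) (hs : s ≤ t) (j : Fin t) :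
    (std s k h hs).σ (Sum.inl j) =
      Sum.inr ⟨if j.val < s then j else j + 2 * k, by split_ifs <;> omega⟩ := rfl

theorem std_isMonic {s k : ℕ} (h : n = t + 2 * k) (hs : s ≤ t) : (std s k h hs).IsMonic :=
  fun j => ⟨_, std_inl h hs j⟩

/-- A through line followed to the middle returns along its mirror image. Consequently `(D, D)` is a
power of the loop value and is nonzero when `δ ≠ 0`. -/
theorem glueMonic_self {D : TLDiagram t n} (h : D.IsMonic) : GlueMonic fun _ => D := by
  intro s j
  obtain ⟨x, hx⟩ := h j
  have e : ∀ r, glue (fun _ => D) (Sum.inr (r, j)) (Sum.inl x) := by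
    intro r
    have := glue_edge (ι := gluePt) (fun _ : Bool => D.σ) r (Sum.inl j)
    rwa [hx] at this
  exact ⟨j, (glue fun _ => D).trans (e s) ((glue fun _ => D).symm (e _))⟩

/-- The points `2j` and `2j + 1` are joined for all `j < k`. -/
def HasCups (D : TLDiagram t n) (k : ℕ) : Prop :=
  ∀ j < k, ∃ a b : Fin n, a.val = 2 * j ∧ b.val = 2 * j + 1 ∧ D.σ (Sum.inr a) = Sum.inr b

theorem std_hasCups {k : ℕ} (h : n = t + 2 * k) : (std 0 k h (Nat.zero_le t)).HasCups k := by
  intro j hj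
  refine ⟨⟨2 * j, by omega⟩, ⟨2 * j + 1, by omega⟩, rfl, rfl, ?_⟩
  simp only [std, Sum.elim_inr]
  split_ifs <;> first | omega | rfl

theorem HasCups.le_of_inl {D : TLDiagram t n} {k : ℕ} (hD : D.HasCups k) {j : Fin t} {x : Fin n}
    (hx : D.σ (Sum.inl j) = Sum.inr x) : 2 * k ≤ x := by
  by_contra hlt
  obtain ⟨a, b, ha, hb, e⟩ := hD (x / 2) (by omega)
  have hx' : D.σ (Sum.inr x) = Sum.inl j := by rw [← hx, D.invol]
  have e' : D.σ (Sum.inr b) = Sum.inr a := by rw [← e, D.invol]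
  rcases Nat.mod_two_eq_zero_or_one x with h | h
  · obtain rfl : x = a := Fin.ext (by omega)
    rw [e] at hx'
    cases hx'
  · obtain rfl : x = b := Fin.ext (by omega)
    rw [e'] at hx'
    cases hx'

theorem HasCups.le_of_inr {D : TLDiagram t n} {k : ℕ} (hD : D.HasCups k) {x y : Fin n}
    (hk : 2 * k ≤ x) (hx : D.σ (Sum.inr x) = Sum.inr y) : 2 * k ≤ y := by
  by_contra hlt
  obtain ⟨a, b, ha, hb, e⟩ := hD (y / 2) (by omega)
  have hx' : D.σ (Sum.inr y) = Sum.inr x := by rw [← hx, D.invol]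
  have e' : D.σ (Sum.inr b) = Sum.inr a := by rw [← e, D.invol]
  rcases Nat.mod_two_eq_zero_or_one y with h | h
  · obtain rfl : y = a := Fin.ext (by omega)
    rw [e, Sum.inr.injEq] at hx'
    subst hx'
    omega
  · obtain rfl : y = b := Fin.ext (by omega)
    rw [e', Sum.inr.injEq] at hx'
    subst hx'
    omega

/-- Through lines cannot cross; `tlPos` lists the bottom points in reverse, so planarity reads as
preservation of order. -/
theorem strictMono_of_inl {D : TLDiagram t n} {f : Fin t → Fin n}
    (hf : ∀ j, D.σ (Sum.inl j) = Sum.inr (f j)) : StrictMono fun j => (f j).val := by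
  intro i j hij
  have := D.planar (Sum.inl j) (Sum.inl i)
  rw [hf, hf] at this
  simp only [tlPos, Sum.elim_inl, Sum.elim_inr] at this
  have hne : f i ≠ f j := by
    intro h
    have := (D.invol (Sum.inl i)).symm.trans ((congrArg D.σ ((hf i).trans (h ▸ (hf j).symm))).trans
      (D.invol (Sum.inl j)))
    rw [Sum.inl.injEq] at this
    exact hij.ne this
  have hne' := Fin.val_ne_of_ne hne
  have := Fin.lt_def.1 hij
  show (f i).val < (f j).val
  omega

theorem HasCups.add_le {D : TLDiagram t n} {k : ℕ} (hD : D.HasCups k) (hM : D.IsMonic)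
    (hk : 2 * k ≤ n) : t + 2 * k ≤ n := by
  choose f hf using hM
  have hinj : Function.Injective fun j : Fin t =>
      (⟨f j - 2 * k, by have := hD.le_of_inl (hf j); omega⟩ : Fin (n - 2 * k)) := by
    intro i j hij
    have h1 := hD.le_of_inl (hf i)
    have h2 := hD.le_of_inl (hf j)
    rw [Fin.mk.injEq] at hij
    exact (strictMono_of_inl hf).injective (by omega)
  have := Fintype.card_le_of_injective _ hinj
  rw [Fintype.card_fin, Fintype.card_fin] at this
  omega

theorem HasCups.inl_eq {D : TLDiagram t n} {k : ℕ} (hD : D.HasCups k) (hM : D.IsMonic)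
    (h : n = t + 2 * k) (j : Fin t) : D.σ (Sum.inl j) = Sum.inr ⟨2 * k + j, by omega⟩ := by
  choose f hf using hM
  rw [hf]
  congr 1
  exact Fin.ext (eq_add_of_strictMono (strictMono_of_inl hf) (fun j => hD.le_of_inl (hf j))
    (fun j => by have := (f j).2; omega) j)

/-- The `t` through lines have exactly `t` free top points and must meet them in order, so nothing
beyond the `k` cups remains to be chosen. -/
theorem HasCups.eq {D D' : TLDiagram t n} {k : ℕ} (hD : D.HasCups k) (hM : D.IsMonic)
    (hD' : D'.HasCups k) (hM' : D'.IsMonic) (h : n = t + 2 * k) : D = D' := by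
  have key : ∀ D D' : TLDiagram t n, ∀ x y, D.σ x = y → D'.σ x = y → D.σ y = D'.σ y := by
    intro D D' x y h1 h2
    rw [← h1, D.invol, h1, ← h2, D'.invol]
  refine ext_σ ?_
  rintro (j | x)
  · rw [hD.inl_eq hM h, hD'.inl_eq hM' h]
  · by_cases hx : x.val < 2 * k
    · obtain ⟨a, b, ha, hb, e⟩ := hD (x / 2) (by omega)
      obtain ⟨a', b', ha', hb', e'⟩ := hD' (x / 2) (by omega)
      obtain rfl : a' = a := Fin.ext (by omega)
      obtain rfl : b' = b := Fin.ext (by omega)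
      rcases Nat.mod_two_eq_zero_or_one x with h | h
      · obtain rfl : x = a' := Fin.ext (by omega)
        rw [e, e']
      · obtain rfl : x = b' := Fin.ext (by omega)
        exact key _ _ _ _ e e'
    · have e1 := hD.inl_eq hM h ⟨x - 2 * k, by omega⟩
      have e2 := hD'.inl_eq hM' h ⟨x - 2 * k, by omega⟩
      have e3 : (⟨2 * k + (x.val - 2 * k), by omega⟩ : Fin n) = x := Fin.ext (by simp only; omega)
      simp only [e3] at e1 e2
      exact key _ _ _ _ e1 e2

theorem HasCups.hook {D : TLDiagram t n} {k : ℕ} (hD : D.HasCups k) (i : Fin (n - 1))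
    (hi : 2 * k ≤ i) : (hook i D).HasCups k := by
  intro j hj
  obtain ⟨a, b, ha, hb, e⟩ := hD j hj
  refine ⟨a, b, ha, hb, ?_⟩
  have h : ∀ c : Fin n, c.val < i → (Sum.inr c : Fin t ⊕ Fin n) ≠ lpt i ∧
      (Sum.inr c : Fin t ⊕ Fin n) ≠ rpt i := by
    intro c hc
    simp only [lpt, rpt, ne_eq, Sum.inr.injEq, Fin.ext_iff]
    omega
  rw [← e]
  refine reconnect_of_ne D.invol (h a (by omega)).1 (h a (by omega)).2 ?_ ?_
  · rw [e]; exact (h b (by omega)).1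
  · rw [e]; exact (h b (by omega)).2

theorem HasCups.hook_succ {D : TLDiagram t n} {k : ℕ} (hD : D.HasCups k) (i : Fin (n - 1))
    (hi : i.val = 2 * k) : (TLDiagram.hook i D).HasCups (k + 1) := by
  intro j hj
  rcases Nat.lt_succ_iff_lt_or_eq.1 hj with hj | rfl
  · exact hD.hook i hi.ge j hj
  · exact ⟨⟨i, by omega⟩, ⟨i + 1, by omega⟩, hi, by simp [hi], reconnect_left⟩

/-- A diagram with too few cups has a cup between neighbours right of the cups considered. -/
theorem HasCups.exists_simple {D : TLDiagram t n} {k : ℕ} (hD : D.HasCups k)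
    (hn : t + 2 * k < n) :
    ∃ i : Fin (n - 1), 2 * k ≤ i ∧ D.σ (lpt i) = rpt i := by
  -- Pigeonhole: more than `t` top points lie right of the cups, so they cannot all be ends of
  -- through lines.
  have start : ∃ x y : Fin n, 2 * k ≤ x.val ∧ x < y ∧ D.σ (Sum.inr x) = Sum.inr y := by
    by_contra hcon
    push Not at hcon
    have h : ∀ x : Fin (n - 2 * k), ∃ j : Fin t,
        D.σ (Sum.inr ⟨x + 2 * k, by omega⟩) = Sum.inl j := by
      intro x
      rcases hx : D.σ (Sum.inr ⟨x + 2 * k, by omega⟩) with j | y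
      · exact ⟨j, rfl⟩
      · exfalso
        have hy := hD.le_of_inr (by simp) hx
        rcases lt_trichotomy (⟨x + 2 * k, by omega⟩ : Fin n) y with h | h | h
        · exact hcon _ _ (by simp) h hx
        · exact D.no_fix _ (hx.trans (by rw [h]))
        · exact hcon _ _ hy h (by rw [← hx, D.invol])
    choose f hf using h
    have hinj : Function.Injective f := by
      intro x y hxy
      have h1 := D.invol (Sum.inr ⟨x + 2 * k, by omega⟩)
      rw [hf, hxy, ← hf, D.invol, Sum.inr.injEq, Fin.mk.injEq] at h1
      exact Fin.ext (by omega)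
    have := Fintype.card_le_of_injective _ hinj
    rw [Fintype.card_fin, Fintype.card_fin] at this
    omega
  obtain ⟨x, y, hx, hxy, e⟩ := start
  -- Descent on the gap of the arc: if its ends are not neighbours, planarity forces the arc from
  -- the next point `x + 1` to be nested strictly inside.
  obtain ⟨d, hd⟩ : ∃ d, y.val = x.val + 1 + d := ⟨y - x - 1, by rw [Fin.lt_def] at hxy; omega⟩
  induction d using Nat.strong_induction_on generalizing x y with
  | _ d ih =>
    have hyn := y.2
    rcases Nat.eq_zero_or_pos d with rfl | hpos
    · refine ⟨⟨x, by omega⟩, hx, ?_⟩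
      exact e.trans (congrArg Sum.inr (Fin.ext hd))
    · have e' : D.σ (Sum.inr y) = Sum.inr x := by rw [← e, D.invol]
      obtain ⟨z, hz⟩ : ∃ z : Fin n, z.val = x.val + 1 := ⟨⟨x + 1, by omega⟩, rfl⟩
      rcases hw : D.σ (Sum.inr z) with j | w
      · exfalso
        have hw' : D.σ (Sum.inl j) = Sum.inr z := by rw [← hw, D.invol]
        have := D.planar (Sum.inl j) (Sum.inr x)
        rw [hw', e] at this
        simp only [tlPos, Sum.elim_inl, Sum.elim_inr] at this
        omega
      · have hw' : D.σ (Sum.inr w) = Sum.inr z := by rw [← hw, D.invol]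
        have p1 := D.planar (Sum.inr w) (Sum.inr x)
        have p2 := D.planar (Sum.inr x) (Sum.inr z)
        rw [hw', e] at p1
        rw [hw, e] at p2
        simp only [tlPos, Sum.elim_inr] at p1 p2
        have n1 : w ≠ z := by rintro rfl; exact D.no_fix _ hw
        have n2 : w ≠ x := by rintro rfl; rw [e, Sum.inr.injEq] at hw'; subst hw'; omega
        have n3 : w ≠ y := by rintro rfl; rw [e', Sum.inr.injEq] at hw'; subst hw'; omega
        have m1 := Fin.val_ne_of_ne n1
        have m2 := Fin.val_ne_of_ne n2
        have m3 := Fin.val_ne_of_ne n3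
        exact ih (w - z - 1) (by omega) z w (by omega) (by rw [Fin.lt_def]; omega) hw (by omega)

/-- An isotopy: `f_i` moves the cup at `j = i + 1` one place to the left, and `f_j` moves it back.
-/
theorem hook_slide {D : TLDiagram t n} (i j : Fin (n - 1)) (hij : i.val + 1 = j.val)
    (h : D.σ (lpt j) = rpt j) : hook j (hook i D) = D := by
  have h5 : (lpt j : Fin t ⊕ Fin n) = rpt i := by simp [lpt, rpt, hij]
  have h6 : (lpt i : Fin t ⊕ Fin n) ≠ rpt j := by simp [lpt, rpt]; omega
  refine ext_σ fun x => ?_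
  simp only [hook, h5]
  exact reconnect_slide D.invol (lpt_ne_rpt i) h6 (h5 ▸ lpt_ne_rpt j) (h5 ▸ h) x

theorem hook_left (i : Fin (n - 1)) (D : TLDiagram t n) : (hook i D).σ (lpt i) = rpt i :=
  reconnect_left

theorem hook_eq_self {D : TLDiagram t n} {i : Fin (n - 1)} (e : D.σ (lpt i) = rpt i) :
    hook i D = D := by
  refine ext_σ fun x => ?_
  have e2 : D.σ (rpt i) = lpt i := by rw [← e, D.invol]
  simp only [hook]
  rcases reconnect_val (a := lpt i) (b := rpt i) D.invol (lpt_ne_rpt i) x with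
    ⟨a1, a2⟩ | ⟨a1, a2⟩ | ⟨a1, a2, a3⟩ | ⟨a1, a2, a3⟩ | ⟨_, _, _, _, a3⟩
  · rw [a2, a1, e]
  · rw [a2, a1, e2]
  · exact absurd (a1.trans e) a2
  · exact absurd (a1.trans e2) a2
  · exact a3

/-- A property of monic diagrams that is stable under the generators and holds for the standard
diagram holds for all of them. -/
theorem hook_induction {k : ℕ} (h : n = t + 2 * k) {C : TLDiagram t n → Prop}
    (h0 : C (std 0 k h (Nat.zero_le t)))
    (h1 : ∀ i D, D.IsMonic → C D → C (hook i D)) {D : TLDiagram t n} (hD : D.IsMonic) : C D := by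
  -- Here `d` counts the cups still to be brought to the left end, and below `m` is the distance of
  -- a simple cup from the next free place `2j`.
  have main : ∀ d j, j + d = k → ∀ D : TLDiagram t n, D.IsMonic → D.HasCups j → C D := by
    intro d
    induction d with
    | zero =>
      rintro j rfl D hM hC
      rwa [hC.eq hM (std_hasCups h) (std_isMonic h _) h]
    | succ d ih =>
      intro j hj D hM hC
      obtain ⟨i, hi, e⟩ := hC.exists_simple (by omega)
      obtain ⟨m, hm⟩ := Nat.exists_eq_add_of_le hi
      induction m generalizing D i with
      | zero =>
        have e' := hook_eq_self e
        exact ih (j + 1) (by omega) D hM (e' ▸ hC.hook_succ i hm)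
      | succ m ihm =>
        obtain ⟨i', hi'⟩ : ∃ i' : Fin (n - 1), i'.val + 1 = i.val := ⟨⟨i - 1, by omega⟩, by
          simp only; omega⟩
        -- The diagram is `f_i` applied to one whose simple cup lies one place further left; that
        -- diagram is monic because composing with `f_i` never restores monicity.
        have e' := hook_slide i' i hi' e
        have hM' : (hook i' D).IsMonic := IsMonic.of_hook (i := i) (by rwa [e'])
        have := ihm (hook i' D) hM' (hC.hook i' (by omega)) i' (by omega) (hook_left i' D) (by omega)
        rw [← e']
        exact h1 i _ hM' this
  exact main k 0 (by omega) D hD fun j hj => absurd hj (Nat.not_lt_zero j)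

end TLDiagram

/-! ### Simplicity of the heads of the cell modules -/

namespace CellModule

open TLDiagram

variable {q : ℂ} {t n k : ℕ}

theorem gen_smul_ofDiagram (i : Fin (n - 1)) (D : TLDiagram t n) :
    TL.gen q i • ofDiagram q D = hookCoef q i D • ofDiagram q (hook i D) := by
  rw [gen_smul, genAction_ofDiagram]

theorem genNat_smul_ofDiagram {i : ℕ} (hi : i < n - 1) (D : TLDiagram t n) :
    TL.genNat q n i • ofDiagram q D =
      hookCoef q ⟨i, hi⟩ D • ofDiagram q (hook ⟨i, hi⟩ D) := by
  rw [TL.genNat_of_lt hi, gen_smul_ofDiagram]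

theorem hookCoef_ne_zero (hd : loopValue q ≠ 0) (i : Fin (n - 1)) (D : TLDiagram t n) :
    hookCoef q i D ≠ 0 := by
  unfold hookCoef
  split_ifs
  · exact hd
  · exact one_ne_zero

theorem exists_cups_smul_ofDiagram (j : ℕ) (hj : 2 * j ≤ n) (D : TLDiagram t n) :
    ∃ (c : ℂ) (D' : TLDiagram t n), D'.HasCups j ∧
      TL.cups q n j • ofDiagram q D = c • ofDiagram q D' := by
  induction j with
  | zero => exact ⟨1, D, fun j hj => absurd hj (Nat.not_lt_zero j), by rw [TL.cups, one_smul, one_smul]⟩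
  | succ j ih =>
    obtain ⟨c, D', h1, h2⟩ := ih (by omega)
    have hi : 2 * j < n - 1 := by omega
    refine ⟨c * hookCoef q ⟨2 * j, hi⟩ D', hook ⟨2 * j, hi⟩ D', h1.hook_succ _ rfl, ?_⟩
    rw [TL.cups, mul_smul, h2, smul_comm, genNat_smul_ofDiagram hi, smul_smul]

theorem induction_ofDiagram {C : CellModule q t n → Prop} (h0 : C 0)
    (hadd : ∀ v w, C v → C w → C (v + w)) (hsmul : ∀ (c : ℂ) v, C v → C (c • v))
    (h : ∀ D : TLDiagram t n, D.IsMonic → C (ofDiagram q D)) (v : CellModule q t n) : C v := by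
  have hv := (basis q).mem_span v
  induction hv using Submodule.span_induction with
  | mem x hx => obtain ⟨D, rfl⟩ := hx; rw [← ofDiagram_val]; exact h _ D.2
  | zero => exact h0
  | add x y _ _ hx hy => exact hadd _ _ hx hy
  | smul c x _ hx => exact hsmul _ _ hx

/-- Applying `c_j` puts `j` cups on the left, which leaves fewer than `t` top points for the `t`
through lines. -/
theorem cups_smul_eq_zero {j : ℕ} (hj : n < t + 2 * j) (v : CellModule q t n) :
    TL.cups q n j • v = 0 := by
  by_cases hn : 2 * j ≤ n
  · induction v using induction_ofDiagram with
    | h0 => exact smul_zero _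
    | hadd v w hv hw => rw [smul_add, hv, hw, add_zero]
    | hsmul c v hv => rw [smul_comm, hv, smul_zero]
    | h D hD =>
      obtain ⟨c, D', h1, h2⟩ := exists_cups_smul_ofDiagram (q := q) j hn D
      rw [h2, ofDiagram_of_not, smul_zero]
      intro hM
      have := h1.add_le hM hn
      omega
  · rw [TL.cups_eq_zero (by omega), zero_smul]

/-- The class of the diagram whose cups are to the left of the through lines. -/
def stdVec (q : ℂ) (h : n = t + 2 * k) : CellModule q t n :=
  ofDiagram q (std 0 k h (Nat.zero_le t))

/-- By `HasCups.eq` only one monic diagram has all its `k` cups on the left, so `c_k` has image in a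
line. -/
theorem exists_cups_smul (h : n = t + 2 * k) (v : CellModule q t n) :
    ∃ c : ℂ, TL.cups q n k • v = c • stdVec q h := by
  induction v using induction_ofDiagram with
  | h0 => exact ⟨0, by rw [smul_zero, zero_smul]⟩
  | hadd v w hv hw =>
    obtain ⟨c, hc⟩ := hv
    obtain ⟨d, hd⟩ := hw
    exact ⟨c + d, by rw [smul_add, hc, hd, add_smul]⟩
  | hsmul c v hv =>
    obtain ⟨d, hd⟩ := hv
    exact ⟨c * d, by rw [smul_comm, hd, smul_smul]⟩
  | h D hD =>
    obtain ⟨c, D', h1, h2⟩ := exists_cups_smul_ofDiagram (q := q) k (by omega) D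
    by_cases hM : D'.IsMonic
    · exact ⟨c, by rw [h2, h1.eq hM (std_hasCups h) (std_isMonic h _) h]; rfl⟩
    · exact ⟨0, by rw [h2, ofDiagram_of_not q hM, smul_zero, zero_smul]⟩

theorem genNat_smul_stdVec (h : n = t + 2 * k) {j : ℕ} (hj : j < k) :
    TL.genNat q n (2 * j) • stdVec q h = loopValue q • stdVec q h := by
  have hi : 2 * j < n - 1 := by omega
  obtain ⟨a, b, ha, hb, e⟩ := std_hasCups (t := t) h j hj
  have e' : (std 0 k h (Nat.zero_le t)).σ (lpt ⟨2 * j, hi⟩) = rpt ⟨2 * j, hi⟩ := by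
    have e1 : (lpt ⟨2 * j, hi⟩ : Fin t ⊕ Fin n) = Sum.inr a := congrArg Sum.inr (Fin.ext ha.symm)
    have e2 : (rpt ⟨2 * j, hi⟩ : Fin t ⊕ Fin n) = Sum.inr b := congrArg Sum.inr (Fin.ext hb.symm)
    rw [e1, e2, e]
  rw [stdVec, genNat_smul_ofDiagram hi, hook_eq_self e', hookCoef, if_pos e']

theorem cups_smul_stdVec (h : n = t + 2 * k) {j : ℕ} (hj : j ≤ k) :
    TL.cups q n j • stdVec q h = loopValue q ^ j • stdVec q h := by
  induction j with
  | zero => rw [TL.cups, one_smul, pow_zero, one_smul]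
  | succ j ih =>
    rw [TL.cups, mul_smul, ih (by omega), smul_comm, genNat_smul_stdVec h (by omega), smul_smul,
      pow_succ]

theorem form_genNat (i : ℕ) (v w : CellModule q t n) :
    form q (TL.genNat q n i • v) w = form q v (TL.genNat q n i • w) := by
  by_cases h : i < n - 1
  · rw [TL.genNat_of_lt h, form_gen]
  · rw [TL.genNat_of_not h]; simp

theorem form_cups_stdVec (h : n = t + 2 * k) {j : ℕ} (hj : j ≤ k) (v : CellModule q t n) :
    form q (TL.cups q n j • v) (stdVec q h) = loopValue q ^ j * form q v (stdVec q h) := by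
  induction j with
  | zero => rw [TL.cups, one_smul, pow_zero, one_mul]
  | succ j ih =>
    rw [TL.cups, mul_smul, form_genNat, genNat_smul_stdVec h (by omega), map_smul, ih (by omega),
      smul_eq_mul, pow_succ]
    ring

/-- Cyclicity of the cell module: `hook_induction` reaches every monic diagram, and each generator
introduces only a factor `1` or `δ`, which can be divided out. -/
theorem eq_top_of_stdVec_mem (hd : loopValue q ≠ 0) (h : n = t + 2 * k)
    {N : Submodule (TL q n) (CellModule q t n)} (hN : stdVec q h ∈ N) : N = ⊤ := by
  have hsmul : ∀ (c : ℂ) (v : CellModule q t n), v ∈ N → c • v ∈ N := by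
    intro c v hv
    rw [← algebraMap_smul (TL q n) c v]
    exact N.smul_mem _ hv
  refine eq_top_iff.2 fun v _ => ?_
  induction v using induction_ofDiagram with
  | h0 => exact zero_mem _
  | hadd v w hv hw => exact add_mem (hv trivial) (hw trivial)
  | hsmul c v hv => exact hsmul c v (hv trivial)
  | h D hD =>
    refine hook_induction h (C := fun D => ofDiagram q D ∈ N) hN (fun i D _ hC => ?_) hD
    have := hsmul (hookCoef q i D)⁻¹ _ (N.smul_mem (TL.gen q i) hC)
    rwa [gen_smul_ofDiagram, smul_smul, inv_mul_cancel₀ (hookCoef_ne_zero hd i D), one_smul] at this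

theorem ofDiagram_notMem_radical (hd : loopValue q ≠ 0) {D : TLDiagram t n} (hD : D.IsMonic) :
    ofDiagram q D ∉ radical q t n := by
  intro hr
  have := hr (ofDiagram q D)
  rw [form_ofDiagram] at this
  simp only [ite_self] at this
  rw [glueValue, if_pos (glueMonic_self hD)] at this
  exact pow_ne_zero _ hd this

/-- The cellular argument: a submodule not contained in the radical pairs nontrivially with the
cyclic vector `stdVec`. Since `c_k` is self-adjoint and multiplies `stdVec` by `δ^k`, it sends a
suitable element of the submodule to a nonzero multiple of `stdVec`. -/
theorem isCoatom_radical (hd : loopValue q ≠ 0) (h : n = t + 2 * k) :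
    IsCoatom (radical q t n) := by
  have h0 : stdVec q h ∉ radical q t n := ofDiagram_notMem_radical hd (std_isMonic h _)
  refine ⟨fun e => h0 (e ▸ Submodule.mem_top), fun N hN => eq_top_of_stdVec_mem hd h ?_⟩
  obtain ⟨v, hv, hv'⟩ := SetLike.exists_of_lt hN
  obtain ⟨w, hw, hw'⟩ : ∃ w ∈ N, form q w (stdVec q h) ≠ 0 := by
    by_contra hcon
    push Not at hcon
    -- The orthogonal complement of `N`, a submodule by invariance of the form. If it contained the
    -- cyclic vector it would be everything, and `N` would lie in the radical.
    let S : Submodule (TL q n) (CellModule q t n) :=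
      { carrier := {w | ∀ v ∈ N, form q v w = 0}
        zero_mem' := fun v _ => map_zero _
        add_mem' := fun ha hb v hv => by rw [map_add, ha v hv, hb v hv, add_zero]
        smul_mem' := fun a => by
          induction a using TL.induction with
          | scalar c => intro w hw v hv; rw [algebraMap_smul, map_smul, hw v hv, smul_zero]
          | gen i => intro w hw v hv; rw [← form_gen]; exact hw _ (N.smul_mem _ hv)
          | mul a b ha hb => intro w hw; rw [mul_smul]; exact ha (hb hw)
          | add a b ha hb =>
            intro w hw v hv; rw [add_smul, map_add, ha hw v hv, hb hw v hv, add_zero] }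
    have hS : S = ⊤ := eq_top_of_stdVec_mem hd h hcon
    refine hv' fun w => ?_
    have : w ∈ S := hS ▸ Submodule.mem_top
    exact this v hv
  obtain ⟨c, hc⟩ := exists_cups_smul h w
  have hc0 : c ≠ 0 := by
    rintro rfl
    have := form_cups_stdVec h le_rfl w
    rw [hc, zero_smul, map_zero, LinearMap.zero_apply] at this
    exact mul_ne_zero (pow_ne_zero _ hd) hw' this.symm
  have := N.smul_mem (algebraMap ℂ (TL q n) c⁻¹ * TL.cups q n k) hw
  rwa [mul_smul, hc, algebraMap_smul, smul_smul, inv_mul_cancel₀ hc0, one_smul] at this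

theorem isSimpleModule_simpleHead (hd : loopValue q ≠ 0) (h : n = t + 2 * k) :
    IsSimpleModule (TL q n) (SimpleHead q t n) :=
  isSimpleModule_iff_isCoatom.2 (isCoatom_radical hd h)

theorem cups_smul_simpleHead {j : ℕ} (hj : n < t + 2 * j) (v : SimpleHead q t n) :
    TL.cups q n j • v = 0 := by
  obtain ⟨v, rfl⟩ := Submodule.Quotient.mk_surjective _ v
  rw [← Submodule.Quotient.mk_smul, cups_smul_eq_zero hj, Submodule.Quotient.mk_zero]

theorem exists_cups_smul_simpleHead (hd : loopValue q ≠ 0) (h : n = t + 2 * k) :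
    ∃ v : SimpleHead q t n, TL.cups q n k • v ≠ 0 := by
  refine ⟨Submodule.Quotient.mk (stdVec q h), ?_⟩
  rw [← Submodule.Quotient.mk_smul, cups_smul_stdVec h le_rfl, Ne, Submodule.Quotient.mk_eq_zero]
  intro hr
  have := (radical q t n).smul_mem (algebraMap ℂ (TL q n) (loopValue q ^ k)⁻¹) hr
  rw [algebraMap_smul, smul_smul, inv_mul_cancel₀ (pow_ne_zero _ hd), one_smul] at this
  exact ofDiagram_notMem_radical hd (std_isMonic h _) this

/-- With all cups on the right, the first `t` top points are through lines, and `f_i` connects two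
of their bottom ends, so the result is not monic. -/
theorem gen_smul_std (h : n = t + 2 * k) (i : Fin (n - 1)) (hi : i.val + 1 < t) :
    TL.gen q i • ofDiagram q (std t k h le_rfl) = 0 := by
  rw [gen_smul_ofDiagram, ofDiagram_of_not, smul_zero]
  set D := std t k h le_rfl
  have e : ∀ (j : Fin t) (x : Fin n), x.val = j.val → D.σ (Sum.inl j) = Sum.inr x := by
    intro j x hx
    rw [std_inl]
    congr 1
    exact Fin.ext (by simp only [if_pos j.2]; exact hx.symm)
  have e1 := e ⟨i, by omega⟩ ⟨i, by omega⟩ rfl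
  have e2 := e ⟨i + 1, by omega⟩ ⟨i + 1, by omega⟩ rfl
  have e3 : D.σ (rpt i) = Sum.inl ⟨i + 1, by omega⟩ := by rw [rpt, ← e2, D.invol]
  have e4 : D.σ (lpt i) = Sum.inl ⟨i, by omega⟩ := by rw [lpt, ← e1, D.invol]
  intro hM
  obtain ⟨y, hy⟩ := hM ⟨i, by omega⟩
  have : (hook i D).σ (Sum.inl ⟨i, by omega⟩) = Sum.inl ⟨i + 1, by omega⟩ := by
    simp only [hook, reconnect]
    rw [if_neg (by simp [lpt]), if_neg (by simp [rpt]), if_pos e4.symm, e3]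
  rw [this] at hy
  cases hy

end CellModule

/-! ### The Jones–Wenzl idempotent acts nontrivially when `t` is large -/

theorem TL.incl_gen (q : ℂ) {m n : ℕ} (h : m ≤ n) (i : Fin (m - 1)) :
    TL.incl q h (TL.gen q i) = TL.gen q (Fin.castLE (Nat.sub_le_sub_right h 1) i) :=
  TL.lift_gen _ _ _ _ i

/-- For `m ≤ t` the generators of `TL_m` kill the diagram with through lines on the left, so `E`
acts on it by its augmentation, which is one. -/
theorem IsJonesWenzl.exists_smul_simpleHead {q : ℂ} {t n k m : ℕ} (hd : loopValue q ≠ 0)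
    (h : n = t + 2 * k) (hm : m ≤ t) {E : TL q m} (hE : IsJonesWenzl E) (hmn : m ≤ n) :
    ∃ v : SimpleHead q t n, TL.incl q hmn E • v ≠ 0 := by
  refine ⟨Submodule.Quotient.mk (CellModule.ofDiagram q (TLDiagram.std t k h le_rfl)), ?_⟩
  have key : TL.incl q hmn E • CellModule.ofDiagram q (TLDiagram.std t k h le_rfl) =
      CellModule.ofDiagram q (TLDiagram.std t k h le_rfl) := by
    let _ : Module (TL q m) (CellModule q t n) :=
      Module.compHom (CellModule q t n) (TL.incl q hmn).toRingHom
    have := TL.smul_eq_augmentation (q := q) (n := m)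
      (x := CellModule.ofDiagram q (TLDiagram.std t k h le_rfl)) (fun i => by
        change TL.incl q hmn (TL.gen q i) •
          CellModule.ofDiagram q (TLDiagram.std t k h le_rfl) = 0
        rw [TL.incl_gen, CellModule.gen_smul_std]
        rw [Fin.val_castLE]
        omega) E
    rw [TL.augmentation_of_isJonesWenzl hE, map_one, one_smul] at this
    exact this
  rw [← Submodule.Quotient.mk_smul, key, Ne, Submodule.Quotient.mk_eq_zero]
  exact CellModule.ofDiagram_notMem_radical hd (TLDiagram.std_isMonic h _)

/-! ### The path model -/

/-- Walks of length `n` from `0` to `t` on the graph with vertices `0, …, ℓ - 2`, in which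
neighbouring integers are joined; a walk is continued by the constant value `t`. -/
structure IsWalk (ℓ n : ℕ) (t : ℤ) (a : ℕ → ℤ) : Prop where
  zero : a 0 = 0
  step : ∀ i < n, a (i + 1) = a i + 1 ∨ a (i + 1) = a i - 1
  nonneg : ∀ i, 0 ≤ a i
  le : ∀ i, a i + 2 ≤ ℓ
  tail : ∀ i, n ≤ i → a i = t

/-- Reflect the value of a walk at `i + 1` at its value at `i`. -/
def flipWalk (i : ℕ) (a : ℕ → ℤ) : ℕ → ℤ := Function.update a (i + 1) (2 * a i - a (i + 1))

theorem flipWalk_self (i : ℕ) (a : ℕ → ℤ) : flipWalk i a (i + 1) = 2 * a i - a (i + 1) :=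
  Function.update_self _ _ _

theorem flipWalk_of_ne {i j : ℕ} (h : j ≠ i + 1) (a : ℕ → ℤ) : flipWalk i a j = a j :=
  Function.update_of_ne h _ _

theorem flipWalk_flipWalk (i : ℕ) (a : ℕ → ℤ) : flipWalk i (flipWalk i a) = a := by
  funext j
  by_cases h : j = i + 1
  · subst h
    rw [flipWalk_self, flipWalk_self, flipWalk_of_ne (by omega)]
    ring
  · rw [flipWalk_of_ne h, flipWalk_of_ne h]

theorem flipWalk_comm {i j : ℕ} (h : i + 2 ≤ j) (a : ℕ → ℤ) :
    flipWalk i (flipWalk j a) = flipWalk j (flipWalk i a) := by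
  funext m
  by_cases h1 : m = i + 1
  · subst h1
    rw [flipWalk_self, flipWalk_of_ne (by omega), flipWalk_of_ne (by omega),
      flipWalk_of_ne (by omega), flipWalk_self]
  · rw [flipWalk_of_ne h1]
    by_cases h2 : m = j + 1
    · subst h2
      rw [flipWalk_self, flipWalk_self, flipWalk_of_ne (by omega), flipWalk_of_ne (by omega)]
    · rw [flipWalk_of_ne h2, flipWalk_of_ne h2, flipWalk_of_ne h1]

/-- The weight of a walk at `i + 1`. -/
def walkWeight (q : ℂ) (i : ℕ) (a : ℕ → ℤ) : ℂ :=
  -(quantum q (a (i + 1) + 1) / quantum q (a i + 1))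

/-- The operator by which the generator with index `i` acts on functions on walks. -/
def walkOp (q : ℂ) (i : ℕ) : Module.End ℂ ((ℕ → ℤ) → ℂ) where
  toFun φ a := if a i = a (i + 2) then walkWeight q i a * (φ a + φ (flipWalk i a)) else 0
  map_add' φ ψ := by
    funext a
    simp only [Pi.add_apply]
    split_ifs <;> ring
  map_smul' c φ := by
    funext a
    simp only [Pi.smul_apply, smul_eq_mul, RingHom.id_apply]
    split_ifs <;> ring

theorem walkOp_of_eq {q : ℂ} {i : ℕ} {a : ℕ → ℤ} (h : a i = a (i + 2)) (φ : (ℕ → ℤ) → ℂ) :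
    walkOp q i φ a = walkWeight q i a * (φ a + φ (flipWalk i a)) := if_pos h

theorem walkOp_of_ne {q : ℂ} {i : ℕ} {a : ℕ → ℤ} (h : a i ≠ a (i + 2)) (φ : (ℕ → ℤ) → ℂ) :
    walkOp q i φ a = 0 := if_neg h

/-- The functions that vanish outside the walks. -/
def walkSpace (ℓ n : ℕ) (t : ℤ) : Submodule ℂ ((ℕ → ℤ) → ℂ) where
  carrier := {φ | ∀ a, ¬ IsWalk ℓ n t a → φ a = 0}
  zero_mem' _ _ := rfl
  add_mem' hφ hψ a ha := by rw [Pi.add_apply, hφ a ha, hψ a ha, add_zero]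
  smul_mem' c φ hφ a ha := by rw [Pi.smul_apply, hφ a ha, smul_zero]

/-! ### The path operators satisfy the Temperley–Lieb relations -/

section Relations

variable {q : ℂ} {ℓ n : ℕ} {t : ℤ}

theorem IsWalk.flip_of_range {a : ℕ → ℤ} (ha : IsWalk ℓ n t a) {i : ℕ} (hi : i < n - 1)
    (h : a i = a (i + 2)) (h0 : 0 ≤ 2 * a i - a (i + 1)) (h1 : 2 * a i - a (i + 1) + 2 ≤ ℓ) :
    IsWalk ℓ n t (flipWalk i a) where
  zero := by rw [flipWalk_of_ne (by omega), ha.zero]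
  step j hj := by
    have := ha.step i (by omega)
    by_cases e1 : j = i
    · subst e1
      rw [flipWalk_self, flipWalk_of_ne (by omega)]
      omega
    by_cases e2 : j = i + 1
    · subst e2
      rw [flipWalk_self, flipWalk_of_ne (by omega)]
      have e : a (i + 1 + 1) = a i := h.symm
      omega
    rw [flipWalk_of_ne (by omega), flipWalk_of_ne (by omega)]
    exact ha.step j hj
  nonneg j := by
    by_cases e : j = i + 1
    · subst e; rwa [flipWalk_self]
    · rw [flipWalk_of_ne e]; exact ha.nonneg j
  le j := by
    by_cases e : j = i + 1
    · subst e; rwa [flipWalk_self]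
    · rw [flipWalk_of_ne e]; exact ha.le j
  tail j hj := by rw [flipWalk_of_ne (by omega), ha.tail j hj]

theorem IsWalk.quantum_ne_zero (hℓ : 3 ≤ ℓ) (hq : orderOf (q ^ 2) = ℓ) {a : ℕ → ℤ}
    (ha : IsWalk ℓ n t a) (i : ℕ) : quantum q (a i + 1) ≠ 0 :=
  _root_.quantum_ne_zero hℓ hq (by have := ha.nonneg i; omega) (by have := ha.le i; omega)

theorem IsWalk.walkWeight_ne_zero (hℓ : 3 ≤ ℓ) (hq : orderOf (q ^ 2) = ℓ) {a : ℕ → ℤ}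
    (ha : IsWalk ℓ n t a) (i : ℕ) : walkWeight q i a ≠ 0 :=
  neg_ne_zero.2 (div_ne_zero (ha.quantum_ne_zero hℓ hq _) (ha.quantum_ne_zero hℓ hq _))

/-- The root of unity enters here. If a flip of `a` is a walk and `a` is not, then `a` has height
`-1` or `ℓ - 1` at `i + 1`, where the weight has numerator `[0]` or `[ℓ]`. -/
theorem walkOp_mem (hℓ : 3 ≤ ℓ) (hq : orderOf (q ^ 2) = ℓ) {i : ℕ} (hi : i < n - 1)
    {φ : (ℕ → ℤ) → ℂ} (hφ : φ ∈ walkSpace ℓ n t) : walkOp q i φ ∈ walkSpace ℓ n t := by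
  intro a ha
  by_cases h : a i = a (i + 2)
  · rw [walkOp_of_eq h, hφ a ha, zero_add]
    by_cases hf : IsWalk ℓ n t (flipWalk i a)
    · have h0 : walkWeight q i a = 0 := by
        have e := flipWalk_flipWalk i a
        have e1 : flipWalk i a i = a i := flipWalk_of_ne (by omega) a
        have e2 : flipWalk i a (i + 2) = a (i + 2) := flipWalk_of_ne (by omega) a
        have e3 := flipWalk_self i a
        have key : ¬ (0 ≤ a (i + 1) ∧ a (i + 1) + 2 ≤ ℓ) := by
          rintro ⟨h1, h2⟩
          refine ha (e ▸ hf.flip_of_range hi (by rw [e1, e2, h]) ?_ ?_) <;> omega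
        have s := hf.step i (by omega)
        have b1 := hf.nonneg i
        have b2 := hf.le i
        rw [e1] at s b1 b2
        rw [e3] at s
        have : a (i + 1) + 1 = 0 ∨ a (i + 1) + 1 = ℓ := by omega
        rw [walkWeight]
        rcases this with h' | h'
        · rw [h', quantum_zero, zero_div, neg_zero]
        · rw [h', quantum_order hℓ hq, zero_div, neg_zero]
      rw [h0, zero_mul]
    · rw [hφ _ hf, mul_zero]
  · exact walkOp_of_ne h φ

/-- The output on a pair `a`, `flipWalk i a` is proportional to the two weights, whose sum is `δ` by
the three-term relation of quantum numbers. -/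
theorem walkOp_sq (hℓ : 3 ≤ ℓ) (hq : orderOf (q ^ 2) = ℓ) {a : ℕ → ℤ} (ha : IsWalk ℓ n t a)
    {i : ℕ} (hi : i < n - 1) (φ : (ℕ → ℤ) → ℂ) :
    walkOp q i (walkOp q i φ) a = loopValue q * walkOp q i φ a := by
  by_cases h : a i = a (i + 2)
  · have h' : flipWalk i a i = flipWalk i a (i + 2) := by
      rw [flipWalk_of_ne (by omega), flipWalk_of_ne (by omega), h]
    rw [walkOp_of_eq h, walkOp_of_eq h, walkOp_of_eq h', flipWalk_flipWalk]
    have key : walkWeight q i a + walkWeight q i (flipWalk i a) = loopValue q := by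
      have h1 := ha.quantum_ne_zero hℓ hq i
      have h2 := quantum_add_quantum (ne_zero_of_orderOf hℓ hq) (a i + 1)
      have h3 : quantum q (a (i + 1) + 1) + quantum q (2 * a i - a (i + 1) + 1) =
          -loopValue q * quantum q (a i + 1) := by
        rw [← h2]
        rcases ha.step i (by omega) with e | e
        · rw [e, show 2 * a i - (a i + 1) + 1 = a i + 1 - 1 by ring]
        · rw [e, show 2 * a i - (a i - 1) + 1 = a i + 1 + 1 by ring, add_comm,
            show a i - 1 + 1 = a i + 1 - 1 by ring]
      rw [walkWeight, walkWeight, flipWalk_self, flipWalk_of_ne (by omega)]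
      field_simp
      linear_combination -h3
    rw [← key]
    ring
  · rw [walkOp_of_ne h, walkOp_of_ne h, mul_zero]

theorem walkWeight_mul {a : ℕ → ℤ} {i : ℕ} (h : a i = a (i + 2))
    (h0 : quantum q (a i + 1) ≠ 0) (h1 : quantum q (a (i + 1) + 1) ≠ 0) :
    walkWeight q i a * walkWeight q (i + 1) a = 1 := by
  rw [walkWeight, walkWeight, show i + 1 + 1 = i + 2 from rfl, ← h]
  field_simp

/-- Of `a` and its flip at `i + 1`, exactly one has equal heights at `i + 1` and `i + 3`; only that
one contributes to the middle operator. The consecutive weights there multiply to one. -/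
theorem walkOp_braid (hℓ : 3 ≤ ℓ) (hq : orderOf (q ^ 2) = ℓ) {a : ℕ → ℤ} (ha : IsWalk ℓ n t a)
    {i : ℕ} (hi : i + 1 < n - 1) (φ : (ℕ → ℤ) → ℂ) :
    walkOp q i (walkOp q (i + 1) (walkOp q i φ)) a = walkOp q i φ a := by
  by_cases h : a i = a (i + 2)
  · have s1 := ha.step i (by omega)
    have s3 := ha.step (i + 2) (by omega)
    have f0 : flipWalk i a i = a i := flipWalk_of_ne (by omega) a
    have f1 := flipWalk_self i a
    have f2 : flipWalk i a (i + 2) = a (i + 2) := flipWalk_of_ne (by omega) a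
    have f3 : flipWalk i a (i + 3) = a (i + 3) := flipWalk_of_ne (by omega) a
    have inner : ∀ x : ℕ → ℤ, x i = x (i + 2) → (x (i + 1) = x i + 1 ∨ x (i + 1) = x i - 1) →
        x (i + 1) = x (i + 3) → quantum q (x i + 1) ≠ 0 → quantum q (x (i + 1) + 1) ≠ 0 →
        walkOp q (i + 1) (walkOp q i φ) x = φ x + φ (flipWalk i x) := by
      intro x e1 e2 e3 e4 e5
      have e6 : flipWalk (i + 1) x i ≠ flipWalk (i + 1) x (i + 2) := by
        rw [flipWalk_of_ne (by omega), show i + 2 = i + 1 + 1 from rfl, flipWalk_self]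
        have e1' : x i = x (i + 1 + 1) := e1
        omega
      rw [walkOp_of_eq e3, walkOp_of_ne e6, add_zero, walkOp_of_eq e1, ← mul_assoc,
        mul_comm (walkWeight q (i + 1) x), walkWeight_mul e1 e4 e5, one_mul]
    rw [walkOp_of_eq h, walkOp_of_eq h]
    congr 1
    by_cases h' : a (i + 1) = a (i + 3)
    · rw [inner a h s1 h' (ha.quantum_ne_zero hℓ hq _) (ha.quantum_ne_zero hℓ hq _),
        walkOp_of_ne (a := flipWalk i a), add_zero]
      show flipWalk i a (i + 1) ≠ flipWalk i a (i + 3)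
      omega
    · have hd : flipWalk i a (i + 1) = flipWalk i a (i + 3) := by
        have s3' : a (i + 3) = a (i + 2) + 1 ∨ a (i + 3) = a (i + 2) - 1 := s3
        omega
      -- The flip need not be known to be a walk: its new height equals `a (i + 3)`, so the quantum
      -- number is nonzero anyway.
      rw [walkOp_of_ne (a := a) h', inner (flipWalk i a) (by omega) (by omega) hd
        (by rw [f0]; exact ha.quantum_ne_zero hℓ hq _)
        (by rw [hd, f3]; exact ha.quantum_ne_zero hℓ hq _), flipWalk_flipWalk]
      ring
  · rw [walkOp_of_ne h, walkOp_of_ne h]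

/-- The mirror image: exactly one of `a` and its flip at `i + 2` has equal heights at `i` and `i +
2`. -/
theorem walkOp_braid' (hℓ : 3 ≤ ℓ) (hq : orderOf (q ^ 2) = ℓ) {a : ℕ → ℤ} (ha : IsWalk ℓ n t a)
    {i : ℕ} (hi : i + 1 < n - 1) (φ : (ℕ → ℤ) → ℂ) :
    walkOp q (i + 1) (walkOp q i (walkOp q (i + 1) φ)) a = walkOp q (i + 1) φ a := by
  by_cases h : a (i + 1) = a (i + 3)
  · have s1 := ha.step i (by omega)
    have s2 : a (i + 2) = a (i + 1) + 1 ∨ a (i + 2) = a (i + 1) - 1 := ha.step (i + 1) (by omega)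
    have f0 : flipWalk (i + 1) a i = a i := flipWalk_of_ne (by omega) a
    have f1 : flipWalk (i + 1) a (i + 1) = a (i + 1) := flipWalk_of_ne (by omega) a
    have f2 : flipWalk (i + 1) a (i + 2) = 2 * a (i + 1) - a (i + 2) := flipWalk_self (i + 1) a
    have f3 : flipWalk (i + 1) a (i + 3) = a (i + 3) := flipWalk_of_ne (by omega) a
    have inner : ∀ x : ℕ → ℤ, x (i + 1) = x (i + 3) →
        (x (i + 1) = x i + 1 ∨ x (i + 1) = x i - 1) →
        x i = x (i + 2) → quantum q (x i + 1) ≠ 0 → quantum q (x (i + 1) + 1) ≠ 0 →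
        walkOp q i (walkOp q (i + 1) φ) x = φ x + φ (flipWalk (i + 1) x) := by
      intro x e1 e2 e3 e4 e5
      have e6 : flipWalk i x (i + 1) ≠ flipWalk i x (i + 1 + 2) := by
        rw [flipWalk_of_ne (j := i + 1 + 2) (by omega), flipWalk_self]
        have e1' : x (i + 1) = x (i + 1 + 2) := e1
        omega
      rw [walkOp_of_eq e3, walkOp_of_ne e6, add_zero, walkOp_of_eq (i := i + 1) e1, ← mul_assoc,
        walkWeight_mul e3 e4 e5, one_mul]
    rw [walkOp_of_eq (i := i + 1) h, walkOp_of_eq (i := i + 1) h]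
    congr 1
    by_cases h' : a i = a (i + 2)
    · rw [inner a h s1 h' (ha.quantum_ne_zero hℓ hq _) (ha.quantum_ne_zero hℓ hq _),
        walkOp_of_ne (a := flipWalk (i + 1) a), add_zero]
      omega
    · rw [walkOp_of_ne (a := a) h', inner (flipWalk (i + 1) a) (by omega) (by omega) (by omega)
        (by rw [f0]; exact ha.quantum_ne_zero hℓ hq _)
        (by rw [f1]; exact ha.quantum_ne_zero hℓ hq _), flipWalk_flipWalk]
      ring
  · rw [walkOp_of_ne (i := i + 1) h, walkOp_of_ne (i := i + 1) h]

/-- Each operator changes only its middle height and reads its two neighbours; at distance two or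
more neither changes a height read by the other. -/
theorem walkOp_comm {i j : ℕ} (h : i + 2 ≤ j) (φ : (ℕ → ℤ) → ℂ) :
    walkOp q i (walkOp q j φ) = walkOp q j (walkOp q i φ) := by
  funext a
  have e1 : ∀ m, j ≤ m → flipWalk i a m = a m := fun m hm => flipWalk_of_ne (by omega) a
  have e2 : ∀ m, m ≤ i + 2 → flipWalk j a m = a m := fun m hm => flipWalk_of_ne (by omega) a
  have w1 : walkWeight q j (flipWalk i a) = walkWeight q j a := by
    rw [walkWeight, walkWeight, e1 _ le_rfl, e1 _ (by omega)]
  have w2 : walkWeight q i (flipWalk j a) = walkWeight q i a := by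
    rw [walkWeight, walkWeight, e2 _ (by omega), e2 _ (by omega)]
  simp only [walkOp, LinearMap.coe_mk, AddHom.coe_mk, w1, w2, e1 j le_rfl, e1 (j + 2) (by omega),
    e2 i (by omega), e2 (i + 2) le_rfl, flipWalk_comm h]
  split_ifs <;> ring

end Relations

/-- The module over `TL_n(q)` of functions on the walks of length `n` from `0` to `t`. -/
def WalkModule {q : ℂ} {ℓ : ℕ} (_hℓ : 3 ≤ ℓ) (_hq : orderOf (q ^ 2) = ℓ) (n : ℕ) (t : ℤ) : Type :=
  walkSpace ℓ n t

namespace WalkModule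

variable {q : ℂ} {ℓ : ℕ} (hℓ : 3 ≤ ℓ) (hq : orderOf (q ^ 2) = ℓ) {n : ℕ} {t : ℤ}

instance : AddCommGroup (WalkModule hℓ hq n t) := inferInstanceAs (AddCommGroup (walkSpace ℓ n t))

instance : Module ℂ (WalkModule hℓ hq n t) := inferInstanceAs (Module ℂ (walkSpace ℓ n t))

/-- The action of a generator. -/
def genAction (i : Fin (n - 1)) : Module.End ℂ (WalkModule hℓ hq n t) :=
  LinearMap.restrict (p := walkSpace ℓ n t) (q := walkSpace ℓ n t) (walkOp q i) fun _ hφ =>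
    walkOp_mem hℓ hq i.2 hφ

variable {hℓ hq}

theorem ext' {φ ψ : WalkModule hℓ hq n t} (h : ∀ a, IsWalk ℓ n t a → φ.1 a = ψ.1 a) : φ = ψ := by
  refine Subtype.ext (funext fun a => ?_)
  by_cases ha : IsWalk ℓ n t a
  · exact h a ha
  · rw [φ.2 a ha, ψ.2 a ha]

variable (hℓ hq)

/-- The representation of `TL_n(q)` on functions on walks. -/
def rep : TL q n →ₐ[ℂ] Module.End ℂ (WalkModule hℓ hq n t) :=
  TL.lift (genAction hℓ hq)
    (fun i => LinearMap.ext fun φ => ext' fun _ ha => walkOp_sq hℓ hq ha i.2 φ.1)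
    (fun i j h => LinearMap.ext fun φ => ext' fun a ha => by
      change walkOp q i (walkOp q j (walkOp q i φ.1)) a = walkOp q i φ.1 a
      rcases h with h | h
      · rw [← h]; exact walkOp_braid hℓ hq ha (h ▸ j.2) φ.1
      · rw [← h]; exact walkOp_braid' hℓ hq ha (h ▸ i.2) φ.1)
    (fun i j h => LinearMap.ext fun φ => Subtype.ext (by
      change walkOp q i (walkOp q j φ.1) = walkOp q j (walkOp q i φ.1)
      rcases h with h | h
      · exact walkOp_comm h φ.1
      · exact (walkOp_comm h φ.1).symm))

instance : Module (TL q n) (WalkModule hℓ hq n t) :=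
  Module.compHom (WalkModule hℓ hq n t) (rep hℓ hq (n := n) (t := t)).toRingHom

variable {hℓ hq}

theorem smul_def (a : TL q n) (φ : WalkModule hℓ hq n t) : a • φ = rep hℓ hq a φ := rfl

instance : IsScalarTower ℂ (TL q n) (WalkModule hℓ hq n t) :=
  ⟨fun c a v => by rw [smul_def, smul_def, map_smul, LinearMap.smul_apply]⟩

theorem gen_smul_val (i : Fin (n - 1)) (φ : WalkModule hℓ hq n t) :
    (TL.gen q i • φ).1 = walkOp q i φ.1 := by
  rw [smul_def, rep, TL.lift_gen]
  rfl

theorem genNat_smul_val {i : ℕ} (hi : i < n - 1) (φ : WalkModule hℓ hq n t) :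
    (TL.genNat q n i • φ).1 = walkOp q i φ.1 := by
  rw [TL.genNat_of_lt hi, gen_smul_val]

end WalkModule

/-! ### Simplicity of the path model -/

/-- The walk that alternates between `0` and `1` for `2k` steps and then ascends to `t`. -/
def stdWalk (k t : ℕ) (i : ℕ) : ℤ :=
  if i < 2 * k then ((i % 2 : ℕ) : ℤ) else if i < 2 * k + t then (i : ℤ) - 2 * k else t

namespace IsWalk

variable {ℓ n : ℕ} {t : ℤ} {a : ℕ → ℤ}

theorem le_add (ha : IsWalk ℓ n t a) (i j : ℕ) (h : i + j ≤ n) : a (i + j) ≤ a i + j := by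
  induction j with
  | zero => simp
  | succ j ih =>
    have := ha.step (i + j) (by omega)
    have := ih (by omega)
    rw [← add_assoc]
    push_cast
    omega

theorem std (hℓ : 3 ≤ ℓ) {k t : ℕ} (ht : t + 2 ≤ ℓ) : IsWalk ℓ (t + 2 * k) t (stdWalk k t) where
  zero := by simp only [stdWalk]; split_ifs <;> omega
  step i hi := by simp only [stdWalk]; split_ifs <;> omega
  nonneg i := by simp only [stdWalk]; split_ifs <;> omega
  le i := by simp only [stdWalk]; split_ifs <;> omega
  tail i hi := by simp only [stdWalk]; split_ifs <;> omega

/-- From height `0` with `t` steps left, reaching `t` allows only ascents. -/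
theorem eq_std {k t : ℕ} (ha : IsWalk ℓ (t + 2 * k) t a)
    (h : ∀ i ≤ 2 * k, a i = ((i % 2 : ℕ) : ℤ)) : a = stdWalk k t := by
  funext i
  rw [stdWalk]
  by_cases h1 : i < 2 * k
  · rw [if_pos h1, h i h1.le]
  · rw [if_neg h1]
    by_cases h2 : i < 2 * k + t
    · rw [if_pos h2]
      have e0 : a (2 * k) = 0 := by rw [h _ le_rfl]; omega
      have e1 := ha.le_add (2 * k) (i - 2 * k) (by omega)
      have e2 := ha.le_add i (t + 2 * k - i) (by omega)
      rw [show 2 * k + (i - 2 * k) = i by omega, e0] at e1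
      rw [show i + (t + 2 * k - i) = t + 2 * k by omega, ha.tail _ le_rfl] at e2
      omega
    · rw [if_neg h2, ha.tail _ (by omega)]

/-- A first departure from the alternation between `0` and `1` is a step to height `2`. Without a
peak based at height at least `1` the walk can never descend again, and it overshoots `t`. -/
theorem exists_peak {k t : ℕ} (ha : IsWalk ℓ (t + 2 * k) t a) (hne : a ≠ stdWalk k t) :
    ∃ i, i < t + 2 * k - 1 ∧ a i = a (i + 2) ∧ a (i + 1) = a i + 1 ∧ 1 ≤ a i := by
  by_contra hcon
  push Not at hcon
  refine hne (ha.eq_std fun i hi => ?_)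
  induction i with
  | zero => exact ha.zero
  | succ i ih =>
    have e := ih (by omega)
    have s := ha.step i (by omega)
    have p := ha.nonneg (i + 1)
    by_contra h
    have up : ∀ j, i + 1 + j ≤ t + 2 * k → a (i + j) = 1 + j ∧ a (i + 1 + j) = 2 + j := by
      intro j
      induction j with
      | zero => intro _; simp only [add_zero, Nat.cast_zero]; omega
      | succ j ihj =>
        intro hj
        obtain ⟨j1, j2⟩ := ihj (by omega)
        have s2 := ha.step (i + 1 + j) (by omega)
        have c := hcon (i + j) (by omega)
        rw [show i + j + 2 = i + 1 + j + 1 by omega, show i + j + 1 = i + 1 + j by omega] at c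
        rw [show i + (j + 1) = i + 1 + j by omega, show i + 1 + (j + 1) = i + 1 + j + 1 by omega]
        push_cast
        omega
    have := (up (t + 2 * k - (i + 1)) (by omega)).2
    rw [ha.tail _ (by omega)] at this
    omega

/-- A property that is stable under flips and holds for the standard walk holds for all walks. -/
theorem flip_induction {k t : ℕ} {C : (ℕ → ℤ) → Prop} (h0 : C (stdWalk k t))
    (h : ∀ i a, i < t + 2 * k - 1 → a i = a (i + 2) → IsWalk ℓ (t + 2 * k) t a →
      IsWalk ℓ (t + 2 * k) t (flipWalk i a) → C a → C (flipWalk i a))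
    (ha : IsWalk ℓ (t + 2 * k) t a) : C a := by
  obtain ⟨m, hm⟩ : ∃ m : ℕ, ∑ i ∈ Finset.range (t + 2 * k), a i = m :=
    Int.eq_ofNat_of_zero_le (Finset.sum_nonneg fun i _ => ha.nonneg i)
  induction m using Nat.strong_induction_on generalizing a with
  | _ m ih =>
    by_cases hne : a = stdWalk k t
    · exact hne ▸ h0
    obtain ⟨i, hi, e1, e2, e3⟩ := ha.exists_peak hne
    have hf : IsWalk ℓ (t + 2 * k) t (flipWalk i a) :=
      ha.flip_of_range hi e1 (by omega) (by have := ha.le (i + 1); omega)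
    -- Flipping a peak lowers one height by `2`; the sum of the heights is the induction measure.
    have hsum : ∑ j ∈ Finset.range (t + 2 * k), flipWalk i a j + 2 = m := by
      have hmem : i + 1 ∈ Finset.range (t + 2 * k) := Finset.mem_range.2 (by omega)
      rw [← hm, flipWalk, Finset.sum_update_of_mem hmem,
        Finset.sum_eq_add_sum_sdiff_singleton_of_mem hmem a]
      omega
    have hpos : 0 ≤ ∑ j ∈ Finset.range (t + 2 * k), flipWalk i a j :=
      Finset.sum_nonneg fun j _ => hf.nonneg j
    have hC := ih (m - 2) (by omega) hf (by omega)
    have := h i (flipWalk i a) hi (by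
      rw [flipWalk_of_ne (by omega), flipWalk_of_ne (by omega), e1]) hf
      (by rwa [flipWalk_flipWalk]) hC
    rwa [flipWalk_flipWalk] at this

theorem finite (ℓ n : ℕ) (t : ℤ) : {a | IsWalk ℓ n t a}.Finite := by
  refine Set.Finite.of_finite_image (f := fun a (i : Fin n) => a i)
    ((Set.Finite.pi' (t := fun _ : Fin n => Set.Icc (0 : ℤ) ℓ)
      (fun _ => Set.finite_Icc _ _)).subset ?_) ?_
  · rintro _ ⟨a, ha, rfl⟩ i
    exact ⟨ha.nonneg i, by have := ha.le i; show a i ≤ ℓ; omega⟩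
  · intro a ha b hb hab
    funext i
    by_cases hi : i < n
    · exact congrFun hab ⟨i, hi⟩
    · rw [ha.tail i (by omega), hb.tail i (by omega)]

end IsWalk

namespace WalkModule

variable {q : ℂ} {ℓ : ℕ} {hℓ : 3 ≤ ℓ} {hq : orderOf (q ^ 2) = ℓ} {n : ℕ} {t : ℤ}

-- From height `0` a return in two steps must pass through `1`, since the flipped walk would visit
-- `-1`. Thus the sum over the flip pair has one term, with weight `-[2]/[1] = δ`.
open Classical in
theorem cups_smul_val (j : ℕ) (hj : 2 * j ≤ n) (φ : WalkModule hℓ hq n t) {a : ℕ → ℤ}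
    (ha : IsWalk ℓ n t a) : (TL.cups q n j • φ).1 a =
      if ∀ i ≤ 2 * j, a i = ((i % 2 : ℕ) : ℤ) then loopValue q ^ j * φ.1 a else 0 := by
  induction j generalizing a with
  | zero =>
    rw [TL.cups, one_smul, pow_zero, one_mul, if_pos]
    intro i hi
    obtain rfl : i = 0 := by omega
    exact ha.zero
  | succ j ih =>
    have hi : 2 * j < n - 1 := by omega
    rw [TL.cups, mul_smul, genNat_smul_val hi]
    by_cases hc : ∀ i ≤ 2 * (j + 1), a i = ((i % 2 : ℕ) : ℤ)
    · rw [if_pos hc]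
      have e0 : a (2 * j) = 0 := by rw [hc _ (by omega)]; omega
      have e1 : a (2 * j + 1) = 1 := by rw [hc _ (by omega)]; omega
      have e2 : a (2 * j + 2) = 0 := by rw [hc _ (by omega)]; omega
      have hnf : ¬ IsWalk ℓ n t (flipWalk (2 * j) a) := fun hf => by
        have := hf.nonneg (2 * j + 1)
        rw [flipWalk_self, e0, e1] at this
        omega
      rw [walkOp_of_eq (by rw [e0, e2]), (TL.cups q n j • φ).2 _ hnf, add_zero,
        ih (by omega) ha, if_pos fun i hi => hc i (by omega), walkWeight, e0, e1]
      have h1 : quantum q (0 + 1) ≠ 0 := by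
        rw [← e0]; exact ha.quantum_ne_zero hℓ hq _
      have h2 := quantum_add_quantum (ne_zero_of_orderOf hℓ hq) (0 + 1)
      rw [show (0 : ℤ) + 1 - 1 = 0 by norm_num, quantum_zero, add_zero] at h2
      rw [show (1 : ℤ) + 1 = 0 + 1 + 1 by norm_num, h2]
      field_simp
      ring
    · rw [if_neg hc]
      by_cases h : a (2 * j) = a (2 * j + 2)
      · rw [walkOp_of_eq h]
        -- A walk at `0` after `2j` steps and again two steps later must alternate there, so failure
        -- of the longer alternation is failure of the shorter one.
        have hc' : ¬ ∀ i ≤ 2 * j, a i = ((i % 2 : ℕ) : ℤ) := by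
          intro h'
          refine hc fun i hi => ?_
          have e0 : a (2 * j) = 0 := by rw [h' _ (by omega)]; omega
          rcases (by omega : i ≤ 2 * j ∨ i = 2 * j + 1 ∨ i = 2 * j + 2) with h1 | rfl | rfl
          · exact h' i h1
          · have := ha.step (2 * j) (by omega)
            have := ha.nonneg (2 * j + 1)
            omega
          · omega
        have e1 : (TL.cups q n j • φ).1 a = 0 := by rw [ih (by omega) ha, if_neg hc']
        have e2 : (TL.cups q n j • φ).1 (flipWalk (2 * j) a) = 0 := by
          by_cases hf : IsWalk ℓ n t (flipWalk (2 * j) a)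
          · rw [ih (by omega) hf, if_neg]
            intro h'
            refine hc' fun i hi => ?_
            rw [← h' i hi, flipWalk_of_ne (by omega)]
          · exact (TL.cups q n j • φ).2 _ hf
        rw [e1, e2, add_zero, mul_zero]
      · exact walkOp_of_ne h _

open Classical in
/-- The indicator function of a walk. -/
def single {a : ℕ → ℤ} (ha : IsWalk ℓ n t a) : WalkModule hℓ hq n t :=
  ⟨fun b => if b = a then 1 else 0, fun b hb => if_neg (by rintro rfl; exact hb ha)⟩

open Classical in
theorem single_val {a : ℕ → ℤ} (ha : IsWalk ℓ n t a) (b : ℕ → ℤ) :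
    (single ha : WalkModule hℓ hq n t).1 b = if b = a then 1 else 0 :=
  rfl

theorem smul_val (c : ℂ) (φ : WalkModule hℓ hq n t) (a : ℕ → ℤ) : (c • φ).1 a = c * φ.1 a := rfl

theorem add_val (φ ψ : WalkModule hℓ hq n t) (a : ℕ → ℤ) : (φ + ψ).1 a = φ.1 a + ψ.1 a := rfl

theorem smul_mem_of_mem {N : Submodule (TL q n) (WalkModule hℓ hq n t)} (c : ℂ)
    {φ : WalkModule hℓ hq n t} (h : φ ∈ N) : c • φ ∈ N := by
  rw [← algebraMap_smul (TL q n) c φ]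
  exact N.smul_mem _ h

theorem eq_top_of_single_mem {N : Submodule (TL q n) (WalkModule hℓ hq n t)}
    (h : ∀ a (ha : IsWalk ℓ n t a), single ha ∈ N) : N = ⊤ := by
  classical
  refine eq_top_iff.2 fun φ _ => ?_
  have hfin := IsWalk.finite ℓ n t
  have e : φ = ∑ x ∈ hfin.toFinset.attach,
      φ.1 x.1 • single (hfin.mem_toFinset.1 x.2) := by
    refine ext' fun a ha => ?_
    let ev : WalkModule hℓ hq n t →ₗ[ℂ] ℂ :=
      (LinearMap.proj a : ((ℕ → ℤ) → ℂ) →ₗ[ℂ] ℂ).comp (walkSpace ℓ n t).subtype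
    change ev φ = ev (∑ x ∈ hfin.toFinset.attach, φ.1 x.1 • single (hfin.mem_toFinset.1 x.2))
    rw [map_sum, Finset.sum_eq_single ⟨a, hfin.mem_toFinset.2 ha⟩]
    · rw [map_smul]
      change φ.1 a = φ.1 a * (single ha : WalkModule hℓ hq n t).1 a
      rw [single_val, if_pos rfl, mul_one]
    · rintro ⟨b, hb⟩ _ hne
      rw [map_smul]
      change φ.1 b * (single (hfin.mem_toFinset.1 hb) : WalkModule hℓ hq n t).1 a = 0
      rw [single_val, if_neg, mul_zero]
      rintro rfl
      exact hne rfl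
    · intro h'
      exact absurd (Finset.mem_attach _ _) h'
  rw [e]
  exact N.sum_mem fun x _ => smul_mem_of_mem _ (h _ _)

theorem gen_smul_single {a : ℕ → ℤ} (i : Fin (n - 1)) (h : a i = a (i + 2))
    (ha : IsWalk ℓ n t a) (hf : IsWalk ℓ n t (flipWalk i a)) :
    TL.gen q i • (single ha : WalkModule hℓ hq n t) =
      walkWeight q i a • single ha + walkWeight q i (flipWalk i a) • single hf := by
  refine ext' fun b _ => ?_
  have hne : flipWalk i a ≠ a := by
    intro e
    have := congrFun e (i + 1)
    rw [flipWalk_self] at this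
    have := ha.step i (by omega)
    omega
  have h' : flipWalk i a i = flipWalk i a (i + 2) := by
    rw [flipWalk_of_ne (by omega), flipWalk_of_ne (by omega), h]
  rw [gen_smul_val, add_val, smul_val, smul_val, single_val, single_val]
  by_cases e1 : b = a
  · rw [e1, walkOp_of_eq h, single_val, single_val]
    simp [hne, hne.symm]
  by_cases e2 : b = flipWalk i a
  · rw [e2, walkOp_of_eq h', single_val, single_val, flipWalk_flipWalk]
    simp [hne]
  · have e3 : flipWalk i b ≠ a := by
      rintro rfl
      exact e2 (flipWalk_flipWalk _ _).symm
    by_cases hb : b i = b (i + 2)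
    · rw [walkOp_of_eq hb, single_val, single_val]
      simp [e1, e2, e3]
    · rw [walkOp_of_ne hb]
      simp [e1, e2]

variable {k t : ℕ}

/-- A walk at height `0` after `2k + 2` steps has too few steps left to reach `t`. -/
theorem cups_succ_smul (φ : WalkModule hℓ hq (t + 2 * k) t) :
    TL.cups q (t + 2 * k) (k + 1) • φ = 0 := by
  by_cases hn : 2 * (k + 1) ≤ t + 2 * k
  · refine ext' fun a ha => ?_
    rw [cups_smul_val _ hn φ ha, if_neg]
    · rfl
    · intro h
      have e := h _ le_rfl
      have := ha.le_add (2 * (k + 1)) (t + 2 * k - 2 * (k + 1)) (by omega)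
      rw [ha.tail _ (by omega), e] at this
      omega
  · rw [TL.cups_eq_zero (by omega), zero_smul]

theorem cups_smul (ht : t + 2 ≤ ℓ) (φ : WalkModule hℓ hq (t + 2 * k) t) :
    TL.cups q (t + 2 * k) k • φ =
      (loopValue q ^ k * φ.1 (stdWalk k t)) • single (IsWalk.std hℓ ht) := by
  refine ext' fun a ha => ?_
  rw [cups_smul_val _ (by omega) φ ha, smul_val, single_val]
  by_cases h : a = stdWalk k t
  · rw [if_pos h, if_pos, h, mul_one]
    intro i hi
    rw [h, stdWalk]
    split_ifs <;> omega
  · rw [if_neg h, mul_zero, if_neg fun h' => h (ha.eq_std h')]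

/-- On the indicator of `a`, a generator yields the indicators of `a` and of its flip. Removing the
first and dividing by the nonzero weight of the second moves along all flips. -/
theorem eq_top_of_std_mem (ht : t + 2 ≤ ℓ)
    {N : Submodule (TL q (t + 2 * k)) (WalkModule hℓ hq (t + 2 * k) t)}
    (h : single (IsWalk.std hℓ ht) ∈ N) : N = ⊤ := by
  refine eq_top_of_single_mem fun a ha => ?_
  refine IsWalk.flip_induction (ℓ := ℓ) (k := k) (t := t)
    (C := fun a => ∀ ha : IsWalk ℓ (t + 2 * k) t a, single ha ∈ N) (fun _ => h) ?_ ha ha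
  intro i a hi e ha hf hC _
  have h1 := N.sub_mem (N.smul_mem (TL.gen q ⟨i, hi⟩) (hC ha))
    (smul_mem_of_mem (walkWeight q i a) (hC ha))
  rw [gen_smul_single ⟨i, hi⟩ e ha hf, add_sub_cancel_left] at h1
  have h2 := smul_mem_of_mem (walkWeight q i (flipWalk i a))⁻¹ h1
  rwa [smul_smul, inv_mul_cancel₀ (hf.walkWeight_ne_zero hℓ hq i), one_smul] at h2

/-- The dual of cyclicity: if all translates of `φ` vanish at `a`, then evaluating a further
generator at `a` makes them vanish at the flip of `a`. -/
theorem eq_zero_of_forall_std {φ : WalkModule hℓ hq (t + 2 * k) t}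
    (h : ∀ b : TL q (t + 2 * k), (b • φ).1 (stdWalk k t) = 0) : φ = 0 := by
  refine ext' fun a ha => ?_
  have key := IsWalk.flip_induction (ℓ := ℓ) (k := k) (t := t)
    (C := fun a => ∀ b : TL q (t + 2 * k), (b • φ).1 a = 0) h ?_ ha 1
  · rwa [one_smul] at key
  intro i a hi e ha hf hC b
  have h1 := hC (TL.gen q ⟨i, hi⟩ * b)
  rw [mul_smul, gen_smul_val, walkOp_of_eq (i := i) e, hC b, zero_add] at h1
  exact (mul_eq_zero.1 h1).resolve_left (ha.walkWeight_ne_zero hℓ hq i)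

theorem isSimpleModule (ht : t + 2 ≤ ℓ) :
    IsSimpleModule (TL q (t + 2 * k)) (WalkModule hℓ hq (t + 2 * k) t) := by
  have hne : (single (IsWalk.std hℓ ht) : WalkModule hℓ hq (t + 2 * k) t) ≠ 0 := by
    intro h
    have := congrArg (fun φ : WalkModule hℓ hq (t + 2 * k) t => φ.1 (stdWalk k t)) h
    simp only [single_val, if_true] at this
    exact one_ne_zero this
  have : Nontrivial (WalkModule hℓ hq (t + 2 * k) t) := ⟨⟨_, _, hne⟩⟩
  refine { eq_bot_or_eq_top := fun N => ?_ }
  by_cases hN : N = ⊥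
  · exact .inl hN
  right
  obtain ⟨φ, hφ, h0⟩ := Submodule.exists_mem_ne_zero_of_ne_bot hN
  obtain ⟨b, hb⟩ : ∃ b : TL q (t + 2 * k), (b • φ).1 (stdWalk k t) ≠ 0 := by
    by_contra hcon
    push Not at hcon
    exact h0 (eq_zero_of_forall_std hcon)
  -- `c_k` projects, up to `δ^k`, onto the line of the standard walk, so a nonzero value at that
  -- walk puts its indicator into `N`.
  have h1 := N.smul_mem (TL.cups q (t + 2 * k) k) (N.smul_mem b hφ)
  rw [cups_smul ht] at h1
  have hc : loopValue q ^ k * (b • φ).1 (stdWalk k t) ≠ 0 :=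
    mul_ne_zero (pow_ne_zero _ (loopValue_ne_zero hℓ hq)) hb
  have h2 := smul_mem_of_mem (loopValue q ^ k * (b • φ).1 (stdWalk k t))⁻¹ h1
  rw [smul_smul, inv_mul_cancel₀ hc, one_smul] at h2
  exact eq_top_of_std_mem ht h2

theorem exists_cups_smul (ht : t + 2 ≤ ℓ) :
    ∃ φ : WalkModule hℓ hq (t + 2 * k) t, TL.cups q (t + 2 * k) k • φ ≠ 0 := by
  refine ⟨single (IsWalk.std hℓ ht), fun h => ?_⟩
  rw [cups_smul ht] at h
  have := congrArg (fun φ : WalkModule hℓ hq (t + 2 * k) t => φ.1 (stdWalk k t)) h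
  simp only [smul_val, single_val, if_true, mul_one] at this
  exact pow_ne_zero _ (loopValue_ne_zero hℓ hq) this

/-- Both modules are simple with `c_k` as last nonvanishing cup product. The isomorphism is abstract
and is enough for dimensions and annihilators. -/
theorem nonempty_equiv_simpleHead (ht : t + 2 ≤ ℓ) :
    Nonempty (SimpleHead q t (t + 2 * k) ≃ₗ[TL q (t + 2 * k)]
      WalkModule hℓ hq (t + 2 * k) t) := by
  have hd := loopValue_ne_zero hℓ hq
  have := isSimpleModule (hℓ := hℓ) (hq := hq) (k := k) ht
  have := CellModule.isSimpleModule_simpleHead (q := q) (t := t) (k := k) hd rfl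
  exact TL.nonempty_equiv_of_cups (CellModule.cups_smul_simpleHead (by omega))
    (CellModule.exists_cups_smul_simpleHead hd rfl) cups_succ_smul (exists_cups_smul ht)

/-- The image vector is killed by the first `ℓ - 2` generators. This forces its support onto walks
that rise in each of the first `ℓ - 1` steps, but height `ℓ - 1` is outside the graph. -/
theorem isJonesWenzl_smul {n : ℕ} {t : ℤ} (hn : ℓ - 1 ≤ n) {E : TL q (ℓ - 1)} (hE : IsJonesWenzl E)
    (φ : WalkModule hℓ hq n t) : TL.incl q hn E • φ = 0 := by
  set ψ := TL.incl q hn E • φ with hψ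
  have hgen : ∀ i (hi : i < ℓ - 2), walkOp q i ψ.1 = 0 := by
    intro i hi
    have h1 := congrArg (TL.incl q hn) (hE.gen_mul ⟨i, by omega⟩)
    rw [map_mul, map_zero, TL.incl_gen] at h1
    rw [← genNat_smul_val (by omega), TL.genNat_of_lt (by omega), hψ, ← mul_smul]
    have h2 := congrArg (fun x => x • φ) h1
    simp only [zero_smul] at h2
    exact congrArg Subtype.val h2
  have key : ∀ m, m + 1 ≤ ℓ - 1 → ∀ a, IsWalk ℓ n t a → ψ.1 a ≠ 0 →
      ∀ j ≤ m + 1, a j = j := by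
    intro m
    induction m with
    | zero =>
      intro hm a ha _ j hj
      have h0 := ha.zero
      rcases (by omega : j = 0 ∨ j = 1) with rfl | rfl
      · exact h0
      · have := ha.step 0 (by omega)
        have := ha.nonneg 1
        rw [zero_add] at *
        push_cast
        omega
    | succ m ih =>
      intro hm a ha h0 j hj
      have e := ih (by omega) a ha h0
      rcases Nat.le_succ_iff.1 hj with hj | rfl
      · exact e j hj
      have em := e m (by omega)
      have em1 := e (m + 1) le_rfl
      rcases ha.step (m + 1) (by omega) with h | h
      · rw [Nat.succ_eq_add_one, h, em1]; push_cast; ring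
      · exfalso
        have h' : a m = a (m + 2) := by
          rw [show m + 2 = m + 1 + 1 from rfl, h, em, em1]; push_cast; ring
        have h1 := congrFun (hgen m (by omega)) a
        rw [walkOp_of_eq h', Pi.zero_apply] at h1
        -- The flipped walk descends at step `m + 1`, so by the induction hypothesis it is outside
        -- the support; the vanishing of `f_m ψ` at `a` then concerns `ψ a` alone.
        have h2 : ψ.1 (flipWalk m a) = 0 := by
          by_contra hne
          have hf : IsWalk ℓ n t (flipWalk m a) := by
            by_contra hf
            exact hne (ψ.2 _ hf)
          have := ih (by omega) _ hf hne (m + 1) le_rfl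
          rw [flipWalk_self, em, em1] at this
          push_cast at this
          omega
        rw [h2, add_zero] at h1
        exact (mul_eq_zero.1 h1).elim (ha.walkWeight_ne_zero hℓ hq m) h0
  refine ext' fun a ha => ?_
  by_contra h0
  have h1 := key (ℓ - 2) (by omega) a ha h0 (ℓ - 1) (by omega)
  have h2 := ha.le (ℓ - 1)
  omega

end WalkModule

/-! ### Counting walks -/

/-- The number of walks of length `n` from `0` to `t`. -/
def walkCount (ℓ n : ℕ) (t : ℤ) : ℕ := {a | IsWalk ℓ n t a}.ncard

theorem walkCount_eq_zero {ℓ n : ℕ} {t : ℤ} (h : ∀ a, ¬ IsWalk ℓ n t a) : walkCount ℓ n t = 0 := by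
  rw [walkCount, Set.eq_empty_of_forall_notMem (s := {a | IsWalk ℓ n t a}) h, Set.ncard_empty]

theorem walkCount_of_lt {ℓ n : ℕ} {t : ℤ} (h : n < t) : walkCount ℓ n t = 0 := by
  refine walkCount_eq_zero fun a ha => ?_
  have := ha.le_add 0 n (by omega)
  rw [zero_add, ha.tail n le_rfl, ha.zero] at this
  omega

theorem walkCount_of_neg {ℓ n : ℕ} {t : ℤ} (h : t < 0) : walkCount ℓ n t = 0 := by
  refine walkCount_eq_zero fun a ha => ?_
  have := ha.nonneg n
  rw [ha.tail n le_rfl] at this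
  omega

theorem walkCount_of_ge {ℓ n : ℕ} {t : ℤ} (h : (ℓ : ℤ) < t + 2) : walkCount ℓ n t = 0 := by
  refine walkCount_eq_zero fun a ha => ?_
  have := ha.le n
  rw [ha.tail n le_rfl] at this
  omega

theorem walkCount_zero {ℓ : ℕ} (hℓ : 2 ≤ ℓ) : walkCount ℓ 0 0 = 1 := by
  rw [walkCount, Set.ncard_eq_one]
  refine ⟨fun _ => 0, Set.ext fun a => ⟨fun ha => funext fun i => ha.tail i (Nat.zero_le i), ?_⟩⟩
  rintro rfl
  exact ⟨rfl, fun i hi => absurd hi (Nat.not_lt_zero i), fun _ => le_rfl, fun _ => by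
    show (0 : ℤ) + 2 ≤ ℓ
    omega, fun _ _ => rfl⟩

theorem walkCount_succ {ℓ n : ℕ} {t : ℤ} (h0 : 0 ≤ t) (h1 : t + 2 ≤ ℓ) :
    walkCount ℓ (n + 1) t = walkCount ℓ n (t - 1) + walkCount ℓ n (t + 1) := by
  -- Walks are continued by their final value, so adding a last step means overwriting every value
  -- after `n`.
  let extend : (ℕ → ℤ) → ℕ → ℤ := fun a i => if i ≤ n then a i else t
  have hext : ∀ (u : ℤ) a, (t = u + 1 ∨ t = u - 1) → IsWalk ℓ n u a →
      IsWalk ℓ (n + 1) t (extend a) := by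
    intro u a hu ha
    refine ⟨?_, fun i hi => ?_, fun i => ?_, fun i => ?_, fun i hi => ?_⟩
    · simp only [extend, if_pos (Nat.zero_le n)]; exact ha.zero
    · rcases Nat.lt_succ_iff_lt_or_eq.1 hi with hi | rfl
      · simp only [extend]
        rw [if_pos (by omega), if_pos (by omega)]
        exact ha.step i hi
      · simp only [extend]
        rw [if_neg (by omega), if_pos le_rfl, ha.tail i le_rfl]
        exact hu
    · simp only [extend]; split_ifs
      · exact ha.nonneg i
      · exact h0
    · simp only [extend]; split_ifs
      · exact ha.le i
      · exact h1
    · simp only [extend]; rw [if_neg (by omega)]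
  have himage : {a | IsWalk ℓ (n + 1) t a} =
      extend '' ({a | IsWalk ℓ n (t - 1) a} ∪ {a | IsWalk ℓ n (t + 1) a}) := by
    ext a
    constructor
    · intro (ha : IsWalk ℓ (n + 1) t a)
      have hr : ∀ u : ℤ, a n = u → IsWalk ℓ n u fun i => a (min i n) := by
        intro u hu
        refine ⟨?_, fun i hi => ?_, fun i => ha.nonneg _, fun i => ha.le _, fun i hi => ?_⟩
        · rw [Nat.zero_min]; exact ha.zero
        · rw [min_eq_left (by omega), min_eq_left (by omega)]
          exact ha.step i (by omega)
        · rw [min_eq_right hi, hu]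
      refine ⟨fun i => a (min i n), ?_, ?_⟩
      · have s := ha.step n (by omega)
        rw [ha.tail (n + 1) le_rfl] at s
        rcases s with s | s
        · exact .inl (hr _ (by omega))
        · exact .inr (hr _ (by omega))
      · funext i
        simp only [extend]
        split_ifs with h
        · rw [min_eq_left h]
        · rw [ha.tail i (by omega)]
    · rintro ⟨a, ha | ha, rfl⟩
      · exact hext _ a (.inl (by omega)) ha
      · exact hext _ a (.inr (by omega)) ha
  have htail : ∀ a ∈ {a | IsWalk ℓ n (t - 1) a} ∪ {a | IsWalk ℓ n (t + 1) a},
      ∀ i, n ≤ i → a i = a n := by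
    rintro a (ha | ha) i hi
    · rw [ha.tail i hi, ha.tail n le_rfl]
    · rw [ha.tail i hi, ha.tail n le_rfl]
  rw [walkCount, himage, Set.InjOn.ncard_image, Set.ncard_union_eq _ (IsWalk.finite _ _ _)
    (IsWalk.finite _ _ _)]
  · rfl
  · refine Set.disjoint_left.2 fun a ha hb => ?_
    have h1 := ha.tail n le_rfl
    have h2 := hb.tail n le_rfl
    omega
  · intro a ha b hb hab
    have key : ∀ i ≤ n, a i = b i := by
      intro i hi
      have := congrFun hab i
      simpa only [extend, if_pos hi] using this
    funext i
    by_cases hi : i ≤ n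
    · exact key i hi
    · rw [htail a ha i (by omega), htail b hb i (by omega), key n le_rfl]

/-- The functions on the walks, as a product. -/
def walkSpaceEquiv (ℓ n : ℕ) (t : ℤ) : walkSpace ℓ n t ≃ₗ[ℂ] ({a | IsWalk ℓ n t a} → ℂ) where
  toFun φ a := φ.1 a.1
  map_add' _ _ := rfl
  map_smul' _ _ := rfl
  invFun f := ⟨fun a => open Classical in if h : IsWalk ℓ n t a then f ⟨a, h⟩ else 0,
    fun _ ha => dif_neg ha⟩
  left_inv φ := by
    refine Subtype.ext (funext fun a => ?_)
    by_cases ha : IsWalk ℓ n t a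
    · exact dif_pos ha
    · rw [φ.2 a ha]; exact dif_neg ha
  right_inv f := funext fun a => dif_pos a.2

theorem finrank_walkSpace (ℓ n : ℕ) (t : ℤ) :
    Module.finrank ℂ (walkSpace ℓ n t) = walkCount ℓ n t := by
  have := (IsWalk.finite ℓ n t).fintype
  rw [(walkSpaceEquiv ℓ n t).finrank_eq, Module.finrank_fintype_fun_eq_card, walkCount,
    ← Nat.card_coe_set_eq, Nat.card_eq_fintype_card]

theorem finrank_simpleHead {q : ℂ} {ℓ : ℕ} (hℓ : 3 ≤ ℓ) (hq : orderOf (q ^ 2) = ℓ) {t : ℕ}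
    (ht : t + 2 ≤ ℓ) (k : ℕ) :
    Module.finrank ℂ (SimpleHead q t (t + 2 * k)) = walkCount ℓ (t + 2 * k) t := by
  obtain ⟨e⟩ := WalkModule.nonempty_equiv_simpleHead (hℓ := hℓ) (hq := hq) (k := k) ht
  rw [(e.restrictScalars ℂ).finrank_eq]
  exact finrank_walkSpace ℓ _ _

/-! ### Generating functions -/

/-- The convention `p_0 = 0` makes the recursion hold from the start. -/
theorem chebPoly_succ (i : ℕ) :
    (chebPoly (i + 2) : ℤ⟦X⟧) =
      (chebPoly (i + 1) : ℤ⟦X⟧) - PowerSeries.X * (chebPoly i : ℤ⟦X⟧) := by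
  rcases i with _ | i
  · simp [chebPoly]
  · rw [chebPoly, Polynomial.coe_sub, Polynomial.coe_mul, Polynomial.coe_X]

theorem constantCoeff_chebPoly (i : ℕ) :
    PowerSeries.constantCoeff (chebPoly (i + 1) : ℤ⟦X⟧) = 1 := by
  induction i with
  | zero => simp [chebPoly]
  | succ i ih => rw [chebPoly_succ, map_sub, ih, map_mul, PowerSeries.constantCoeff_X]; simp

theorem isUnit_chebPoly (i : ℕ) : IsUnit (chebPoly (i + 1) : ℤ⟦X⟧) := by
  rw [PowerSeries.isUnit_iff_constantCoeff, constantCoeff_chebPoly]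
  exact isUnit_one

/-- The generating function of the numbers of walks from `0` to `t`. -/
def walkSeries (ℓ t : ℕ) : ℤ⟦X⟧ := PowerSeries.mk fun k => (walkCount ℓ (t + 2 * k) t : ℤ)

theorem walkSeries_zero {ℓ : ℕ} (hℓ : 2 ≤ ℓ) :
    walkSeries ℓ 0 = 1 + PowerSeries.X * walkSeries ℓ 1 := by
  ext k
  rcases k with _ | k
  · simp [walkSeries, walkCount_zero hℓ]
  · rw [map_add, PowerSeries.coeff_succ_X_mul, walkSeries, walkSeries, PowerSeries.coeff_mk,
      PowerSeries.coeff_mk, PowerSeries.coeff_one, if_neg (by omega), zero_add,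
      zero_add, show 2 * (k + 1) = 1 + 2 * k + 1 by ring, walkCount_succ (by simp) (by simp; omega),
      walkCount_of_neg (by simp), zero_add]
    simp

theorem walkSeries_succ {ℓ t : ℕ} (h : t + 3 ≤ ℓ) :
    walkSeries ℓ (t + 1) = walkSeries ℓ t + PowerSeries.X * walkSeries ℓ (t + 2) := by
  have e1 : ((t + 1 : ℕ) : ℤ) - 1 = t := by push_cast; ring
  have e2 : ((t + 1 : ℕ) : ℤ) + 1 = (t + 2 : ℕ) := by push_cast; ring
  ext k
  rcases k with _ | k
  · rw [map_add, PowerSeries.coeff_zero_X_mul, walkSeries, walkSeries, PowerSeries.coeff_mk,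
      PowerSeries.coeff_mk, mul_zero, add_zero, add_zero,
      walkCount_succ (by omega) (by push_cast; omega), e1,
      walkCount_of_lt (t := ((t + 1 : ℕ) : ℤ) + 1) (by push_cast; omega), add_zero]
    rfl
  · rw [map_add, PowerSeries.coeff_succ_X_mul, walkSeries, walkSeries, walkSeries,
      PowerSeries.coeff_mk, PowerSeries.coeff_mk, PowerSeries.coeff_mk,
      show t + 1 + 2 * (k + 1) = t + 2 * (k + 1) + 1 by ring,
      walkCount_succ (by omega) (by push_cast; omega), e1, e2,
      show t + 2 + 2 * k = t + 2 * (k + 1) by ring]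
    push_cast
    rfl

theorem walkSeries_eq_zero {ℓ t : ℕ} (h : ℓ < t + 2) : walkSeries ℓ t = 0 := by
  ext k
  rw [walkSeries, PowerSeries.coeff_mk, walkCount_of_ge (by omega)]
  simp

/-- Solves the recurrence from the upper wall, by induction on the distance `d` to it: at `t = ℓ -
2` both sides vanish, since no walk ends at `ℓ - 1` and `p_0 = 0`. -/
theorem walkSeries_succ_mul {ℓ : ℕ} (d t : ℕ) (h : t + d + 2 = ℓ) :
    walkSeries ℓ (t + 1) * (chebPoly (d + 1) : ℤ⟦X⟧) = walkSeries ℓ t * (chebPoly d : ℤ⟦X⟧) := by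
  induction d generalizing t with
  | zero =>
    rw [walkSeries_eq_zero (by omega)]
    simp [chebPoly]
  | succ d ih =>
    have h1 := ih (t + 1) (by omega)
    have h2 := walkSeries_succ (ℓ := ℓ) (t := t) (by omega)
    have h3 := chebPoly_succ d
    linear_combination walkSeries ℓ (t + 1) * h3 +
      (chebPoly (d + 1) : ℤ⟦X⟧) * h2 + PowerSeries.X * h1

/-- The equation at the lower wall, with its extra `1` for the empty walk, fixes the remaining
factor; the ratios of neighbouring series then propagate it upwards. -/
theorem walkSeries_mul {ℓ t d : ℕ} (h : t + d + 2 = ℓ) :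
    walkSeries ℓ t * (chebPoly ℓ : ℤ⟦X⟧) = (chebPoly (d + 1) : ℤ⟦X⟧) := by
  induction t generalizing d with
  | zero =>
    obtain rfl : ℓ = d + 2 := by omega
    have h1 := walkSeries_succ_mul (ℓ := d + 2) d 0 (by omega)
    have h2 := walkSeries_zero (ℓ := d + 2) (by omega)
    have h3 := chebPoly_succ d
    rw [zero_add] at h1
    linear_combination walkSeries (d + 2) 0 * h3 + (chebPoly (d + 1) : ℤ⟦X⟧) * h2 +
      PowerSeries.X * h1
  | succ t ih =>
    have h1 := ih (d := d + 1) (by omega)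
    have h2 := walkSeries_succ_mul (ℓ := ℓ) (d + 1) t (by omega)
    refine (isUnit_chebPoly (d + 1)).mul_left_cancel ?_
    linear_combination (chebPoly ℓ : ℤ⟦X⟧) * h2 + (chebPoly (d + 1) : ℤ⟦X⟧) * h1

/-! ### Modules over the Jones quotient -/

section JonesQuotient

variable {q : ℂ} {m n : ℕ} {h : m ≤ n} {E : TL q m}

theorem jonesMk_surjective : Function.Surjective (jonesMk h E) :=
  RingCon.mk'_surjective _

theorem jonesMk_incl : jonesMk h E (TL.incl q h E) = 0 := by
  have : TL.incl q h E ∈ jonesIdeal h E := TwoSidedIdeal.subset_span rfl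
  exact (RingCon.eq _).2 ((TwoSidedIdeal.mem_iff _ _).1 this)

theorem jonesIdeal_ringCon_le {N : Type*} [AddCommGroup N] [Module (TL q n) N]
    (hN : ∀ v : N, TL.incl q h E • v = 0) :
    (jonesIdeal h E).ringCon ≤ RingCon.ker (Module.toAddMonoidEnd (TL q n) N) := by
  have h1 : jonesIdeal h E ≤ TwoSidedIdeal.ker (Module.toAddMonoidEnd (TL q n) N) := by
    refine TwoSidedIdeal.span_le.2 ?_
    rintro _ rfl
    rw [SetLike.mem_coe, TwoSidedIdeal.mem_ker]
    exact AddMonoidHom.ext hN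
  intro x y hxy
  have h2 := h1 ((TwoSidedIdeal.rel_iff _ _ _).1 hxy)
  rw [TwoSidedIdeal.mem_ker, map_sub, sub_eq_zero] at h2
  exact h2

/-- The module structure over the Jones quotient on a module killed by the idempotent. -/
abbrev jonesModule {N : Type*} [AddCommGroup N] [Module (TL q n) N]
    (hN : ∀ v : N, TL.incl q h E • v = 0) : Module (JonesQuotient h E) N :=
  Module.compHom N (RingCon.lift _ (Module.toAddMonoidEnd (TL q n) N) (jonesIdeal_ringCon_le hN))

theorem isSimpleModule_jones_iff {N : Type*} [AddCommGroup N] [Module (TL q n) N]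
    [Module (JonesQuotient h E) N] (hN : ∀ (a : TL q n) (v : N), jonesMk h E a • v = a • v) :
    IsSimpleModule (TL q n) N ↔ IsSimpleModule (JonesQuotient h E) N := by
  have : RingHomSurjective (jonesMk h E) := ⟨jonesMk_surjective⟩
  let l : N →ₛₗ[jonesMk h E] N :=
    { toFun := id, map_add' := fun _ _ => rfl, map_smul' := fun a v => (hN a v).symm }
  exact LinearMap.isSimpleModule_iff_of_bijective l Function.bijective_id

end JonesQuotient

/-! ### Simple modules of the Jones quotient and the final assembly -/

theorem incl_isJonesWenzl_smul_simpleHead {q : ℂ} {ℓ : ℕ} (hℓ : 3 ≤ ℓ) (hq : orderOf (q ^ 2) = ℓ)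
    {E : TL q (ℓ - 1)} (hE : IsJonesWenzl E) {t k : ℕ} (ht : t + 2 ≤ ℓ) (hn : ℓ - 1 ≤ t + 2 * k)
    (v : SimpleHead q t (t + 2 * k)) : TL.incl q hn E • v = 0 := by
  obtain ⟨e⟩ := WalkModule.nonempty_equiv_simpleHead (hℓ := hℓ) (hq := hq) (k := k) ht
  apply e.injective
  rw [map_smul, map_zero, WalkModule.isJonesWenzl_smul hn hE]

/-- The last nonvanishing cup product is an isomorphism invariant: if `s < t`, then `c_j` would kill
`L_t(n)` but not `L_s(n)`. -/
theorem simpleHead_index_le {q : ℂ} (hd : loopValue q ≠ 0) {n t s k j : ℕ} (ht : n = t + 2 * k)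
    (hs : n = s + 2 * j) (e : SimpleHead q t n ≃+ SimpleHead q s n)
    (he : ∀ (a : TL q n) v, e (a • v) = a • e v) : t ≤ s := by
  by_contra hlt
  obtain ⟨v, hv⟩ := CellModule.exists_cups_smul_simpleHead hd hs
  apply hv
  have := he (TL.cups q n j) (e.symm v)
  rw [CellModule.cups_smul_simpleHead (by omega), map_zero, e.apply_symm_apply] at this
  exact this.symm

theorem existsUnique_isInflation {q : ℂ} {ℓ : ℕ} (hℓ : 3 ≤ ℓ) (hq : orderOf (q ^ 2) = ℓ)
    {E : TL q (ℓ - 1)} (hE : IsJonesWenzl E) {n : ℕ} (hn : ℓ - 1 ≤ n) (M : Type*) [AddCommGroup M]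
    [Module (JonesQuotient hn E) M] (hM : IsSimpleModule (JonesQuotient hn E) M) :
    ∃! t : ℕ, (t ≤ n ∧ Even (t + n) ∧ t ≤ ℓ - 2) ∧ IsInflation hn E M (SimpleHead q t n) := by
  have hd := loopValue_ne_zero hℓ hq
  let _ : Module (TL q n) M := Module.compHom M (jonesMk hn E)
  have hsmul : ∀ (a : TL q n) (v : M), jonesMk hn E a • v = a • v := fun _ _ => rfl
  have hM' := (isSimpleModule_jones_iff hsmul).2 hM
  have := hM'.nontrivial
  obtain ⟨k, hk, h1, h2⟩ := TL.exists_max_cups (q := q) (n := n) M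
  obtain ⟨t, ht⟩ : ∃ t, n = t + 2 * k := ⟨n - 2 * k, by omega⟩
  have hsimple := CellModule.isSimpleModule_simpleHead hd ht
  obtain ⟨e⟩ := TL.nonempty_equiv_of_cups h1 h2
    (CellModule.cups_smul_simpleHead (q := q) (t := t) (by omega))
    (CellModule.exists_cups_smul_simpleHead hd ht)
  refine ⟨t, ⟨⟨by omega, ⟨t + k, by omega⟩, ?_⟩, e.toAddEquiv, fun a x => ?_⟩, ?_⟩
  -- `E` is zero in the quotient, hence on `M`, but acts nontrivially on `L_t(n)` once `t ≥ ℓ - 1`.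
  · by_contra hlt
    obtain ⟨v, hv⟩ := hE.exists_smul_simpleHead hd ht (by omega) hn
    apply hv
    rw [← e.apply_symm_apply v, ← map_smul, ← hsmul, jonesMk_incl, zero_smul, map_zero]
  · exact map_smul e a x
  · rintro s ⟨⟨hs, ⟨r, hr⟩, _⟩, e', he'⟩
    have hs' : n = s + 2 * (r - s) := by omega
    have he : ∀ (a : TL q n) v, (e.toAddEquiv.symm.trans e') (a • v) =
        a • (e.toAddEquiv.symm.trans e') v := fun a v => by
      change e' (e.symm (a • v)) = a • e' (e.symm v)
      rw [map_smul, ← hsmul, he']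
    have he2 : ∀ (a : TL q n) v, (e'.symm.trans e.toAddEquiv) (a • v) =
        a • (e'.symm.trans e.toAddEquiv) v := fun a v => by
      change e (e'.symm (a • v)) = a • e (e'.symm v)
      rw [← map_smul]
      congr 1
      apply e'.injective
      rw [e'.apply_symm_apply, ← hsmul, he', e'.apply_symm_apply]
    exact le_antisymm (simpleHead_index_le hd hs' ht _ he2) (simpleHead_index_le hd ht hs' _ he)

theorem mainTheorem3 (q : ℂ) (ℓ : ℕ) (hℓ : 3 ≤ ℓ) (hq : orderOf (q ^ 2) = ℓ) :
    -- the Jones-Wenzl idempotent of `TL_{ℓ-1}(q)` exists and is unique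
    (∃! E : TL q (ℓ - 1), IsJonesWenzl E) ∧
    (∀ E : TL q (ℓ - 1), IsJonesWenzl E → ∀ (n : ℕ) (hn : ℓ - 1 ≤ n),
      -- `L_t(n)` is a simple `TL_n(q)`-module; its structure descends to that of a (simple) module
      -- of the Jones quotient if and only if `t ≤ ℓ - 2`
      (∀ t : ℕ, t ≤ n → Even (t + n) →
        IsSimpleModule (TL q n) (SimpleHead q t n) ∧
        ((∃ _ : Module (JonesQuotient hn E) (SimpleHead q t n),
            (∀ (a : TL q n) (v : SimpleHead q t n), jonesMk hn E a • v = a • v) ∧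
            IsSimpleModule (JonesQuotient hn E) (SimpleHead q t n)) ↔ t ≤ ℓ - 2)) ∧
      -- each simple module of the Jones quotient is `L_t(n)` for exactly one of these `t`
      (∀ (M : Type*) [AddCommGroup M] [Module (JonesQuotient hn E) M],
        IsSimpleModule (JonesQuotient hn E) M →
        ∃! t : ℕ, (t ≤ n ∧ Even (t + n) ∧ t ≤ ℓ - 2) ∧
          IsInflation hn E M (SimpleHead q t n))) ∧
    -- the generating function of the dimensions is `p_{ℓ-1-t}(x) / p_ℓ(x)`
    IsUnit (chebPoly ℓ : ℤ⟦X⟧) ∧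
    (∀ t : ℕ, t ≤ ℓ - 2 →
      PowerSeries.mk (fun k => (Module.finrank ℂ (SimpleHead q t (t + 2 * k)) : ℤ)) *
        (chebPoly ℓ : ℤ⟦X⟧) = (chebPoly (ℓ - 1 - t) : ℤ⟦X⟧)) := by
  refine ⟨TL.isJonesWenzl_existsUnique hℓ hq, fun E hE n hn => ⟨fun t ht hpar => ?_,
    fun M _ _ hM => existsUnique_isInflation hℓ hq hE hn M hM⟩, ?_, fun t ht => ?_⟩
  · have hd := loopValue_ne_zero hℓ hq
    obtain ⟨k, rfl⟩ : ∃ k, n = t + 2 * k := by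
      obtain ⟨r, hr⟩ := hpar
      exact ⟨r - t, by omega⟩
    have hsimple := CellModule.isSimpleModule_simpleHead (q := q) (t := t) (k := k) hd rfl
    refine ⟨hsimple, ?_, fun ht' => ?_⟩
    · rintro ⟨_, hsmul, _⟩
      by_contra hlt
      obtain ⟨v, hv⟩ := hE.exists_smul_simpleHead (k := k) hd rfl (by omega) hn
      exact hv (by rw [← hsmul, jonesMk_incl, zero_smul])
    · let inst : Module (JonesQuotient hn E) (SimpleHead q t (t + 2 * k)) :=
        jonesModule (incl_isJonesWenzl_smul_simpleHead hℓ hq hE (by omega) hn)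
      have hsmul : ∀ (a : TL q (t + 2 * k)) (v : SimpleHead q t (t + 2 * k)),
          jonesMk hn E a • v = a • v := fun _ _ => rfl
      exact ⟨inst, hsmul, (isSimpleModule_jones_iff hsmul).1 hsimple⟩
  · obtain ⟨i, rfl⟩ : ∃ i, ℓ = i + 1 := ⟨ℓ - 1, by omega⟩
    exact isUnit_chebPoly i
  · obtain ⟨d, rfl⟩ : ∃ d, ℓ = t + d + 2 := ⟨ℓ - t - 2, by omega⟩
    simp only [finrank_simpleHead hℓ hq (show t + 2 ≤ t + d + 2 by omega)]
    rw [show t + d + 2 - 1 - t = d + 1 by omega]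
    exact walkSeries_mul rfl

end
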